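/- \textbf{Notation.} Let $m\ge 2$. $\mathcal M_m^{\otimes n}$ and $\mathcal H_m^{\otimes n}$ are the spaces of linear, resp. Hermitian, operators on $(\mathbb C^m)^{\otimes n}$ (for $n=0$: $\mathbb C$, resp. $\mathbb R$); for $H\subseteq[n]$ with $|H|=h$, $\mathcal H_m^{\otimes h}$ stands for the operators on the registers in $H$. On $D\times D$ matrices put $\langle P,Q\rangle=\frac1D\operatorname{Tr}P^\dagger Q$ and $|||P|||_2=\langle P,P\rangle^{1/2}$. A standard orthonormal basis of $\mathcal M_m$ is an orthonormal basis $\mathcal B_0,\dots,\mathcal B_{m^2-1}$ of Hermitian matrices with $\mathcal B_0=1$. For $\sigma\in\{0,\dots,m^2-1\}^n$ let $|\sigma|=|\{i:\sigma_i\ne0\}|$, $\mathcal B_\sigma=\bigotimes_i\mathcal B_{\sigma_i}$, $\widehat M(\sigma)=\langle\mathcal B_\sigma,M\rangle$; $\deg M=\max\{|\sigma|:\widehat M(\sigma)\neq0\}$ (with $\deg 0=0$), $M^{\le d}=\sum_{|\sigma|\le d}\widehat M(\sigma)\mathcal B_\sigma$, $M^{>d}=M-M^{\le d}$ (none of these depends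 on the basis). For $S\subseteq[n]$ let $P_S=m^{-|S^c|}\operatorname{Tr}_{S^c}P$, and let $\mathrm{Inf}_i(P)=\langle 1,(P^\dagger P)_{\{i\}^c}-(P_{\{i\}^c})^\dagger P_{\{i\}^c}\rangle$. Let $\zeta(x)=x^2$ for $x\le0$ and $\zeta(x)=0$ for $x>0$, applied to Hermitian operators through the spectral decomposition. Let $\mathbf g_{i,0}=1$ and let $\mathbf g_{i,j}$ ($1\le i\le n$, $1\le j\le m^2-1$) be i.i.d. standard Gaussians. $\gamma_N$ is the standard Gaussian measure on $\mathbb R^N$, and $\mathcal G_\rho$ is the centered Gaussian law on $\mathbb R^2$ with unit variances and covariance $\rho$. A random operator $\mathbf P\in L^2(\mathcal H_m^{\otimes h},\gamma_N)$ is a function $\mathbf P=\sum_\sigma p_\sigma\mathcal B_\sigma$ on $\mathbb R^N$ with real $p_\sigma\in L^2(\gamma_N)$; it is multilinear, of degree at most $d$, if the Hermite coefficients $\widehat{p_\sigma}(\tau)$, $\tau\in\mathbb Z_{\ge0}^N$, vanish unless $\tau\in\{0,1\}^N$ and $\sum_i\tau_i\le d$; $N_2(\mathbf P)=(\mathbb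 E\,|||\mathbf P|||_2^2)^{1/2}$. An $m$-dimensional noisy maximally entangled state (MES) is a density operator $\psi_{AB}$ on $\mathbb C^m\otimes\mathbb C^m$ with $\psi_A=\psi_B=1/m$ and maximal correlation $\rho(\psi_{AB})=\sup\{|\operatorname{Tr}((P^\dagger\otimes Q)\psi_{AB})|:\operatorname{Tr}P=\operatorname{Tr}Q=0,\ |||P|||_2=|||Q|||_2=1\}<1$. \textbf{Statement.} There is an absolute constant $C>0$ such that the following hold, all the expectations being those of integrable random variables. (1) Let $m\ge2$, $n\ge0$, $M\in\mathcal H_m^{\otimes n}$, $d=\deg M$, let $\{\mathcal B_i\}_{i=0}^{m^2-1}$ be a standard orthonormal basis of $\mathcal M_m$, $\lambda>0$, $H\subseteq[n]$ and $h=|H|$. Then $$\Big|\mathbb E\Big[\tfrac1{m^h}\operatorname{Tr}\zeta\Big(\sum_{\sigma}\widehat M(\sigma)\prod_{i\notin H}\mathbf g_{i,\sigma_i}\bigotimes_{i\in H}\mathcal B_{\sigma_i}\Big)\Big]-\tfrac1{m^n}\operatorname{Tr}\zeta(M)\Big|\le C\Big(\lambda^2+\frac{3^dm^{d/2}}{\lambda}\sum_{i\notin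 H}\mathrm{Inf}_i(M)^{3/2}\Big).$$ (2) Let $m\ge2$, $n\ge0$, $d\ge1$, $0<\tau<1$, $M\in\mathcal H_m^{\otimes n}$, $H\subseteq[n]$, $h=|H|$, and let $\{\mathcal B_i\}$ be a standard orthonormal basis of $\mathcal M_m$. Suppose $|||M|||_2\le1$ and $\mathrm{Inf}_i(M)\le\tau$ for all $i\notin H$. Put $\mathbf M=\sum_{|\sigma|\le d}\widehat M(\sigma)\prod_{i\notin H}\mathbf g_{i,\sigma_i}\bigotimes_{i\in H}\mathcal B_{\sigma_i}$. Then $$\Big|\tfrac1{m^h}\mathbb E[\operatorname{Tr}\zeta(\mathbf M)]-\tfrac1{m^n}\operatorname{Tr}\zeta(M^{\le d})\Big|\le C\big(3^dm^{d/2}\sqrt\tau\,d\big)^{2/3}.$$ (3) Let $0<\tau,\delta<1$, $n>h\ge0$, $d\ge1$, $m\ge2$, $H\subseteq[n]$ with $|H|=h$, $N=2(m^2-1)(n-h)$, and let $\psi_{AB}$ be an $m$-dimensional noisy MES with $\rho=\rho(\psi_{AB})>0$. There are maps $f,f':\mathcal H_m^{\otimes n}\times\mathbb R^N\to\mathcal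 H_m^{\otimes h}$ such that $f(P,\cdot),f'(P,\cdot)\in L^2(\mathcal H_m^{\otimes h},\gamma_N)$ for every $P\in\mathcal H_m^{\otimes n}$; for every $x\in\mathbb R^N$ the maps $f(\cdot,x)$ and $f'(\cdot,x)$ are linear and unital; and the following holds. Let $P,Q\in\mathcal H_m^{\otimes n}$ with $0\le P,Q\le1$, $\mathrm{Inf}_i(P)\le\tau$ and $\mathrm{Inf}_i(Q)\le\tau$ for all $i\notin H$, $|||P^{>d}|||_2^2\le\delta$ and $|||Q^{>d}|||_2^2\le\delta$, and put $(\mathbf P,\mathbf Q)=(f(P,\mathbf g),f'(Q,\mathbf h))$ with $(\mathbf g,\mathbf h)\sim\mathcal G_\rho^{\otimes N}$. Then $\mathbf P$ and $\mathbf Q$ are multilinear of degree at most $d$, and (a) $N_2(\mathbf P)\le|||P|||_2$ and $N_2(\mathbf Q)\le|||Q|||_2$; (b) $\big|\operatorname{Tr}((P\otimes Q)\psi_{AB}^{\otimes n})-\mathbb E\operatorname{Tr}((\mathbf P\otimes\mathbf Q)\psi_{AB}^{\otimes h})\big|\le\delta$; (c) $\mathbb E\operatorname{Tr}\zeta(\mathbf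 P)$ and $\mathbb E\operatorname{Tr}\zeta(\mathbf Q)$ are both at most $C\,m^h\big((3^dm^{d/2}\sqrt\tau\,d)^{2/3}+\sqrt\delta\big)$. -/

import Mathlib

open MeasureTheory ProbabilityTheory
open scoped Kronecker ComplexOrder

noncomputable section

namespace QuantumInvariance

/-! ### Operators on several registers -/

/-- `𝓜_m^{⊗ι}`: linear operators on registers labelled by `ι`, each of dimension `m`, written in
the product basis, whose elements are the functions `ι → Fin m`. -/
abbrev Op (m : ℕ) (ι : Type) : Type := Matrix (ι → Fin m) (ι → Fin m) ℂ

/-- `𝓗_m^{⊗ι}`: the real vector space of Hermitian operators on the registers `ι`. -/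
abbrev HermOp (m : ℕ) (ι : Type) [Fintype ι] [DecidableEq ι] : Type := selfAdjoint (Op m ι)

/-- The normalized inner product `⟨P, Q⟩ = (1 / dim) Tr (P† Q)`. -/
def ninner {κ : Type} [Fintype κ] (P Q : Matrix κ κ ℂ) : ℂ :=
  (Fintype.card κ : ℂ)⁻¹ * (P.conjTranspose * Q).trace

/-- The normalized Schatten 2-norm. -/
def nnorm2 {κ : Type} [Fintype κ] (P : Matrix κ κ ℂ) : ℝ := Real.sqrt (ninner P P).re

/-- A standard orthonormal basis of `𝓜_m`: `m ^ 2` Hermitian matrices (so as many as the dimension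
of `𝓜_m`), orthonormal for `ninner`, the one of index `0` being the identity. -/
structure IsStdBasis (m : ℕ) (B : Fin (m ^ 2) → Matrix (Fin m) (Fin m) ℂ) : Prop where
  isHermitian : ∀ i, (B i).IsHermitian
  orthonormal : ∀ i j, ninner (B i) (B j) = if i = j then 1 else 0
  eq_one : ∀ i : Fin (m ^ 2), (i : ℕ) = 0 → B i = 1

section Fourier

variable {m : ℕ} {ι : Type} [Fintype ι]

/-- The tensor product `𝓑_σ = ⨂_i 𝓑_{σ i}`. -/
def tensorBasis (B : Fin (m ^ 2) → Matrix (Fin m) (Fin m) ℂ) (σ : ι → Fin (m ^ 2)) : Op m ι :=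
  Matrix.of fun a b => ∏ i, B (σ i) (a i) (b i)

/-- `|σ|`, the number of nonzero entries. -/
def wtNZ (σ : ι → Fin (m ^ 2)) : ℕ := (Finset.univ.filter fun i => (σ i : ℕ) ≠ 0).card

variable [DecidableEq ι]

/-- The Fourier coefficient of `M` at `σ` with respect to the basis `B`. -/
def fourierCoeff (B : Fin (m ^ 2) → Matrix (Fin m) (Fin m) ℂ) (M : Op m ι)
    (σ : ι → Fin (m ^ 2)) : ℂ :=
  ninner (tensorBasis B σ) M

open Classical in
/-- The degree of `M`: the largest `|σ|` with a nonzero Fourier coefficient (`0` if `M = 0`). -/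
def opDegree (B : Fin (m ^ 2) → Matrix (Fin m) (Fin m) ℂ) (M : Op m ι) : ℕ :=
  (Finset.univ.filter fun σ : ι → Fin (m ^ 2) => fourierCoeff B M σ ≠ 0).sup wtNZ

/-- `M^{≤ t}`. -/
def lowDegree (B : Fin (m ^ 2) → Matrix (Fin m) (Fin m) ℂ) (M : Op m ι) (t : ℕ) : Op m ι :=
  ∑ σ ∈ Finset.univ.filter (fun σ : ι → Fin (m ^ 2) => wtNZ σ ≤ t),
    fourierCoeff B M σ • tensorBasis B σ

/-- `M^{> t}`. -/
def highDegree (B : Fin (m ^ 2) → Matrix (Fin m) (Fin m) ℂ) (M : Op m ι) (t : ℕ) : Op m ι :=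
  ∑ σ ∈ Finset.univ.filter (fun σ : ι → Fin (m ^ 2) => t < wtNZ σ),
    fourierCoeff B M σ • tensorBasis B σ

/-- `P_S = m^{-|Sᶜ|} Tr_{Sᶜ} P`, the normalized partial trace over the registers outside `S`. -/
def reduced (S : Finset ι) (P : Op m ι) : Op m {i // i ∈ S} :=
  Matrix.of fun a a' =>
    ((m : ℂ) ^ Sᶜ.card)⁻¹ * ∑ b : {i // i ∉ S} → Fin m,
      P ((Equiv.piEquivPiSubtypeProd (fun i => i ∈ S) fun _ => Fin m).symm (a, b))
        ((Equiv.piEquivPiSubtypeProd (fun i => i ∈ S) fun _ => Fin m).symm (a', b))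

/-- `Var_S[P] = (P† P)_{Sᶜ} - (P_{Sᶜ})† P_{Sᶜ}`. -/
def varOp (S : Finset ι) (P : Op m ι) : Op m {i // i ∈ Sᶜ} :=
  reduced Sᶜ (P.conjTranspose * P) - (reduced Sᶜ P).conjTranspose * reduced Sᶜ P

/-- The influence `Inf_i(P) = ⟨1, Var_{i}[P]⟩`. -/
def influence (i : ι) (P : Op m ι) : ℝ := (ninner 1 (varOp {i} P)).re

end Fourier

/-! ### The function `ζ` -/

/-- `ζ(x) = x²` for `x ≤ 0` and `0` otherwise. -/
def zeta (x : ℝ) : ℝ := if x ≤ 0 then x ^ 2 else 0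

/-- `Tr ζ(P)` for a Hermitian matrix `P`, where `ζ(P)` applies `ζ` to the eigenvalues. -/
def trZeta {κ : Type} [Fintype κ] [DecidableEq κ] (P : Matrix κ κ ℂ) : ℝ :=
  (cfc zeta P).trace.re

/-! ### Gaussian space -/

/-- The standard Gaussian measure on `ℝ^N`. -/
def gaussN (N : ℕ) : Measure (Fin N → ℝ) := Measure.pi fun _ => gaussianReal 0 1

/-- `𝒢_ρ`: the centered Gaussian measure on `ℝ²` with unit variances and covariance `ρ`, as the law
of `(x, ρ x + √(1 - ρ²) y)` for independent standard Gaussians `x`, `y`. -/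
def corrGauss (ρ : ℝ) : Measure (ℝ × ℝ) :=
  ((gaussianReal 0 1).prod (gaussianReal 0 1)).map
    fun z => (z.1, ρ * z.1 + Real.sqrt (1 - ρ ^ 2) * z.2)

/-- `𝒢_ρ^{⊗ N}`. -/
def corrGaussN (ρ : ℝ) (N : ℕ) : Measure (Fin N → ℝ × ℝ) := Measure.pi fun _ => corrGauss ρ

/-- The multivariate normalized Hermite polynomial `H_τ(x) = ∏_i H_{τ i}(x i)`. -/
def hermiteFn {N : ℕ} (τ : Fin N → ℕ) (x : Fin N → ℝ) : ℝ :=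
  ∏ i, Polynomial.aeval (x i) (Polynomial.hermite (τ i)) / Real.sqrt ((τ i).factorial : ℝ)

/-- The Hermite coefficient `⟨H_τ, f⟩` of `f ∈ L²(ℂ, γ_N)`. -/
def hermiteCoeff {N : ℕ} (f : (Fin N → ℝ) → ℂ) (τ : Fin N → ℕ) : ℂ :=
  ∫ x, (hermiteFn τ x : ℂ) * f x ∂gaussN N

/-- All Hermite coefficients outside `{0,1}^N` vanish. -/
def IsMultilinear {N : ℕ} (f : (Fin N → ℝ) → ℂ) : Prop :=
  ∀ τ : Fin N → ℕ, (∃ i, 1 < τ i) → hermiteCoeff f τ = 0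

/-- The degree of `f`, the supremum of `∑ i, τ i` over the nonzero Hermite coefficients. -/
def hermiteDegree {N : ℕ} (f : (Fin N → ℝ) → ℂ) : ℕ∞ :=
  ⨆ (τ : Fin N → ℕ) (_ : hermiteCoeff f τ ≠ 0), ((∑ i, τ i : ℕ) : ℕ∞)

/-! ### Random operators: operator-valued functions of a standard Gaussian vector -/

section RandomOperator

variable {m N : ℕ} {ι : Type} [Fintype ι] [DecidableEq ι]

/-- `R ∈ L²(𝓗_m^{⊗ι}, γ_N)`: the coordinates of `R` in the basis `B` are in `L²(γ_N)` (they are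
real because the values of `R` are Hermitian). -/
def IsL2 (B : Fin (m ^ 2) → Matrix (Fin m) (Fin m) ℂ) (R : (Fin N → ℝ) → HermOp m ι) : Prop :=
  ∀ σ, MemLp (fun x => fourierCoeff B (R x : Op m ι) σ) 2 (gaussN N)

/-- `R` is multilinear: all its coordinates are. -/
def RandIsMultilinear (B : Fin (m ^ 2) → Matrix (Fin m) (Fin m) ℂ)
    (R : (Fin N → ℝ) → HermOp m ι) : Prop :=
  ∀ σ, IsMultilinear fun x => fourierCoeff B (R x : Op m ι) σ

/-- The degree of `R`: the largest degree of its coordinates. -/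
def randDegree (B : Fin (m ^ 2) → Matrix (Fin m) (Fin m) ℂ)
    (R : (Fin N → ℝ) → HermOp m ι) : ℕ∞ :=
  ⨆ σ, hermiteDegree fun x => fourierCoeff B (R x : Op m ι) σ

/-- `N_2(R) = (𝔼 ‖R‖₂²)^{1/2}` with the normalized 2-norm. -/
def randNorm2 (R : (Fin N → ℝ) → HermOp m ι) : ℝ :=
  Real.sqrt (∫ x, nnorm2 (R x : Op m ι) ^ 2 ∂gaussN N)

end RandomOperator

/-! ### Replacing the registers outside `H` by Gaussian variables -/

section Replacement

variable {m n : ℕ}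

/-- The law of a family `ω i j` of independent standard Gaussians. -/
def gaussFamily (m n : ℕ) : Measure (Fin n → Fin (m ^ 2) → ℝ) :=
  Measure.pi fun _ => Measure.pi fun _ => gaussianReal 0 1

/-- `𝐠_{i,0} = 1`, and `𝐠_{i,j}` for `j ≠ 0` are independent standard Gaussians. -/
def gvar (ω : Fin n → Fin (m ^ 2) → ℝ) (i : Fin n) (j : Fin (m ^ 2)) : ℝ :=
  if (j : ℕ) = 0 then 1 else ω i j

/-- `∏_{i ∉ H} 𝐠_{i, σ i} · ⨂_{i ∈ H} 𝓑_{σ i}`, an operator on the registers in `H`. -/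
def hybridBasis (B : Fin (m ^ 2) → Matrix (Fin m) (Fin m) ℂ) (H : Finset (Fin n))
    (ω : Fin n → Fin (m ^ 2) → ℝ) (σ : Fin n → Fin (m ^ 2)) : Op m {i // i ∈ H} :=
  ((∏ i ∈ Hᶜ, gvar ω i (σ i) : ℝ) : ℂ) • tensorBasis B fun i : {i // i ∈ H} => σ i

/-- `∑_σ M̂(σ) ∏_{i ∉ H} 𝐠_{i, σ i} ⨂_{i ∈ H} 𝓑_{σ i}`. -/
def hybrid (B : Fin (m ^ 2) → Matrix (Fin m) (Fin m) ℂ) (H : Finset (Fin n)) (M : Op m (Fin n))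
    (ω : Fin n → Fin (m ^ 2) → ℝ) : Op m {i // i ∈ H} :=
  ∑ σ, fourierCoeff B M σ • hybridBasis B H ω σ

/-- The same sum restricted to `|σ| ≤ d`. -/
def hybridLow (B : Fin (m ^ 2) → Matrix (Fin m) (Fin m) ℂ) (H : Finset (Fin n)) (d : ℕ)
    (M : Op m (Fin n)) (ω : Fin n → Fin (m ^ 2) → ℝ) : Op m {i // i ∈ H} :=
  ∑ σ ∈ Finset.univ.filter (fun σ : Fin n → Fin (m ^ 2) => wtNZ σ ≤ d),
    fourierCoeff B M σ • hybridBasis B H ω σ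

end Replacement

/-! ### Bipartite states -/

section States

variable {m : ℕ}

/-- `ψ_A = Tr_B ψ`. -/
def margA (ψ : Matrix (Fin m × Fin m) (Fin m × Fin m) ℂ) : Matrix (Fin m) (Fin m) ℂ :=
  Matrix.of fun a a' => ∑ b, ψ (a, b) (a', b)

/-- `ψ_B = Tr_A ψ`. -/
def margB (ψ : Matrix (Fin m × Fin m) (Fin m × Fin m) ℂ) : Matrix (Fin m) (Fin m) ℂ :=
  Matrix.of fun b b' => ∑ a, ψ (a, b) (a, b')

/-- The quantum maximal correlation of `ψ`. -/
def maxCorr (ψ : Matrix (Fin m × Fin m) (Fin m × Fin m) ℂ) : ℝ :=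
  sSup {r | ∃ P Q : Matrix (Fin m) (Fin m) ℂ, P.trace = 0 ∧ Q.trace = 0 ∧
    nnorm2 P = 1 ∧ nnorm2 Q = 1 ∧ r = ‖((P.conjTranspose ⊗ₖ Q) * ψ).trace‖}

/-- A noisy maximally entangled state: a density operator with maximally mixed marginals and maximal
correlation less than one. -/
structure IsNoisyMES (ψ : Matrix (Fin m × Fin m) (Fin m × Fin m) ℂ) : Prop where
  posSemidef : ψ.PosSemidef
  trace_eq_one : ψ.trace = 1
  margA_eq : margA ψ = (m : ℂ)⁻¹ • (1 : Matrix (Fin m) (Fin m) ℂ)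
  margB_eq : margB ψ = (m : ℂ)⁻¹ • (1 : Matrix (Fin m) (Fin m) ℂ)
  maxCorr_lt_one : maxCorr ψ < 1

/-- `ψ^{⊗ι}`, with all the `A` registers grouped before all the `B` registers, so that it acts on
the same space as `P ⊗ₖ Q` for `P Q : Op m ι`. -/
def tensorState (ψ : Matrix (Fin m × Fin m) (Fin m × Fin m) ℂ) (ι : Type) [Fintype ι] :
    Matrix ((ι → Fin m) × (ι → Fin m)) ((ι → Fin m) × (ι → Fin m)) ℂ :=
  Matrix.of fun x y => ∏ i, ψ (x.1 i, x.2 i) (y.1 i, y.2 i)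

/-- `Tr ((P ⊗ Q) ψ^{⊗ι})`. -/
def corrValue {ι : Type} [Fintype ι] [DecidableEq ι]
    (ψ : Matrix (Fin m × Fin m) (Fin m × Fin m) ℂ) (P Q : Op m ι) : ℂ :=
  ((P ⊗ₖ Q) * tensorState ψ ι).trace

end States

end QuantumInvariance

end

open QuantumInvariance

/-! The function `zeta` is a quadratic minus a superposition of resolvents: ζ(x) = x²/2 − π⁻¹ ∫₀^∞
x³/(x²+t²) dt, where x³/(x²+t²) = x − t² Re (x − it)⁻¹. Hence the normalized trace of ζ(X) is
determined by the first two moments of X and the normalized traces of (X − it)⁻¹ (`specAvg_zeta`).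
The expected first two moments of a hybrid are functions of the Fourier coefficients alone,
whichever registers are Gaussian, so only resolvents have to be compared, and ζ needs no smoothing.

The comparison is Lindeberg's, one register at a time, with all hybrids put on the same space by
tensoring with identities. When register i is exchanged, the hybrid is 1 ⊗ X plus a perturbation Y
whose mean squared norm is Inf_i. The resolvent of 1 ⊗ X is 1 ⊗ R, so up to second order register i
enters only through tr 𝓑_j and tr 𝓑_j𝓑_k, which agree with E g_j and E g_j g_k. The remainder is an
exact product of resolvents, bounded by Cauchy–Schwarz and ‖R‖ ≤ 1/t by t⁻⁴ ‖Y‖₂ ‖Y²‖₂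
(`norm_ntr_res_taylor_le`).

Hypercontractivity, `sqrt_N4_le`, bounds E‖Y²‖₂² by ((3√m)^d Inf_i)², so one exchange costs a
constant times t⁻⁴ (3√m)^d Inf_i^{3/2}. It is proved by induction on the registers for quartic forms
in which each register is either quantum or Gaussian. All that is used of a local tensor is that it
is cyclic and a Gram matrix; this gives Hölder's inequality `norm_T4_le` for every mixture.

With S the total of these costs without t⁻⁴, the integrands for two hybrids differ by at most 2t
(trivially) and at most S/t² (Lindeberg). Cutting the integral at t = λ gives λ² + S/λ, which is the
first claim. The second follows by optimizing λ, since an operator of degree at most d and norm at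
most 1 has total influence at most d.

For the joint claim, a real singular value decomposition gives two standard bases in which the
correlations of ψ are diagonal, with entries c_j, |c_j| ≤ ρ for j ≠ 0 (`exists_diagonal_bases`).
Each nontrivial pair (i, j) outside H receives two Gaussian coordinates. The first operator uses the
first of them, the second uses (c_j/ρ) times the first plus an independent correction, so their
covariance is exactly c_j. Thus low-degree correlations are preserved exactly and only the tails
cost δ. Finally, the negative part of P^{≤d} is controlled by its distance to the positive operator
P (`trZeta_le_nsq_sub`), that is, by the tail again. -/

noncomputable section
set_option linter.unusedSectionVars false
namespace QuantumInvariance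

/-! ### Normalized trace and normalized Frobenius norm -/

section Trace

variable {κ κ' : Type} [Fintype κ] [Fintype κ']

/-- The normalized trace. -/
def ntr (A : Matrix κ κ ℂ) : ℂ := (Fintype.card κ : ℂ)⁻¹ * A.trace

/-- The square of the normalized Frobenius norm. -/
def nsq (A : Matrix κ κ ℂ) : ℝ := (ntr (A.conjTranspose * A)).re

theorem ninner_eq_ntr (P Q : Matrix κ κ ℂ) : ninner P Q = ntr (P.conjTranspose * Q) := rfl

theorem ntr_add (A B : Matrix κ κ ℂ) : ntr (A + B) = ntr A + ntr B := by
  simp [ntr, mul_add]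

theorem ntr_sub (A B : Matrix κ κ ℂ) : ntr (A - B) = ntr A - ntr B := by
  simp [ntr, mul_sub]

theorem ntr_smul (c : ℂ) (A : Matrix κ κ ℂ) : ntr (c • A) = c * ntr A := by
  simp [ntr, mul_left_comm]

theorem ntr_sum {J : Type*} (s : Finset J) (A : J → Matrix κ κ ℂ) :
    ntr (∑ j ∈ s, A j) = ∑ j ∈ s, ntr (A j) := by
  simp [ntr, Matrix.trace_sum, Finset.mul_sum]

theorem ntr_mul_comm (A B : Matrix κ κ ℂ) : ntr (A * B) = ntr (B * A) := by
  simp [ntr, Matrix.trace_mul_comm A B]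

theorem ntr_conjTranspose (A : Matrix κ κ ℂ) : ntr A.conjTranspose = star (ntr A) := by
  simp [ntr, Matrix.trace_conjTranspose]

theorem ntr_submatrix (e : κ' ≃ κ) (A : Matrix κ κ ℂ) : ntr (A.submatrix e e) = ntr A := by
  have : (A.submatrix e e).trace = A.trace := by
    simp only [Matrix.trace, Matrix.diag, Matrix.submatrix_apply]
    exact Equiv.sum_comp e fun i => A i i
  simp [ntr, this, Fintype.card_congr e]

theorem ntr_kronecker (A : Matrix κ κ ℂ) (B : Matrix κ' κ' ℂ) :
    ntr (A ⊗ₖ B) = ntr A * ntr B := by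
  simp only [ntr, Matrix.trace_kronecker, Fintype.card_prod, Nat.cast_mul, mul_inv]
  ring

theorem ntr_one [DecidableEq κ] [Nonempty κ] : ntr (1 : Matrix κ κ ℂ) = 1 := by
  simp [ntr, Matrix.trace_one]

theorem ntr_conjTranspose_mul (A B : Matrix κ κ ℂ) :
    ntr (A.conjTranspose * B) = (Fintype.card κ : ℂ)⁻¹ * ∑ a, ∑ b, star (A b a) * B b a := by
  simp [ntr, Matrix.trace, Matrix.mul_apply]

theorem nsq_eq_sum (A : Matrix κ κ ℂ) :
    nsq A = (Fintype.card κ : ℝ)⁻¹ * ∑ a, ∑ b, ‖A b a‖ ^ 2 := by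
  rw [nsq, ntr_conjTranspose_mul]
  have : ∀ a b, star (A b a) * A b a = ((‖A b a‖ ^ 2 : ℝ) : ℂ) := fun a b => by
    rw [Complex.star_def, Complex.conj_mul']; push_cast; rfl
  simp only [this]
  rw [← Complex.ofReal_natCast, ← Complex.ofReal_inv]
  simp only [← Complex.ofReal_sum, ← Complex.ofReal_mul, Complex.ofReal_re]

theorem ntr_conjTranspose_mul_self (A : Matrix κ κ ℂ) :
    ntr (A.conjTranspose * A) = (nsq A : ℂ) := by
  rw [nsq_eq_sum, ntr_conjTranspose_mul]
  have : ∀ a b, star (A b a) * A b a = ((‖A b a‖ ^ 2 : ℝ) : ℂ) := fun a b => by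
    rw [Complex.star_def, Complex.conj_mul']; push_cast; rfl
  simp only [this]
  push_cast
  rfl

theorem nsq_nonneg (A : Matrix κ κ ℂ) : 0 ≤ nsq A := by
  rw [nsq_eq_sum]; positivity

theorem nsq_eq_zero {A : Matrix κ κ ℂ} (h : nsq A = 0) : A = 0 := by
  rw [nsq_eq_sum] at h
  ext b a
  have hc : (Fintype.card κ : ℝ)⁻¹ ≠ 0 := by
    have : Nonempty κ := ⟨a⟩
    positivity
  have h1 := (mul_eq_zero.1 h).resolve_left hc
  rw [Finset.sum_eq_zero_iff_of_nonneg (fun _ _ => by positivity)] at h1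
  have h2 := h1 a (Finset.mem_univ _)
  rw [Finset.sum_eq_zero_iff_of_nonneg (fun _ _ => by positivity)] at h2
  simpa using h2 b (Finset.mem_univ _)

theorem nsq_conjTranspose (A : Matrix κ κ ℂ) : nsq A.conjTranspose = nsq A := by
  rw [nsq, nsq, Matrix.conjTranspose_conjTranspose, ntr_mul_comm]

theorem nnorm2_sq (A : Matrix κ κ ℂ) : nnorm2 A ^ 2 = nsq A :=
  Real.sq_sqrt (nsq_nonneg A)

theorem norm_ntr_conjTranspose_mul_sq_le (A B : Matrix κ κ ℂ) :
    ‖ntr (A.conjTranspose * B)‖ ^ 2 ≤ nsq A * nsq B := by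
  rw [ntr_conjTranspose_mul, nsq_eq_sum, nsq_eq_sum, norm_mul, mul_pow]
  simp only [← Finset.sum_product' (s := Finset.univ) (t := Finset.univ)
    (f := fun a b => star (A b a) * B b a),
    ← Finset.sum_product' (s := Finset.univ) (t := Finset.univ)
    (f := fun a b => ‖A b a‖ ^ 2), ← Finset.sum_product' (s := Finset.univ) (t := Finset.univ)
    (f := fun a b => ‖B b a‖ ^ 2)]
  have h1 : ‖∑ x ∈ Finset.univ ×ˢ Finset.univ, star (A x.2 x.1) * B x.2 x.1‖ ≤
      ∑ x ∈ (Finset.univ : Finset κ) ×ˢ (Finset.univ : Finset κ),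
        ‖A x.2 x.1‖ * ‖B x.2 x.1‖ :=
    (norm_sum_le _ _).trans (le_of_eq (by simp))
  have h2 := Finset.sum_mul_sq_le_sq_mul_sq ((Finset.univ : Finset κ) ×ˢ (Finset.univ : Finset κ))
    (fun x => ‖A x.2 x.1‖) (fun x => ‖B x.2 x.1‖)
  have h3 := pow_le_pow_left₀ (norm_nonneg _) h1 2
  have h4 : ‖((Fintype.card κ : ℂ))⁻¹‖ = (Fintype.card κ : ℝ)⁻¹ := by simp
  rw [h4]
  calc _ ≤ ((Fintype.card κ : ℝ)⁻¹) ^ 2 * _ :=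
        mul_le_mul_of_nonneg_left (h3.trans h2) (by positivity)
    _ = _ := by ring

theorem norm_ntr_mul_sq_le (A B : Matrix κ κ ℂ) : ‖ntr (A * B)‖ ^ 2 ≤ nsq A * nsq B := by
  have := norm_ntr_conjTranspose_mul_sq_le A.conjTranspose B
  rwa [Matrix.conjTranspose_conjTranspose, nsq_conjTranspose] at this

theorem norm_ntr_sq_le [DecidableEq κ] [Nonempty κ] (A : Matrix κ κ ℂ) :
    ‖ntr A‖ ^ 2 ≤ nsq A := by
  have := norm_ntr_conjTranspose_mul_sq_le (1 : Matrix κ κ ℂ) A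
  simpa [nsq, ntr_one] using this

end Trace

/-! ### Expansion in an orthonormal family of full cardinality -/

section Expansion

variable {κ J : Type} [Fintype κ] [DecidableEq κ] [Fintype J] [DecidableEq J]

theorem ninner_sum_right (P : Matrix κ κ ℂ) (c : J → ℂ) (F : J → Matrix κ κ ℂ) :
    ninner P (∑ j, c j • F j) = ∑ j, c j * ninner P (F j) := by
  simp only [ninner_eq_ntr, Matrix.mul_sum, ntr_sum, Matrix.mul_smul, ntr_smul]

theorem ninner_sum_left (P : Matrix κ κ ℂ) (c : J → ℂ) (F : J → Matrix κ κ ℂ) :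
    ninner (∑ j, c j • F j) P = ∑ j, star (c j) * ninner (F j) P := by
  simp only [ninner_eq_ntr, Matrix.conjTranspose_sum, Matrix.conjTranspose_smul, Matrix.sum_mul,
    ntr_sum, Matrix.smul_mul, ntr_smul]

/-- `IsStdBasis` has no spanning axiom: orthonormality gives linear independence, and the number of
elements equals the dimension, so the family spans. -/
theorem sum_ninner_smul_eq {F : J → Matrix κ κ ℂ}
    (hF : ∀ i j, ninner (F i) (F j) = if i = j then 1 else 0)
    (hcard : Fintype.card J = Fintype.card κ * Fintype.card κ) (M : Matrix κ κ ℂ) :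
    ∑ j, ninner (F j) M • F j = M := by
  have hco : ∀ (c : J → ℂ) i, ninner (F i) (∑ j, c j • F j) = c i := fun c i => by
    rw [ninner_sum_right]; simp [hF]
  have hli : LinearIndependent ℂ F := by
    rw [Fintype.linearIndependent_iff]
    intro c hc i
    rw [← hco c i, hc]; simp [ninner]
  have hfin : Module.finrank ℂ (Matrix κ κ ℂ) = Fintype.card J := by
    rw [Module.finrank_matrix, hcard]; simp
  have hspan : Submodule.span ℂ (Set.range F) = ⊤ :=
    hli.span_eq_top_of_card_eq_finrank' hfin.symm
  have hM : M ∈ Submodule.span ℂ (Set.range F) := hspan ▸ Submodule.mem_top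
  obtain ⟨c, rfl⟩ := (Submodule.mem_span_range_iff_exists_fun ℂ).1 hM
  exact Finset.sum_congr rfl fun i _ => by rw [hco]

theorem nsq_sum_smul {F : J → Matrix κ κ ℂ}
    (hF : ∀ i j, ninner (F i) (F j) = if i = j then 1 else 0) (c : J → ℂ) :
    nsq (∑ j, c j • F j) = ∑ j, ‖c j‖ ^ 2 := by
  have : ninner (∑ j, c j • F j) (∑ j, c j • F j) = ∑ j, ((‖c j‖ ^ 2 : ℝ) : ℂ) := by
    rw [ninner_sum_left]
    refine Finset.sum_congr rfl fun i _ => ?_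
    rw [ninner_sum_right]
    simp only [hF, mul_ite, mul_one, mul_zero, Finset.sum_ite_eq, Finset.mem_univ, if_true]
    rw [Complex.star_def, Complex.conj_mul']; push_cast; rfl
  rw [nsq, ← ninner_eq_ntr, this, ← Complex.ofReal_sum, Complex.ofReal_re]

end Expansion

/-! ### Tensor products of one-register operators -/

section Tens

variable {m : ℕ} {ι : Type} [Fintype ι]

/-- The tensor product of a family of one-register operators. -/
def tens (A : ι → Matrix (Fin m) (Fin m) ℂ) : Op m ι :=
  Matrix.of fun a b => ∏ i, A i (a i) (b i)

theorem tensorBasis_eq_tens (B : Fin (m ^ 2) → Matrix (Fin m) (Fin m) ℂ) (σ : ι → Fin (m ^ 2)) :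
    tensorBasis B σ = tens fun i => B (σ i) := rfl

theorem tens_conjTranspose (A : ι → Matrix (Fin m) (Fin m) ℂ) :
    (tens A).conjTranspose = tens fun i => (A i).conjTranspose := by
  ext a b
  simp [tens, Matrix.conjTranspose_apply]

variable [DecidableEq ι]

theorem tens_mul (A A' : ι → Matrix (Fin m) (Fin m) ℂ) :
    tens A * tens A' = tens fun i => A i * A' i := by
  ext a b
  simp only [tens, Matrix.mul_apply, Matrix.of_apply]
  rw [Finset.prod_univ_sum]
  simp [Finset.prod_mul_distrib]

theorem tens_one : tens (fun _ : ι => (1 : Matrix (Fin m) (Fin m) ℂ)) = 1 := by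
  ext a b
  simp only [tens, Matrix.of_apply, Matrix.one_apply]
  rw [Finset.prod_ite_zero]
  simp [funext_iff]

theorem trace_tens (A : ι → Matrix (Fin m) (Fin m) ℂ) : (tens A).trace = ∏ i, (A i).trace := by
  simp only [Matrix.trace, Matrix.diag, tens, Matrix.of_apply]
  rw [Finset.prod_univ_sum]
  simp

theorem ntr_tens (A : ι → Matrix (Fin m) (Fin m) ℂ) : ntr (tens A) = ∏ i, ntr (A i) := by
  simp only [ntr, trace_tens, Finset.prod_mul_distrib]
  simp

/-- Splitting off the register `i`. -/
theorem tens_submatrix_funSplitAt (i : ι) (A : ι → Matrix (Fin m) (Fin m) ℂ) :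
    (tens A).submatrix (Equiv.funSplitAt i (Fin m)).symm (Equiv.funSplitAt i (Fin m)).symm =
      A i ⊗ₖ tens fun j : {j // j ≠ i} => A j := by
  ext ⟨a, a'⟩ ⟨b, b'⟩
  simp only [tens, Matrix.submatrix_apply, Matrix.of_apply, Matrix.kronecker_apply]
  rw [Fintype.prod_eq_mul_prod_subtype_ne _ i]
  congr 1
  · simp
  · refine Finset.prod_congr rfl fun j _ => ?_
    simp [j.2]

theorem tens_isHermitian {A : ι → Matrix (Fin m) (Fin m) ℂ} (hA : ∀ i, (A i).IsHermitian) :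
    (tens A).IsHermitian := by
  rw [Matrix.IsHermitian, tens_conjTranspose]
  congr 1
  funext i
  exact hA i

end Tens

/-! ### Fourier expansions -/

section FourierExpansion

variable {m : ℕ} {ι : Type} [Fintype ι] [DecidableEq ι]
  {B : Fin (m ^ 2) → Matrix (Fin m) (Fin m) ℂ}

theorem ninner_tensorBasis (hB : IsStdBasis m B) (σ τ : ι → Fin (m ^ 2)) :
    ninner (tensorBasis B σ) (tensorBasis B τ) = if σ = τ then 1 else 0 := by
  rw [ninner_eq_ntr, tensorBasis_eq_tens, tensorBasis_eq_tens, tens_conjTranspose, tens_mul,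
    ntr_tens]
  simp only [← ninner_eq_ntr, hB.orthonormal, Finset.prod_ite_zero]
  simp [funext_iff]

theorem card_registers : Fintype.card (ι → Fin (m ^ 2)) =
    Fintype.card (ι → Fin m) * Fintype.card (ι → Fin m) := by
  simp only [Fintype.card_pi, Fintype.card_fin, ← Finset.prod_mul_distrib]
  simp [sq]

theorem sum_fourierCoeff (hB : IsStdBasis m B) (M : Op m ι) :
    ∑ σ, fourierCoeff B M σ • tensorBasis B σ = M :=
  sum_ninner_smul_eq (ninner_tensorBasis hB) card_registers M

theorem nsq_sum_tensorBasis (hB : IsStdBasis m B) (c : (ι → Fin (m ^ 2)) → ℂ) :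
    nsq (∑ σ, c σ • tensorBasis B σ) = ∑ σ, ‖c σ‖ ^ 2 :=
  nsq_sum_smul (ninner_tensorBasis hB) c

theorem nsq_eq_sum_fourierCoeff (hB : IsStdBasis m B) (M : Op m ι) :
    nsq M = ∑ σ, ‖fourierCoeff B M σ‖ ^ 2 := by
  conv_lhs => rw [← sum_fourierCoeff hB M]
  exact nsq_sum_tensorBasis hB _

theorem fourierCoeff_sum (hB : IsStdBasis m B) (c : (ι → Fin (m ^ 2)) → ℂ) (σ : ι → Fin (m ^ 2)) :
    fourierCoeff B (∑ τ, c τ • tensorBasis B τ) σ = c σ := by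
  rw [fourierCoeff, ninner_sum_right]
  simp [ninner_tensorBasis hB]

theorem tensorBasis_isHermitian (hB : IsStdBasis m B) (σ : ι → Fin (m ^ 2)) :
    (tensorBasis B σ).IsHermitian :=
  tens_isHermitian fun i => hB.isHermitian (σ i)

theorem star_fourierCoeff (hB : IsStdBasis m B) {M : Op m ι} (hM : M.IsHermitian)
    (σ : ι → Fin (m ^ 2)) : star (fourierCoeff B M σ) = fourierCoeff B M σ := by
  rw [fourierCoeff, ninner_eq_ntr, ← ntr_conjTranspose, Matrix.conjTranspose_mul,
    Matrix.conjTranspose_conjTranspose, (tensorBasis_isHermitian hB σ).eq, hM.eq, ntr_mul_comm]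

/-- Truncations by degree become full sums in which some coefficients are zero, so that the analysis
can be carried out for an arbitrary coefficient function. -/
theorem filter_sum_eq {p : (ι → Fin (m ^ 2)) → Prop} [DecidablePred p] (M : Op m ι)
    {E : Type*} [AddCommMonoid E] [Module ℂ E] (F : (ι → Fin (m ^ 2)) → E) :
    ∑ σ ∈ Finset.univ.filter p, fourierCoeff B M σ • F σ =
      ∑ σ, (if p σ then fourierCoeff B M σ else 0) • F σ := by
  rw [Finset.sum_filter]
  exact Finset.sum_congr rfl fun σ _ => by split_ifs <;> simp

theorem fourierCoeff_highDegree (hB : IsStdBasis m B) (M : Op m ι) (d : ℕ)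
    (σ : ι → Fin (m ^ 2)) :
    fourierCoeff B (highDegree B M d) σ = if d < wtNZ σ then fourierCoeff B M σ else 0 := by
  rw [highDegree, filter_sum_eq, fourierCoeff_sum hB]

end FourierExpansion

/-! ### Resolvents of Hermitian matrices -/

section Resolvent

variable {κ κ' : Type} [Fintype κ] [DecidableEq κ] [Fintype κ'] [DecidableEq κ']

/-- The shifted matrix `X - i t`. -/
def shift (X : Matrix κ κ ℂ) (t : ℝ) : Matrix κ κ ℂ := X - ((t : ℂ) * Complex.I) • 1

/-- The resolvent `(X - i t)⁻¹`. -/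
def res (X : Matrix κ κ ℂ) (t : ℝ) : Matrix κ κ ℂ := (shift X t)⁻¹

/-- For Hermitian X, (X − it)*(X − it) = X² + t², the cross terms cancelling. Both the invertibility
of the shift and the bound 1/t for the resolvent come from this identity, without any spectral
theory. -/
theorem nsq_shift_mul {X : Matrix κ κ ℂ} (hX : X.IsHermitian) (t : ℝ) (D : Matrix κ κ ℂ) :
    nsq (shift X t * D) = nsq (X * D) + t ^ 2 * nsq D := by
  have h : (shift X t * D).conjTranspose * (shift X t * D) =
      (X * D).conjTranspose * (X * D) + ((t ^ 2 : ℝ) : ℂ) • (D.conjTranspose * D) := by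
    simp only [shift, Matrix.conjTranspose_mul, Matrix.conjTranspose_sub, hX.eq,
      Matrix.conjTranspose_smul, Matrix.conjTranspose_one]
    have e : star ((t : ℂ) * Complex.I) = -((t : ℂ) * Complex.I) := by simp
    have e2 : ((t ^ 2 : ℝ) : ℂ) = -((t : ℂ) * Complex.I) * ((t : ℂ) * Complex.I) := by
      push_cast
      linear_combination (t : ℂ) ^ 2 * Complex.I_sq
    rw [e, e2]
    generalize (t : ℂ) * Complex.I = z
    simp only [Matrix.sub_mul, Matrix.mul_sub, Matrix.smul_mul, Matrix.mul_smul, Matrix.one_mul,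
      Matrix.mul_assoc, neg_smul, smul_smul, neg_mul, Matrix.mul_neg, smul_sub,
      smul_neg]
    abel
  rw [nsq, h, ntr_add, ntr_smul, Complex.add_re, ntr_conjTranspose_mul_self D,
    ← Complex.ofReal_mul, Complex.ofReal_re]
  rfl

theorem isUnit_det_shift {X : Matrix κ κ ℂ} (hX : X.IsHermitian) {t : ℝ} (ht : 0 < t) :
    IsUnit (shift X t).det := by
  have hinj : Function.Injective (LinearMap.mulLeft ℂ (shift X t)) := by
    rw [injective_iff_map_eq_zero]
    intro D hD
    rw [LinearMap.mulLeft_apply] at hD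
    have h1 := nsq_shift_mul hX t D
    rw [hD] at h1
    have h0 : nsq (0 : Matrix κ κ ℂ) = 0 := by simp [nsq, ntr]
    rw [h0] at h1
    have h2 : t ^ 2 * nsq D = 0 := by
      have := nsq_nonneg (X * D)
      have := mul_nonneg (sq_nonneg t) (nsq_nonneg D)
      linarith
    exact nsq_eq_zero ((mul_eq_zero.1 h2).resolve_left (by positivity))
  obtain ⟨D, hD⟩ := LinearMap.surjective_of_injective hinj 1
  rw [LinearMap.mulLeft_apply] at hD
  exact Matrix.isUnit_det_of_right_inverse hD

theorem shift_mul_res {X : Matrix κ κ ℂ} (hX : X.IsHermitian) {t : ℝ} (ht : 0 < t) :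
    shift X t * res X t = 1 := Matrix.mul_nonsing_inv _ (isUnit_det_shift hX ht)

theorem res_mul_shift {X : Matrix κ κ ℂ} (hX : X.IsHermitian) {t : ℝ} (ht : 0 < t) :
    res X t * shift X t = 1 := Matrix.nonsing_inv_mul _ (isUnit_det_shift hX ht)

theorem nsq_res_mul_le {X : Matrix κ κ ℂ} (hX : X.IsHermitian) {t : ℝ} (ht : 0 < t)
    (D : Matrix κ κ ℂ) : nsq (res X t * D) ≤ (t ^ 2)⁻¹ * nsq D := by
  have h := nsq_shift_mul hX t (res X t * D)
  rw [← Matrix.mul_assoc, shift_mul_res hX ht, Matrix.one_mul] at h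
  have := nsq_nonneg (X * (res X t * D))
  rw [inv_mul_eq_div, le_div_iff₀ (by positivity)]
  linarith

theorem shift_commute (X : Matrix κ κ ℂ) (s t : ℝ) : Commute (shift X s) (shift X t) := by
  simp only [shift]
  refine Commute.sub_left ?_ ?_
  · exact (Commute.refl X).sub_right ((Commute.one_right _).smul_right _)
  · exact (Commute.one_left _).smul_left _

/-- The adjoint of the resolvent at t is the inverse of the shift at −t, and the two shifts commute.
Normality is what turns the bound for left multiplication by the resolvent into one for right
multiplication. -/
theorem res_conjTranspose_mul_res {X : Matrix κ κ ℂ} (hX : X.IsHermitian) (t : ℝ) :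
    (res X t).conjTranspose * res X t = res X t * (res X t).conjTranspose := by
  have h1 : (shift X t).conjTranspose = shift X (-t) := by
    simp [shift, Matrix.conjTranspose_sub, hX.eq, Matrix.conjTranspose_smul]
  have : (res X t).conjTranspose = (shift X (-t))⁻¹ := by
    rw [res, Matrix.conjTranspose_nonsing_inv, h1]
  rw [this, res, ← Matrix.mul_inv_rev, ← Matrix.mul_inv_rev, (shift_commute X t (-t)).eq]

theorem nsq_mul_res_le {X : Matrix κ κ ℂ} (hX : X.IsHermitian) {t : ℝ} (ht : 0 < t)
    (D : Matrix κ κ ℂ) : nsq (D * res X t) ≤ (t ^ 2)⁻¹ * nsq D := by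
  have h := nsq_res_mul_le hX ht D.conjTranspose
  rw [nsq_conjTranspose] at h
  refine le_trans (le_of_eq ?_) h
  rw [← nsq_conjTranspose, Matrix.conjTranspose_mul]
  simp only [nsq, Matrix.conjTranspose_mul, Matrix.conjTranspose_conjTranspose]
  have e : ∀ R : Matrix κ κ ℂ, D * R * (R.conjTranspose * D.conjTranspose) =
      D * (R * R.conjTranspose) * D.conjTranspose := fun R => by simp [Matrix.mul_assoc]
  have e' : ∀ R : Matrix κ κ ℂ, D * R.conjTranspose * (R * D.conjTranspose) =
      D * (R.conjTranspose * R) * D.conjTranspose := fun R => by simp [Matrix.mul_assoc]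
  rw [e, e', res_conjTranspose_mul_res hX t]

theorem norm_ntr_res_le [Nonempty κ] {X : Matrix κ κ ℂ} (hX : X.IsHermitian) {t : ℝ}
    (ht : 0 < t) : ‖ntr (res X t)‖ ≤ t⁻¹ := by
  have h := norm_ntr_sq_le (res X t)
  have h1 := nsq_res_mul_le hX ht 1
  rw [Matrix.mul_one] at h1
  have h2 : nsq (1 : Matrix κ κ ℂ) = 1 := by simp [nsq, ntr_one]
  rw [h2, mul_one, ← inv_pow] at h1
  exact (sq_le_sq₀ (norm_nonneg _) (by positivity)).1 (h.trans h1)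

theorem res_add {X Y : Matrix κ κ ℂ} (hX : X.IsHermitian) (hY : Y.IsHermitian) {t : ℝ}
    (ht : 0 < t) : res (X + Y) t = res X t - res X t * Y * res (X + Y) t := by
  have h1 := shift_mul_res (hX.add hY) ht
  have h2 : shift (X + Y) t = shift X t + Y := by simp only [shift]; abel
  have h3 : res X t * (shift (X + Y) t * res (X + Y) t) = res X t := by rw [h1, Matrix.mul_one]
  rw [h2, Matrix.add_mul, Matrix.mul_add, ← Matrix.mul_assoc, res_mul_shift hX ht,
    Matrix.one_mul, ← Matrix.mul_assoc] at h3
  exact eq_sub_of_add_eq h3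

/-- The resolvent identity used three times. The remainder is grouped as (RYR)(YRYR') so that
Cauchy–Schwarz separates one factor linear in Y from one quadratic in Y. -/
theorem res_add_expansion {X Y : Matrix κ κ ℂ} (hX : X.IsHermitian) (hY : Y.IsHermitian) {t : ℝ}
    (ht : 0 < t) : res (X + Y) t = res X t - res X t * Y * res X t +
      res X t * Y * res X t * Y * res X t -
      res X t * Y * res X t * (Y * res X t * Y * res (X + Y) t) := by
  have h := res_add hX hY ht
  generalize res (X + Y) t = R' at *
  generalize res X t = R at *
  conv_lhs => rw [h, h, h]
  simp only [Matrix.mul_sub, Matrix.mul_assoc]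
  abel

/-- Moving one outer Y around the trace pairs Y²R with RY², and Cauchy–Schwarz then bounds the
resolvents alone. The operator norm of Y, over which there is no control, never appears. -/
theorem nsq_mul_res_mul_le {X Y : Matrix κ κ ℂ} (hX : X.IsHermitian) (hY : Y.IsHermitian) {t : ℝ}
    (ht : 0 < t) : nsq (Y * res X t * Y) ≤ (t ^ 2)⁻¹ * nsq (Y * Y) := by
  have h1 : ntr ((Y * res X t * Y).conjTranspose * (Y * res X t * Y)) =
      ntr ((Y * Y * res X t).conjTranspose * (res X t * (Y * Y))) := by
    simp only [Matrix.conjTranspose_mul, hY.eq, Matrix.mul_assoc]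
    rw [ntr_mul_comm]
    simp only [Matrix.mul_assoc]
  have h2 := norm_ntr_conjTranspose_mul_sq_le (Y * Y * res X t) (res X t * (Y * Y))
  rw [← h1, ntr_conjTranspose_mul_self, Complex.norm_real, Real.norm_eq_abs, sq_abs] at h2
  have h3 := nsq_mul_res_le hX ht (Y * Y)
  have h4 := nsq_res_mul_le hX ht (Y * Y)
  have h5 : nsq (Y * res X t * Y) ^ 2 ≤ ((t ^ 2)⁻¹ * nsq (Y * Y)) ^ 2 := by
    rw [sq ((t ^ 2)⁻¹ * nsq (Y * Y))]
    exact h2.trans (mul_le_mul h3 h4 (nsq_nonneg _)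
      (mul_nonneg (by positivity) (nsq_nonneg _)))
  exact (sq_le_sq₀ (nsq_nonneg _) (mul_nonneg (by positivity) (nsq_nonneg _))).1 h5

/-- The second-order Taylor expansion of the trace of the resolvent, with a remainder controlled by
the second and fourth moments of the perturbation. -/
theorem norm_ntr_res_taylor_le {X Y : Matrix κ κ ℂ} (hX : X.IsHermitian) (hY : Y.IsHermitian)
    {t ε : ℝ} (ht : 0 < t) (hε : 0 < ε) :
    ‖ntr (res (X + Y) t) - (ntr (res X t) - ntr (res X t * Y * res X t) +
      ntr (res X t * Y * res X t * Y * res X t))‖ ≤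
      (t ^ 4)⁻¹ * ((ε * nsq Y + ε⁻¹ * nsq (Y * Y)) / 2) := by
  have h := congrArg ntr (res_add_expansion hX hY ht)
  rw [ntr_sub, ntr_add, ntr_sub] at h
  rw [h, sub_sub_cancel_left, norm_neg]
  have h1 := norm_ntr_mul_sq_le (res X t * Y * res X t) (Y * res X t * Y * res (X + Y) t)
  have h2 : nsq (res X t * Y * res X t) ≤ (t ^ 2)⁻¹ * ((t ^ 2)⁻¹ * nsq Y) :=
    (nsq_mul_res_le hX ht _).trans
      (mul_le_mul_of_nonneg_left (nsq_res_mul_le hX ht _) (by positivity))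
  have h3 : nsq (Y * res X t * Y * res (X + Y) t) ≤ (t ^ 2)⁻¹ * ((t ^ 2)⁻¹ * nsq (Y * Y)) :=
    (nsq_mul_res_le (hX.add hY) ht _).trans
      (mul_le_mul_of_nonneg_left (nsq_mul_res_mul_le hX hY ht) (by positivity))
  have h4 := h1.trans (mul_le_mul h2 h3 (nsq_nonneg _) (le_trans (nsq_nonneg _) h2))
  have hu := nsq_nonneg Y
  have hv := nsq_nonneg (Y * Y)
  generalize nsq Y = u at *
  generalize nsq (Y * Y) = v at *
  have hb : 0 ≤ (t ^ 4)⁻¹ * ((ε * u + ε⁻¹ * v) / 2) := by positivity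
  refine (sq_le_sq₀ (norm_nonneg _) hb).1 (h4.trans ?_)
  -- The product of norms is split by the arithmetic–geometric mean with a free weight `ε`, making
  -- the bound linear in the two moments. It can then be integrated, and `ε` is chosen only
  -- afterwards.
  have h5 : u * v ≤ ((ε * u + ε⁻¹ * v) / 2) ^ 2 := by
    have : (ε * u) * (ε⁻¹ * v) = u * v := by field_simp
    nlinarith [sq_nonneg (ε * u - ε⁻¹ * v)]
  calc _ = ((t ^ 4)⁻¹) ^ 2 * (u * v) := by field_simp
    _ ≤ ((t ^ 4)⁻¹) ^ 2 * ((ε * u + ε⁻¹ * v) / 2) ^ 2 :=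
      mul_le_mul_of_nonneg_left h5 (by positivity)
    _ = _ := by ring

theorem res_submatrix (e : κ' ≃ κ) (X : Matrix κ κ ℂ) (t : ℝ) :
    res (X.submatrix e e) t = (res X t).submatrix e e := by
  have : shift (X.submatrix e e) t = (shift X t).submatrix e e := by
    simp [shift, Matrix.submatrix_sub, Matrix.submatrix_smul]
  rw [res, this, Matrix.inv_submatrix_equiv, res]

theorem res_one_kronecker (X : Matrix κ κ ℂ) (t : ℝ) :
    res ((1 : Matrix κ' κ' ℂ) ⊗ₖ X) t = (1 : Matrix κ' κ' ℂ) ⊗ₖ res X t := by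
  have : shift ((1 : Matrix κ' κ' ℂ) ⊗ₖ X) t = (1 : Matrix κ' κ' ℂ) ⊗ₖ shift X t := by
    simp only [shift]
    ext ⟨a, b⟩ ⟨a', b'⟩
    by_cases h : a = a' <;> by_cases h' : b = b' <;>
      simp [h, h']
  rw [res, this, Matrix.inv_kronecker, inv_one, res]

end Resolvent

/-! ### Quartic forms given by products of one-register tensors -/

section Quartic

variable {α : Type} [Fintype α] {n : ℕ}

/-- The quartic form whose coefficients are products of one-register tensors. -/
def T4 (T : Fin n → α → α → α → α → ℂ) (a b c d : (Fin n → α) → ℂ) : ℂ :=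
  ∑ σ₁, ∑ σ₂, ∑ σ₃, ∑ σ₄,
    a σ₁ * b σ₂ * c σ₃ * d σ₄ * ∏ i, T i (σ₁ i) (σ₂ i) (σ₃ i) (σ₄ i)

/-- A one-register tensor which is cyclically invariant and is a Gram matrix. -/
structure IsTracial (T : α → α → α → α → ℂ) : Prop where
  cyclic : ∀ j k l p, T j k l p = T k l p j
  gram : ∃ (U : Type) (_ : Fintype U) (G : α → α → U → ℂ),
    ∀ j k l p, T j k l p = ∑ u, G j k u * star (G p l u)

theorem T4_cyclic {T : Fin n → α → α → α → α → ℂ} (hT : ∀ i, IsTracial (T i))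
    (a b c d : (Fin n → α) → ℂ) : T4 T a b c d = T4 T b c d a := by
  have h1 : T4 T b c d a = ∑ σ₂, ∑ σ₃, ∑ σ₄, ∑ σ₁,
      a σ₁ * b σ₂ * c σ₃ * d σ₄ * ∏ i, T i (σ₁ i) (σ₂ i) (σ₃ i) (σ₄ i) := by
    simp only [T4]
    refine Finset.sum_congr rfl fun σ₂ _ => Finset.sum_congr rfl fun σ₃ _ =>
      Finset.sum_congr rfl fun σ₄ _ => Finset.sum_congr rfl fun σ₁ _ => ?_
    rw [Finset.prod_congr rfl fun i _ => (hT i).cyclic (σ₁ i) (σ₂ i) (σ₃ i) (σ₄ i)]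
    ring
  rw [h1, T4, Finset.sum_comm]
  refine Finset.sum_congr rfl fun σ₂ _ => ?_
  rw [Finset.sum_comm]
  refine Finset.sum_congr rfl fun σ₃ _ => ?_
  rw [Finset.sum_comm]

theorem T4_sum_smul {J : Type*} (s : Finset J) (T : Fin n → α → α → α → α → ℂ) (x : J → ℂ)
    (a : J → (Fin n → α) → ℂ) (b c d : (Fin n → α) → ℂ) :
    T4 T (∑ j ∈ s, x j • a j) b c d = ∑ j ∈ s, x j * T4 T (a j) b c d := by
  simp only [T4, Finset.sum_apply, Pi.smul_apply, smul_eq_mul, Finset.sum_mul, Finset.mul_sum]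
  symm
  refine Finset.sum_comm.trans (Finset.sum_congr rfl fun σ₁ _ => ?_)
  refine Finset.sum_comm.trans (Finset.sum_congr rfl fun σ₂ _ => ?_)
  refine Finset.sum_comm.trans (Finset.sum_congr rfl fun σ₃ _ => ?_)
  refine Finset.sum_comm.trans (Finset.sum_congr rfl fun σ₄ _ => ?_)
  exact Finset.sum_congr rfl fun j _ => by ring

/-- The Gram vectors of the product form are products of the one-register Gram vectors. The reversed
and conjugated second pair reflects tr(AB·CD) = ⟨(CD)*, AB⟩. -/
theorem T4_gram {T : Fin n → α → α → α → α → ℂ} (hT : ∀ i, IsTracial (T i)) :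
    ∃ (U : Type) (_ : Fintype U) (L : ((Fin n → α) → ℂ) → ((Fin n → α) → ℂ) → U → ℂ),
      ∀ a b c d, T4 T a b c d = ∑ u, L a b u * star (L (star d) (star c) u) := by
  choose U hU G hG using fun i => (hT i).gram
  refine ⟨∀ i, U i, inferInstance, fun a b u =>
    ∑ σ₁, ∑ σ₂, a σ₁ * b σ₂ * ∏ i, G i (σ₁ i) (σ₂ i) (u i), fun a b c d => ?_⟩
  have h1 : ∀ u : ∀ i, U i,
      (∑ σ₁, ∑ σ₂, a σ₁ * b σ₂ * ∏ i, G i (σ₁ i) (σ₂ i) (u i)) *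
        star (∑ σ₄, ∑ σ₃, star d σ₄ * star c σ₃ * ∏ i, G i (σ₄ i) (σ₃ i) (u i)) =
      ∑ σ₁, ∑ σ₂, ∑ σ₃, ∑ σ₄, a σ₁ * b σ₂ * c σ₃ * d σ₄ *
        ∏ i, (G i (σ₁ i) (σ₂ i) (u i) * star (G i (σ₄ i) (σ₃ i) (u i))) := by
    intro u
    rw [Finset.sum_mul]
    refine Finset.sum_congr rfl fun σ₁ _ => ?_
    rw [Finset.sum_mul]
    refine Finset.sum_congr rfl fun σ₂ _ => ?_
    rw [star_sum, Finset.mul_sum, Finset.sum_comm]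
    refine Finset.sum_congr rfl fun σ₄ _ => ?_
    rw [star_sum, Finset.mul_sum]
    refine Finset.sum_congr rfl fun σ₃ _ => ?_
    rw [Finset.prod_mul_distrib]
    simp only [star_mul', Pi.star_apply, star_star, star_prod]
    ring
  simp only [h1, T4]
  symm
  refine Finset.sum_comm.trans (Finset.sum_congr rfl fun σ₁ _ => ?_)
  refine Finset.sum_comm.trans (Finset.sum_congr rfl fun σ₂ _ => ?_)
  refine Finset.sum_comm.trans (Finset.sum_congr rfl fun σ₃ _ => ?_)
  refine Finset.sum_comm.trans (Finset.sum_congr rfl fun σ₄ _ => ?_)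
  rw [← Finset.mul_sum]
  congr 1
  simp only [hG]
  rw [Finset.prod_univ_sum]
  simp

/-- The fourth power of the `L⁴` norm. -/
def N4 (T : Fin n → α → α → α → α → ℂ) (a : (Fin n → α) → ℂ) : ℝ :=
  ‖T4 T a (star a) a (star a)‖

/-- The `L⁴` norm. -/
def L4 (T : Fin n → α → α → α → α → ℂ) (a : (Fin n → α) → ℂ) : ℝ := √(√(N4 T a))

theorem L4_nonneg (T : Fin n → α → α → α → α → ℂ) (a : (Fin n → α) → ℂ) : 0 ≤ L4 T a :=
  Real.sqrt_nonneg _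

theorem L4_sq (T : Fin n → α → α → α → α → ℂ) (a : (Fin n → α) → ℂ) :
    L4 T a ^ 2 = √(N4 T a) := Real.sq_sqrt (Real.sqrt_nonneg _)

theorem norm_T4_sq_le {T : Fin n → α → α → α → α → ℂ} (hT : ∀ i, IsTracial (T i))
    (a b c d : (Fin n → α) → ℂ) :
    ‖T4 T a b c d‖ ^ 2 ≤ ‖T4 T a b (star b) (star a)‖ * ‖T4 T (star d) (star c) c d‖ := by
  obtain ⟨U, _, L, hL⟩ := T4_gram hT
  have key : ∀ a b, T4 T a b (star b) (star a) = ((∑ u, ‖L a b u‖ ^ 2 : ℝ) : ℂ) := by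
    intro a b
    rw [hL, star_star, star_star]
    push_cast
    exact Finset.sum_congr rfl fun u _ => by rw [Complex.star_def, Complex.mul_conj']
  have key2 := key (star d) (star c)
  rw [star_star, star_star] at key2
  rw [key, key2, hL, Complex.norm_real, Complex.norm_real, Real.norm_of_nonneg (by positivity),
    Real.norm_of_nonneg (by positivity)]
  have h1 : ‖∑ u, L a b u * star (L (star d) (star c) u)‖ ≤
      ∑ u, ‖L a b u‖ * ‖L (star d) (star c) u‖ :=
    (norm_sum_le _ _).trans (le_of_eq (by simp))
  exact (pow_le_pow_left₀ (norm_nonneg _) h1 2).trans (Finset.sum_mul_sq_le_sq_mul_sq _ _ _)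

theorem N4_star {T : Fin n → α → α → α → α → ℂ} (hT : ∀ i, IsTracial (T i))
    (a : (Fin n → α) → ℂ) : N4 T (star a) = N4 T a := by
  rw [N4, N4, star_star, T4_cyclic hT]

theorem L4_star {T : Fin n → α → α → α → α → ℂ} (hT : ∀ i, IsTracial (T i))
    (a : (Fin n → α) → ℂ) : L4 T (star a) = L4 T a := by
  rw [L4, L4, N4_star hT]

/-- Hölder with four exponents equal to 4. Cauchy–Schwarz in the Gram space separates (a, b) from
(c, d); each resulting form T4(a, b, b*, a*) is rotated to T4(a*, a, b, b*), and a second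
Cauchy–Schwarz separates a from b. -/
theorem norm_T4_le {T : Fin n → α → α → α → α → ℂ} (hT : ∀ i, IsTracial (T i))
    (a b c d : (Fin n → α) → ℂ) :
    ‖T4 T a b c d‖ ≤ L4 T a * L4 T b * L4 T c * L4 T d := by
  have h2 : ∀ a b, ‖T4 T a b (star b) (star a)‖ ≤ (L4 T a * L4 T b) ^ 2 := by
    intro a b
    have := norm_T4_sq_le hT (star a) a b (star b)
    rw [star_star] at this
    have e : T4 T a b (star b) (star a) = T4 T (star a) a b (star b) := by
      rw [T4_cyclic hT (star a)]
    rw [e]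
    rw [mul_pow, L4_sq, L4_sq, ← Real.sqrt_mul (by exact norm_nonneg _)]
    apply Real.le_sqrt_of_sq_le
    refine this.trans (le_of_eq ?_)
    rw [← N4_star hT a]
    simp only [N4, star_star]
  have h3 := norm_T4_sq_le hT a b c d
  have h4 := h2 (star d) (star c)
  rw [star_star, star_star, L4_star hT, L4_star hT] at h4
  have h5 := h3.trans (mul_le_mul (h2 a b) h4 (norm_nonneg _) (sq_nonneg _))
  rw [← mul_pow] at h5
  have := (sq_le_sq₀ (norm_nonneg _) (mul_nonneg (mul_nonneg (L4_nonneg _ _) (L4_nonneg _ _))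
    (mul_nonneg (L4_nonneg _ _) (L4_nonneg _ _)))).1 h5
  linarith

theorem sum_cons {E : Type*} [AddCommMonoid E] (f : (Fin (n + 1) → α) → E) :
    ∑ σ, f σ = ∑ j, ∑ σ : Fin n → α, f (Fin.cons j σ) := by
  rw [← Fintype.sum_prod_type']
  exact (Equiv.sum_comp (Fin.consEquiv fun _ => α) f).symm

theorem T4_succ (T : Fin (n + 1) → α → α → α → α → ℂ) (a b c d : (Fin (n + 1) → α) → ℂ) :
    T4 T a b c d = ∑ j, ∑ k, ∑ l, ∑ p, T 0 j k l p *
      T4 (fun i => T i.succ) (fun σ => a (Fin.cons j σ)) (fun σ => b (Fin.cons k σ))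
        (fun σ => c (Fin.cons l σ)) (fun σ => d (Fin.cons p σ)) := by
  simp only [T4, sum_cons, Fin.prod_univ_succ, Fin.cons_zero, Fin.cons_succ, Finset.mul_sum]
  refine Finset.sum_congr rfl fun j _ => ?_
  refine Finset.sum_comm.trans (Finset.sum_congr rfl fun k _ => ?_)
  refine (Finset.sum_congr rfl fun σ₁ _ => Finset.sum_comm).trans ?_
  refine Finset.sum_comm.trans (Finset.sum_congr rfl fun l _ => ?_)
  refine (Finset.sum_congr rfl fun σ₁ _ => Finset.sum_congr rfl fun σ₂ _ =>
    Finset.sum_comm).trans ?_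
  refine (Finset.sum_congr rfl fun σ₁ _ => Finset.sum_comm).trans ?_
  refine Finset.sum_comm.trans (Finset.sum_congr rfl fun p _ => ?_)
  refine Finset.sum_congr rfl fun σ₁ _ => Finset.sum_congr rfl fun σ₂ _ =>
    Finset.sum_congr rfl fun σ₃ _ => Finset.sum_congr rfl fun σ₄ _ => ?_
  ring

end Quartic

/-! ### The fourth moment tensor of independent Gaussians -/

section Wick

variable {α : Type} [Fintype α] [DecidableEq α]

/-- The indicator of `j = z`. -/
def indZ (z j : α) : ℝ := if j = z then 1 else 0

/-- The indicator of `j = k ≠ z`. -/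
def indD (z j k : α) : ℝ := if j = z then 0 else if j = k then 1 else 0

/-- The part of the fourth moment tensor with at least two indices equal to `z`. -/
def wickLow (z j k l p : α) : ℝ :=
  indZ z j * indZ z k * indZ z l * indZ z p +
  indD z j k * indZ z l * indZ z p + indD z j l * indZ z k * indZ z p +
  indD z j p * indZ z k * indZ z l + indD z k l * indZ z j * indZ z p +
  indD z k p * indZ z j * indZ z l + indD z l p * indZ z j * indZ z k

/-- The sum over the three pairings of indices different from `z`. -/
def wickPair (z j k l p : α) : ℝ :=
  indD z j k * indD z l p + indD z j l * indD z k p + indD z j p * indD z k l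

/-- The fourth moment tensor of independent standard Gaussians, the one of index `z` being replaced
by the constant `1`. -/
def wick (z j k l p : α) : ℝ := wickLow z j k l p + wickPair z j k l p

theorem indZ_nonneg (z j : α) : 0 ≤ indZ z j := by unfold indZ; split_ifs <;> simp

theorem indD_nonneg (z j k : α) : 0 ≤ indD z j k := by unfold indD; split_ifs <;> simp

theorem indD_comm (z j k : α) : indD z j k = indD z k j := by
  unfold indD; split_ifs <;> grind

theorem wickLow_nonneg (z j k l p : α) : 0 ≤ wickLow z j k l p := by
  unfold wickLow
  have hZ := indZ_nonneg z
  have hD := indD_nonneg z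
  have h := fun (a b : α) (c : α × α) => mul_nonneg (mul_nonneg (hD a b) (hZ c.1)) (hZ c.2)
  have h4 := mul_nonneg (mul_nonneg (mul_nonneg (hZ j) (hZ k)) (hZ l)) (hZ p)
  linarith [h j k (l, p), h j l (k, p), h j p (k, l), h k l (j, p), h k p (j, l), h l p (j, k)]

theorem wickPair_nonneg (z j k l p : α) : 0 ≤ wickPair z j k l p := by
  unfold wickPair
  have h := fun a b c d => mul_nonneg (indD_nonneg z a b) (indD_nonneg z c d)
  linarith [h j k l p, h j l k p, h j p k l]

theorem sum_indD_mul (z j : α) (f : α → ℝ) :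
    ∑ k, indD z j k * f k = if j = z then 0 else f j := by
  unfold indD
  split_ifs <;> simp

/-- With s the sum of the squares off `z`, this and `sum_wickPair` are the two parts of E(a_z + Σ
a_j g_j)⁴ = a_z⁴ + 6 a_z² s + 3 s². Since the tensors are nonnegative, norms may later be taken term
by term and the sum evaluated here with a_j an L⁴ norm. -/
theorem sum_wickLow (z : α) (a : α → ℝ) :
    ∑ j, ∑ k, ∑ l, ∑ p, wickLow z j k l p * (a j * a k * a l * a p) =
      a z ^ 4 + 6 * a z ^ 2 * ∑ j, if j = z then 0 else a j ^ 2 := by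
  simp only [wickLow, add_mul, Finset.sum_add_distrib]
  have e1 : ∑ j, ∑ k, ∑ l, ∑ p, indZ z j * indZ z k * indZ z l * indZ z p *
      (a j * a k * a l * a p) = a z ^ 4 := by
    simp [indZ]; ring
  have e2 : ∑ j, ∑ k, ∑ l, ∑ p, indD z j k * indZ z l * indZ z p *
      (a j * a k * a l * a p) = a z ^ 2 * ∑ j, if j = z then 0 else a j ^ 2 := by
    simp only [indZ, indD, mul_ite, mul_one, mul_zero, ite_mul, zero_mul, Finset.sum_ite_eq',
      Finset.mem_univ, if_true, one_mul, Finset.mul_sum]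
    refine Finset.sum_congr rfl fun j _ => ?_
    split_ifs
    · simp
    · simp; ring
  have e3 : ∑ j, ∑ k, ∑ l, ∑ p, indD z j l * indZ z k * indZ z p *
      (a j * a k * a l * a p) = a z ^ 2 * ∑ j, if j = z then 0 else a j ^ 2 := by
    simp only [indZ, indD, mul_ite, mul_one, mul_zero, ite_mul, zero_mul, Finset.sum_ite_eq',
      Finset.mem_univ, if_true, one_mul, Finset.mul_sum]
    refine Finset.sum_congr rfl fun j _ => ?_
    split_ifs
    · simp
    · simp [Finset.sum_ite_irrel]; ring
  have e4 : ∑ j, ∑ k, ∑ l, ∑ p, indD z j p * indZ z k * indZ z l *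
      (a j * a k * a l * a p) = a z ^ 2 * ∑ j, if j = z then 0 else a j ^ 2 := by
    simp only [indZ, indD, mul_ite, mul_one, mul_zero, ite_mul, zero_mul, one_mul,
      Finset.mul_sum]
    refine Finset.sum_congr rfl fun j _ => ?_
    split_ifs
    · simp
    · simp [Finset.sum_ite_irrel]; ring
  have e5 : ∑ j, ∑ k, ∑ l, ∑ p, indD z k l * indZ z j * indZ z p *
      (a j * a k * a l * a p) = a z ^ 2 * ∑ j, if j = z then 0 else a j ^ 2 := by
    rw [Finset.sum_comm, ← e2]
    refine Finset.sum_congr rfl fun j _ => ?_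
    rw [Finset.sum_comm]
    refine Finset.sum_congr rfl fun k _ => Finset.sum_congr rfl fun l _ =>
      Finset.sum_congr rfl fun p _ => ?_
    ring
  have e6 : ∑ j, ∑ k, ∑ l, ∑ p, indD z k p * indZ z j * indZ z l *
      (a j * a k * a l * a p) = a z ^ 2 * ∑ j, if j = z then 0 else a j ^ 2 := by
    rw [Finset.sum_comm, ← e4]
    refine Finset.sum_congr rfl fun j _ => Finset.sum_congr rfl fun k _ =>
      Finset.sum_congr rfl fun l _ => Finset.sum_congr rfl fun p _ => ?_
    ring
  have e7 : ∑ j, ∑ k, ∑ l, ∑ p, indD z l p * indZ z j * indZ z k *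
      (a j * a k * a l * a p) = a z ^ 2 * ∑ j, if j = z then 0 else a j ^ 2 := by
    rw [← e6, Finset.sum_congr rfl]
    intro j _
    rw [Finset.sum_comm]
    refine Finset.sum_congr rfl fun k _ => Finset.sum_congr rfl fun l _ =>
      Finset.sum_congr rfl fun p _ => ?_
    ring
  rw [e1, e2, e3, e4, e5, e6, e7]
  ring

theorem sum_wickPair (z : α) (a : α → ℝ) :
    ∑ j, ∑ k, ∑ l, ∑ p, wickPair z j k l p * (a j * a k * a l * a p) =
      3 * (∑ j, if j = z then 0 else a j ^ 2) ^ 2 := by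
  simp only [wickPair, add_mul, Finset.sum_add_distrib]
  have e1 : ∑ j, ∑ k, ∑ l, ∑ p, indD z j k * indD z l p *
      (a j * a k * a l * a p) = (∑ j, if j = z then 0 else a j ^ 2) ^ 2 := by
    have h : ∑ j, ∑ k, indD z j k * (a j * a k) = ∑ j, if j = z then 0 else a j ^ 2 := by
      refine Finset.sum_congr rfl fun j _ => ?_
      rw [sum_indD_mul z j fun k => a j * a k, sq]
    rw [sq, ← h, Finset.sum_mul]
    refine Finset.sum_congr rfl fun j _ => ?_
    rw [Finset.sum_mul]
    refine Finset.sum_congr rfl fun k _ => ?_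
    rw [Finset.mul_sum]
    refine Finset.sum_congr rfl fun l _ => ?_
    rw [Finset.mul_sum]
    refine Finset.sum_congr rfl fun p _ => ?_
    ring
  have e2 : ∑ j, ∑ k, ∑ l, ∑ p, indD z j l * indD z k p *
      (a j * a k * a l * a p) = (∑ j, if j = z then 0 else a j ^ 2) ^ 2 := by
    rw [← e1]
    refine Finset.sum_congr rfl fun j _ => ?_
    rw [Finset.sum_comm]
    refine Finset.sum_congr rfl fun k _ => Finset.sum_congr rfl fun l _ =>
      Finset.sum_congr rfl fun p _ => ?_
    ring
  have e3 : ∑ j, ∑ k, ∑ l, ∑ p, indD z j p * indD z k l *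
      (a j * a k * a l * a p) = (∑ j, if j = z then 0 else a j ^ 2) ^ 2 := by
    rw [← e2]
    refine Finset.sum_congr rfl fun j _ => Finset.sum_congr rfl fun k _ => ?_
    rw [Finset.sum_comm]
    refine Finset.sum_congr rfl fun l _ =>
      Finset.sum_congr rfl fun p _ => ?_
    ring
  rw [e1, e2, e3]
  ring

/-- The Gram vector of (j, k) is the Hermite expansion of g_j g_k: its mean (`none`), its linear
part (`inl`), and its second-order part (`inr`). The last is symmetrized over ordered pairs, which
accounts for the factor 1/√2. -/
theorem wick_isTracial (z : α) : IsTracial fun j k l p => (wick z j k l p : ℂ) where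
  cyclic j k l p := by
    simp only [wick, wickLow, wickPair]
    rw [indD_comm z p j, indD_comm z k j, indD_comm z l j]
    norm_cast
    ring
  gram := by
    refine ⟨Option (α ⊕ α × α), inferInstance, fun j k u => match u with
      | none => ((indZ z j * indZ z k + indD z j k : ℝ) : ℂ)
      | some (Sum.inl r) => ((indZ z j * indD z k r + indD z j r * indZ z k : ℝ) : ℂ)
      | some (Sum.inr (r, s)) =>
        (((√2)⁻¹ * (indD z j r * indD z k s + indD z j s * indD z k r) : ℝ) : ℂ), ?_⟩
    intro j k l p
    rw [Fintype.sum_option, Fintype.sum_sum_type, Fintype.sum_prod_type]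
    simp only [Complex.star_def, Complex.conj_ofReal]
    norm_cast
    have hd : ∀ j k, ∑ r, indD z j r * indD z k r = indD z j k := by
      intro j k
      simp only [indD]
      by_cases hj : j = z <;> by_cases hk : k = z <;> simp [hj, hk]
    have h1 : ∑ r, (indZ z j * indD z k r + indD z j r * indZ z k) *
        (indZ z p * indD z l r + indD z p r * indZ z l) =
        indZ z j * indZ z p * indD z k l + indZ z j * indZ z l * indD z k p +
        indZ z k * indZ z p * indD z j l + indZ z k * indZ z l * indD z j p := by
      rw [← hd k l, ← hd k p, ← hd j l, ← hd j p]
      simp only [Finset.mul_sum, ← Finset.sum_add_distrib]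
      exact Finset.sum_congr rfl fun r _ => by ring
    have h2 : ∑ r, ∑ s, (√2)⁻¹ * (indD z j r * indD z k s + indD z j s * indD z k r) *
        ((√2)⁻¹ * (indD z p r * indD z l s + indD z p s * indD z l r)) =
        indD z j p * indD z k l + indD z j l * indD z k p := by
      have hs : (√2)⁻¹ * (√2)⁻¹ = (1 / 2 : ℝ) := by
        rw [← mul_inv, Real.mul_self_sqrt (by norm_num)]; norm_num
      have h3 : ∀ j k l p, ∑ r, ∑ s, (indD z j r * indD z k s) * (indD z p r * indD z l s) =
          indD z j p * indD z k l := by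
        intro j k l p
        rw [← hd, ← hd, Finset.sum_mul_sum]
        exact Finset.sum_congr rfl fun r _ => Finset.sum_congr rfl fun s _ => by ring
      have h4 : ∀ r s, (√2)⁻¹ * (indD z j r * indD z k s + indD z j s * indD z k r) *
        ((√2)⁻¹ * (indD z p r * indD z l s + indD z p s * indD z l r)) =
        1 / 2 * ((indD z j r * indD z k s) * (indD z p r * indD z l s)) +
        1 / 2 * ((indD z j r * indD z k s) * (indD z l r * indD z p s)) +
        1 / 2 * ((indD z k r * indD z j s) * (indD z p r * indD z l s)) +
        1 / 2 * ((indD z k r * indD z j s) * (indD z l r * indD z p s)) := by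
        intro r s
        rw [← hs]; ring
      simp only [h4, Finset.sum_add_distrib, ← Finset.mul_sum, h3]
      ring
    rw [h1, h2, wick, wickLow, wickPair, indD_comm z p l]
    ring

end Wick

/-! ### The fourth moment tensor of a standard basis -/

section QuantumTensor

variable {m : ℕ} [NeZero m] {B : Fin (m ^ 2) → Matrix (Fin m) (Fin m) ℂ}

/-- The fourth moment tensor of the basis `B`. -/
def traceTensor (B : Fin (m ^ 2) → Matrix (Fin m) (Fin m) ℂ) (j k l p : Fin (m ^ 2)) : ℂ :=
  ntr (B j * B k * B l * B p)

theorem IsStdBasis.zero_eq_one (hB : IsStdBasis m B) : B 0 = 1 := hB.eq_one 0 rfl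

theorem IsStdBasis.ntr_mul (hB : IsStdBasis m B) (j k : Fin (m ^ 2)) :
    ntr (B j * B k) = if j = k then 1 else 0 := by
  have := hB.orthonormal j k
  rwa [ninner_eq_ntr, (hB.isHermitian j).eq] at this

theorem IsStdBasis.ntr_eq (hB : IsStdBasis m B) (j : Fin (m ^ 2)) :
    ntr (B j) = if j = 0 then 1 else 0 := by
  have := hB.ntr_mul j 0
  rwa [hB.zero_eq_one, Matrix.mul_one] at this

/-- The basis with the identity replaced by zero. -/
def reducedBasis (B : Fin (m ^ 2) → Matrix (Fin m) (Fin m) ℂ) (j : Fin (m ^ 2)) :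
    Matrix (Fin m) (Fin m) ℂ := if j = 0 then 0 else B j

theorem traceTensor_isTracial (hB : IsStdBasis m B) : IsTracial (traceTensor B) where
  cyclic j k l p := by
    simp only [traceTensor]
    rw [Matrix.mul_assoc, Matrix.mul_assoc, ntr_mul_comm, Matrix.mul_assoc, Matrix.mul_assoc,
      Matrix.mul_assoc, Matrix.mul_assoc]
  gram := by
    refine ⟨Fin m × Fin m, inferInstance, fun j k u =>
      (((√(m : ℝ))⁻¹ : ℝ) : ℂ) * (B j * B k) u.2 u.1, fun j k l p => ?_⟩
    have h1 : traceTensor B j k l p = ntr ((B p * B l).conjTranspose * (B j * B k)) := by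
      rw [traceTensor, Matrix.conjTranspose_mul, (hB.isHermitian p).eq, (hB.isHermitian l).eq,
        Matrix.mul_assoc (B j * B k), ntr_mul_comm]
    rw [h1, ntr_conjTranspose_mul, Fintype.sum_prod_type, Finset.mul_sum]
    refine Finset.sum_congr rfl fun a _ => ?_
    rw [Finset.mul_sum]
    refine Finset.sum_congr rfl fun b _ => ?_
    have hs : (Fintype.card (Fin m) : ℂ)⁻¹ = (((√(m : ℝ))⁻¹ : ℝ) : ℂ) * (((√(m : ℝ))⁻¹ : ℝ) : ℂ) := by
      rw [← Complex.ofReal_mul, ← mul_inv, Real.mul_self_sqrt (by positivity)]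
      simp
    simp only [hs, star_mul', Complex.star_def, Complex.conj_ofReal]
    ring

/-- Each basis element is either the identity or traceless. With at least two identities present
only traces of products of at most two elements remain, and these agree with Gaussian moments,
giving `wickLow`. The genuinely noncommutative part consists of the cubic and quartic traces. -/
theorem traceTensor_eq (hB : IsStdBasis m B) (j k l p : Fin (m ^ 2)) :
    traceTensor B j k l p = (wickLow 0 j k l p : ℂ) +
      ((indZ 0 j : ℂ) * ntr (reducedBasis B k * reducedBasis B l * reducedBasis B p) +
       (indZ 0 k : ℂ) * ntr (reducedBasis B l * reducedBasis B p * reducedBasis B j) +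
       (indZ 0 l : ℂ) * ntr (reducedBasis B p * reducedBasis B j * reducedBasis B k) +
       (indZ 0 p : ℂ) * ntr (reducedBasis B j * reducedBasis B k * reducedBasis B l)) +
      ntr (reducedBasis B j * reducedBasis B k * reducedBasis B l * reducedBasis B p) := by
  have h1 := hB.zero_eq_one
  have h2 := hB.ntr_mul
  have h3 := hB.ntr_eq
  have h0 : ntr (0 : Matrix (Fin m) (Fin m) ℂ) = 0 := by simp [ntr]
  have c1 : ∀ a b c : Matrix (Fin m) (Fin m) ℂ, ntr (a * b * c) = ntr (b * c * a) := by
    intro a b c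
    rw [Matrix.mul_assoc, ntr_mul_comm]
  by_cases hj : j = 0 <;> by_cases hk : k = 0 <;> by_cases hl : l = 0 <;> by_cases hp : p = 0 <;>
    simp [traceTensor, wickLow, indZ, indD, reducedBasis, hj, hk, hl, hp, h1, h2, h3, h0, ntr_one] <;>
    first
    | exact c1 _ _ _
    | rw [c1, c1]
    | (split_ifs <;> simp)

end QuantumTensor

/-! ### Cauchy–Schwarz for cyclic sums of real arrays -/

section RealSums

variable {ι : Type} [Fintype ι]

theorem sum_mul_mul_sq_le (x y : ι → ι → ℝ) :
    ∑ a, ∑ c, (∑ b, x a b * y b c) ^ 2 ≤ (∑ a, ∑ b, x a b ^ 2) * ∑ a, ∑ b, y a b ^ 2 := by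
  have h : ∀ a c, (∑ b, x a b * y b c) ^ 2 ≤ (∑ b, x a b ^ 2) * ∑ b, y b c ^ 2 := fun a c =>
    Finset.sum_mul_sq_le_sq_mul_sq _ _ _
  refine (Finset.sum_le_sum fun a _ => Finset.sum_le_sum fun c _ => h a c).trans (le_of_eq ?_)
  rw [Finset.sum_mul]
  refine Finset.sum_congr rfl fun a _ => ?_
  rw [← Finset.mul_sum, Finset.sum_comm]

theorem sum_sum_mul_sq_le (x y : ι → ι → ℝ) :
    (∑ a, ∑ c, x a c * y c a) ^ 2 ≤ (∑ a, ∑ b, x a b ^ 2) * ∑ a, ∑ b, y a b ^ 2 := by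
  have h := Finset.sum_mul_sq_le_sq_mul_sq (Finset.univ : Finset (ι × ι)) (fun p => x p.1 p.2)
    (fun p => y p.2 p.1)
  simp only [Fintype.sum_prod_type] at h
  rwa [Finset.sum_comm (f := fun a b => y b a ^ 2)] at h

theorem sum_cycle_three_sq_le (x y w : ι → ι → ℝ) :
    (∑ a, ∑ b, ∑ c, x a b * y b c * w c a) ^ 2 ≤
      (∑ a, ∑ b, x a b ^ 2) * (∑ a, ∑ b, y a b ^ 2) * ∑ a, ∑ b, w a b ^ 2 := by
  have e : ∑ a, ∑ b, ∑ c, x a b * y b c * w c a = ∑ a, ∑ c, (∑ b, x a b * y b c) * w c a := by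
    refine Finset.sum_congr rfl fun a _ => ?_
    rw [Finset.sum_comm]
    exact Finset.sum_congr rfl fun c _ => by rw [Finset.sum_mul]
  rw [e]
  refine (sum_sum_mul_sq_le _ _).trans ?_
  exact mul_le_mul_of_nonneg_right (sum_mul_mul_sq_le x y) (by positivity)

theorem sum_cycle_four_sq_le (x y w v : ι → ι → ℝ) :
    (∑ a, ∑ b, ∑ c, ∑ d, x a b * y b c * w c d * v d a) ^ 2 ≤
      (∑ a, ∑ b, x a b ^ 2) * (∑ a, ∑ b, y a b ^ 2) *
        ((∑ a, ∑ b, w a b ^ 2) * ∑ a, ∑ b, v a b ^ 2) := by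
  have e : ∑ a, ∑ b, ∑ c, ∑ d, x a b * y b c * w c d * v d a =
      ∑ a, ∑ c, (∑ b, x a b * y b c) * ∑ d, w c d * v d a := by
    refine Finset.sum_congr rfl fun a _ => ?_
    rw [Finset.sum_comm]
    refine Finset.sum_congr rfl fun c _ => ?_
    rw [Finset.sum_mul]
    refine Finset.sum_congr rfl fun b _ => ?_
    rw [Finset.mul_sum]
    exact Finset.sum_congr rfl fun d _ => by ring
  rw [e]
  refine (sum_sum_mul_sq_le _ _).trans ?_
  exact mul_le_mul (sum_mul_mul_sq_le x y) (sum_mul_mul_sq_le w v) (by positivity) (by positivity)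

end RealSums

/-! ### Hypercontractivity: adding one register -/

section LocalBounds

variable {α : Type} [Fintype α] {n : ℕ} {T : Fin n → α → α → α → α → ℂ}

theorem T4_sum_smul₂ {J : Type*} (hT : ∀ i, IsTracial (T i)) (s : Finset J) (x : J → ℂ)
    (a c d : (Fin n → α) → ℂ) (b : J → (Fin n → α) → ℂ) :
    T4 T a (∑ j ∈ s, x j • b j) c d = ∑ j ∈ s, x j * T4 T a (b j) c d := by
  rw [T4_cyclic hT, T4_sum_smul]
  exact Finset.sum_congr rfl fun j _ => by rw [T4_cyclic hT a]

theorem T4_sum_smul₃ {J : Type*} (hT : ∀ i, IsTracial (T i)) (s : Finset J) (x : J → ℂ)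
    (a b d : (Fin n → α) → ℂ) (c : J → (Fin n → α) → ℂ) :
    T4 T a b (∑ j ∈ s, x j • c j) d = ∑ j ∈ s, x j * T4 T a b (c j) d := by
  rw [T4_cyclic hT, T4_sum_smul₂ hT]
  exact Finset.sum_congr rfl fun j _ => by rw [T4_cyclic hT a]

theorem T4_sum_smul₄ {J : Type*} (hT : ∀ i, IsTracial (T i)) (s : Finset J) (x : J → ℂ)
    (a b c : (Fin n → α) → ℂ) (d : J → (Fin n → α) → ℂ) :
    T4 T a b c (∑ j ∈ s, x j • d j) = ∑ j ∈ s, x j * T4 T a b c (d j) := by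
  rw [T4_cyclic hT, T4_sum_smul₃ hT]
  exact Finset.sum_congr rfl fun j _ => by rw [T4_cyclic hT a]

theorem sum_comm_three {I J : Type*} [Fintype I] [Fintype J] (f : J → I → I → I → ℂ) :
    ∑ j, ∑ a, ∑ b, ∑ c, f j a b c = ∑ a, ∑ b, ∑ c, ∑ j, f j a b c :=
  Finset.sum_comm.trans (Finset.sum_congr rfl fun _ _ =>
    Finset.sum_comm.trans (Finset.sum_congr rfl fun _ _ => Finset.sum_comm))

theorem sum_comm_four {I J : Type*} [Fintype I] [Fintype J] (f : J → I → I → I → I → ℂ) :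
    ∑ j, ∑ a, ∑ b, ∑ c, ∑ d, f j a b c d = ∑ a, ∑ b, ∑ c, ∑ d, ∑ j, f j a b c d :=
  Finset.sum_comm.trans (Finset.sum_congr rfl fun _ _ => sum_comm_three _)

variable {m : ℕ}

/-- The block `(a, b)` of the operator `∑ j, D j ⊗ c j`. -/
def block {V J : Type*} [Fintype J] [AddCommMonoid V] [Module ℂ V]
    (D : J → Matrix (Fin m) (Fin m) ℂ) (c : J → V) (a b : Fin m) : V := ∑ j, D j a b • c j

theorem ntr_mul_three (A B C : Matrix (Fin m) (Fin m) ℂ) :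
    ntr (A * B * C) = (m : ℂ)⁻¹ * ∑ a, ∑ b, ∑ c, A a b * B b c * C c a := by
  simp only [ntr, Matrix.trace, Matrix.diag, Matrix.mul_apply, Fintype.card_fin]
  congr 1
  refine Finset.sum_congr rfl fun a _ => ?_
  rw [Finset.sum_comm]
  exact Finset.sum_congr rfl fun c _ => by rw [Finset.sum_mul]

theorem ntr_mul_four (A B C D : Matrix (Fin m) (Fin m) ℂ) :
    ntr (A * B * C * D) = (m : ℂ)⁻¹ * ∑ a, ∑ b, ∑ c, ∑ d, A a b * B b c * C c d * D d a := by
  rw [Matrix.mul_assoc (A * B), ntr_mul_three]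
  congr 1
  refine Finset.sum_congr rfl fun a _ => Finset.sum_congr rfl fun b _ =>
    Finset.sum_congr rfl fun c _ => ?_
  rw [Matrix.mul_apply, Finset.mul_sum]
  exact Finset.sum_congr rfl fun d _ => by ring

variable {J : Type} [Fintype J] (D : J → Matrix (Fin m) (Fin m) ℂ)

/-- Written in matrix entries, the trace separates the basis indices, so each sum over the basis
moves into one slot of the multilinear form and becomes a block. -/
theorem sum_ntr_three_T4 (hT : ∀ i, IsTracial (T i)) (x : (Fin n → α) → ℂ)
    (u v w : J → (Fin n → α) → ℂ) :
    ∑ k, ∑ l, ∑ p, ntr (D k * D l * D p) * T4 T x (u k) (v l) (w p) =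
      (m : ℂ)⁻¹ * ∑ a, ∑ b, ∑ c, T4 T x (block D u a b) (block D v b c) (block D w c a) := by
  have h1 : ∀ a b c, T4 T x (block D u a b) (block D v b c) (block D w c a) =
      ∑ k, ∑ l, ∑ p, D k a b * D l b c * D p c a * T4 T x (u k) (v l) (w p) := by
    intro a b c
    simp only [block, T4_sum_smul₂ hT, T4_sum_smul₃ hT, T4_sum_smul₄ hT, Finset.mul_sum]
    exact Finset.sum_congr rfl fun k _ => Finset.sum_congr rfl fun l _ =>
      Finset.sum_congr rfl fun p _ => by ring
  simp only [h1, ntr_mul_three, mul_assoc (m : ℂ)⁻¹, ← Finset.mul_sum, Finset.sum_mul]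
  congr 1
  refine (Finset.sum_congr rfl fun k _ => Finset.sum_congr rfl fun l _ =>
    sum_comm_three _).trans ?_
  exact (Finset.sum_congr rfl fun k _ => sum_comm_three _).trans (sum_comm_three _)

theorem sum_ntr_four_T4 (hT : ∀ i, IsTracial (T i)) (s u v w : J → (Fin n → α) → ℂ) :
    ∑ j, ∑ k, ∑ l, ∑ p, ntr (D j * D k * D l * D p) * T4 T (s j) (u k) (v l) (w p) =
      (m : ℂ)⁻¹ * ∑ a, ∑ b, ∑ c, ∑ d,
        T4 T (block D s a b) (block D u b c) (block D v c d) (block D w d a) := by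
  have h1 : ∀ a b c d, T4 T (block D s a b) (block D u b c) (block D v c d) (block D w d a) =
      ∑ j, ∑ k, ∑ l, ∑ p, D j a b * D k b c * D l c d * D p d a * T4 T (s j) (u k) (v l) (w p) := by
    intro a b c d
    rw [block, T4_sum_smul]
    refine Finset.sum_congr rfl fun j _ => ?_
    simp only [block, T4_sum_smul₂ hT, T4_sum_smul₃ hT, T4_sum_smul₄ hT, Finset.mul_sum]
    exact Finset.sum_congr rfl fun k _ =>
      Finset.sum_congr rfl fun l _ => Finset.sum_congr rfl fun p _ => by ring
  simp only [h1, ntr_mul_four, mul_assoc (m : ℂ)⁻¹, ← Finset.mul_sum, Finset.sum_mul]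
  congr 1
  refine (Finset.sum_congr rfl fun j _ => Finset.sum_congr rfl fun k _ =>
    Finset.sum_congr rfl fun l _ => sum_comm_four _).trans ?_
  refine (Finset.sum_congr rfl fun j _ => Finset.sum_congr rfl fun k _ =>
    sum_comm_four _).trans ?_
  exact (Finset.sum_congr rfl fun j _ => sum_comm_four _).trans (sum_comm_four _)

/-- Hölder is applied to each triple of blocks, and the cyclic sum over matrix positions is bounded
by Frobenius norms. Estimating term by term in the basis index instead would lose the orthogonality
of the basis. -/
theorem norm_sum_ntr_three_T4_le (hT : ∀ i, IsTracial (T i)) (x : (Fin n → α) → ℂ)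
    (u v w : J → (Fin n → α) → ℂ) {q : ℝ} (hq : 0 ≤ q)
    (hu : ∑ a, ∑ b, L4 T (block D u a b) ^ 2 = q ^ 2)
    (hv : ∑ a, ∑ b, L4 T (block D v a b) ^ 2 = q ^ 2)
    (hw : ∑ a, ∑ b, L4 T (block D w a b) ^ 2 = q ^ 2) :
    ‖∑ k, ∑ l, ∑ p, ntr (D k * D l * D p) * T4 T x (u k) (v l) (w p)‖ ≤
      (m : ℝ)⁻¹ * (L4 T x * q ^ 3) := by
  rw [sum_ntr_three_T4 D hT, norm_mul, norm_inv, Complex.norm_natCast]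
  refine mul_le_mul_of_nonneg_left ?_ (by positivity)
  have h1 : ‖∑ a, ∑ b, ∑ c, T4 T x (block D u a b) (block D v b c) (block D w c a)‖ ≤
      L4 T x * ∑ a, ∑ b, ∑ c,
        L4 T (block D u a b) * L4 T (block D v b c) * L4 T (block D w c a) := by
    simp only [Finset.mul_sum]
    refine norm_sum_le_of_le _ fun a _ => norm_sum_le_of_le _ fun b _ =>
      norm_sum_le_of_le _ fun c _ => (norm_T4_le hT _ _ _ _).trans (le_of_eq (by ring))
  refine h1.trans (mul_le_mul_of_nonneg_left ?_ (L4_nonneg _ _))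
  have h2 := sum_cycle_three_sq_le (fun a b => L4 T (block D u a b))
    (fun a b => L4 T (block D v a b)) (fun a b => L4 T (block D w a b))
  rw [hu, hv, hw] at h2
  refine le_of_abs_le (abs_le_of_sq_le_sq (h2.trans (le_of_eq (by ring))) (by positivity))

theorem norm_sum_ntr_four_T4_le (hT : ∀ i, IsTracial (T i))
    (s u v w : J → (Fin n → α) → ℂ) {q : ℝ}
    (hs : ∑ a, ∑ b, L4 T (block D s a b) ^ 2 = q ^ 2)
    (hu : ∑ a, ∑ b, L4 T (block D u a b) ^ 2 = q ^ 2)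
    (hv : ∑ a, ∑ b, L4 T (block D v a b) ^ 2 = q ^ 2)
    (hw : ∑ a, ∑ b, L4 T (block D w a b) ^ 2 = q ^ 2) :
    ‖∑ j, ∑ k, ∑ l, ∑ p, ntr (D j * D k * D l * D p) * T4 T (s j) (u k) (v l) (w p)‖ ≤
      (m : ℝ)⁻¹ * q ^ 4 := by
  rw [sum_ntr_four_T4 D hT, norm_mul, norm_inv, Complex.norm_natCast]
  refine mul_le_mul_of_nonneg_left ?_ (by positivity)
  have h1 : ‖∑ a, ∑ b, ∑ c, ∑ d,
        T4 T (block D s a b) (block D u b c) (block D v c d) (block D w d a)‖ ≤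
      ∑ a, ∑ b, ∑ c, ∑ d, L4 T (block D s a b) * L4 T (block D u b c) *
        L4 T (block D v c d) * L4 T (block D w d a) :=
    norm_sum_le_of_le _ fun a _ => norm_sum_le_of_le _ fun b _ =>
      norm_sum_le_of_le _ fun c _ => norm_sum_le_of_le _ fun d _ => norm_T4_le hT _ _ _ _
  refine h1.trans ?_
  have h2 := sum_cycle_four_sq_le (fun a b => L4 T (block D s a b))
    (fun a b => L4 T (block D u a b)) (fun a b => L4 T (block D v a b))
    (fun a b => L4 T (block D w a b))
  rw [hs, hu, hv, hw] at h2
  refine le_of_abs_le (abs_le_of_sq_le_sq (h2.trans (le_of_eq (by ring))) (by positivity))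

end LocalBounds

section AddRegister

/-- The squared `ℓ²` norm. -/
def sqn {S : Type} [Fintype S] (v : S → ℂ) : ℝ := ∑ s, ‖v s‖ ^ 2

theorem sqn_nonneg {S : Type} [Fintype S] (v : S → ℂ) : 0 ≤ sqn v :=
  Finset.sum_nonneg fun _ _ => by positivity

variable {α : Type} [Fintype α] [DecidableEq α] {n : ℕ} {T : Fin n → α → α → α → α → ℂ}

theorem norm_sum_wickLow_T4_le (hT : ∀ i, IsTracial (T i)) (z : α) (c : α → (Fin n → α) → ℂ) :
    ‖∑ j, ∑ k, ∑ l, ∑ p, (wickLow z j k l p : ℂ) * T4 T (c j) (star (c k)) (c l) (star (c p))‖ ≤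
      L4 T (c z) ^ 4 + 6 * L4 T (c z) ^ 2 * ∑ j, if j = z then 0 else L4 T (c j) ^ 2 := by
  rw [← sum_wickLow z fun j => L4 T (c j)]
  refine norm_sum_le_of_le _ fun j _ => norm_sum_le_of_le _ fun k _ =>
    norm_sum_le_of_le _ fun l _ => norm_sum_le_of_le _ fun p _ => ?_
  rw [norm_mul, Complex.norm_real, Real.norm_of_nonneg (wickLow_nonneg _ _ _ _ _)]
  refine mul_le_mul_of_nonneg_left ?_ (wickLow_nonneg _ _ _ _ _)
  have := norm_T4_le hT (c j) (star (c k)) (c l) (star (c p))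
  rwa [L4_star hT, L4_star hT] at this

theorem norm_sum_wickPair_T4_le (hT : ∀ i, IsTracial (T i)) (z : α) (c : α → (Fin n → α) → ℂ) :
    ‖∑ j, ∑ k, ∑ l, ∑ p, (wickPair z j k l p : ℂ) * T4 T (c j) (star (c k)) (c l) (star (c p))‖ ≤
      3 * (∑ j, if j = z then 0 else L4 T (c j) ^ 2) ^ 2 := by
  rw [← sum_wickPair z fun j => L4 T (c j)]
  refine norm_sum_le_of_le _ fun j _ => norm_sum_le_of_le _ fun k _ =>
    norm_sum_le_of_le _ fun l _ => norm_sum_le_of_le _ fun p _ => ?_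
  rw [norm_mul, Complex.norm_real, Real.norm_of_nonneg (wickPair_nonneg _ _ _ _ _)]
  refine mul_le_mul_of_nonneg_left ?_ (wickPair_nonneg _ _ _ _ _)
  have := norm_T4_le hT (c j) (star (c k)) (c l) (star (c p))
  rwa [L4_star hT, L4_star hT] at this

/-- The factor 3 makes the cross term of (x² + 3s)² equal to 6x²s exactly; the term 3s² is then more
than covered by 9s². -/
theorem quartic_numeric_bound_commutative {x s X Y : ℝ} (hs : 0 ≤ s) (hX : x ^ 2 ≤ X)
    (hY : s ≤ Y) : x ^ 4 + 6 * x ^ 2 * s + 3 * s ^ 2 ≤ (X + 3 * Y) ^ 2 := by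
  have h1 : (x ^ 2 + 3 * s) ^ 2 ≤ (X + 3 * Y) ^ 2 :=
    pow_le_pow_left₀ (by positivity) (by linarith) 2
  linarith [sq_nonneg s, show (x ^ 2 + 3 * s) ^ 2 = x ^ 4 + 6 * x ^ 2 * s + 9 * s ^ 2 by ring]

theorem sqrt_norm_add_le {S S' : ℂ} {r r' R : ℝ} (h : ‖S‖ ≤ r) (h' : ‖S'‖ ≤ r')
    (hR : r + r' ≤ R ^ 2) (hR0 : 0 ≤ R) : √‖S + S'‖ ≤ R :=
  Real.sqrt_le_iff.2 ⟨hR0, ((norm_add_le _ _).trans (add_le_add h h')).trans hR⟩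

/-- The inductive step for a Gaussian register: its nontrivial part costs a factor 3, and √m is
needed for quantum registers only. -/
theorem sqrt_norm_sum_wick_T4_le (hT : ∀ i, IsTracial (T i)) (z : α) (c : α → (Fin n → α) → ℂ)
    {X Y : ℝ} (hX : L4 T (c z) ^ 2 ≤ X) (hY : ∑ j, (if j = z then 0 else L4 T (c j) ^ 2) ≤ Y) :
    √‖∑ j, ∑ k, ∑ l, ∑ p, (wick z j k l p : ℂ) * T4 T (c j) (star (c k)) (c l) (star (c p))‖ ≤
      X + 3 * Y := by
  have hX0 : 0 ≤ L4 T (c z) ^ 2 := sq_nonneg _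
  have hY0 : 0 ≤ ∑ j, (if j = z then 0 else L4 T (c j) ^ 2) :=
    Finset.sum_nonneg fun j _ => by split_ifs <;> positivity
  have e0 : ∑ j, ∑ k, ∑ l, ∑ p, (wick z j k l p : ℂ) *
      T4 T (c j) (star (c k)) (c l) (star (c p)) =
      ∑ j, ∑ k, ∑ l, ∑ p, (wickLow z j k l p : ℂ) * T4 T (c j) (star (c k)) (c l) (star (c p)) +
      ∑ j, ∑ k, ∑ l, ∑ p, (wickPair z j k l p : ℂ) *
        T4 T (c j) (star (c k)) (c l) (star (c p)) := by
    simp only [wick, Complex.ofReal_add, add_mul, Finset.sum_add_distrib]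
  rw [e0]
  exact sqrt_norm_add_le (norm_sum_wickLow_T4_le hT z c) (norm_sum_wickPair_T4_le hT z c)
    (quartic_numeric_bound_commutative hY0 hX hY)
    (add_nonneg (hX0.trans hX) (mul_nonneg zero_le_three (hY0.trans hY)))

variable {m : ℕ} [NeZero m] {B : Fin (m ^ 2) → Matrix (Fin m) (Fin m) ℂ}
  {T : Fin n → Fin (m ^ 2) → Fin (m ^ 2) → Fin (m ^ 2) → Fin (m ^ 2) → ℂ}

theorem block_star (hB : IsStdBasis m B) (c : Fin (m ^ 2) → (Fin n → Fin (m ^ 2)) → ℂ)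
    (a b : Fin m) : block (reducedBasis B) (fun j => star (c j)) a b =
      star (block (reducedBasis B) c b a) := by
  simp only [block, star_sum, star_smul]
  refine Finset.sum_congr rfl fun j _ => ?_
  congr 1
  unfold reducedBasis
  split_ifs
  · simp
  · exact ((hB.isHermitian j).apply a b).symm

/-- In each cubic term one index is forced to be 0. Cyclic rotation brings that slot, `c 0` or its
conjugate, to the front, so the same cubic bound serves all four terms. -/
theorem norm_sum_traceTensor_T4_le (hT : ∀ i, IsTracial (T i)) (hB : IsStdBasis m B)
    (c : Fin (m ^ 2) → (Fin n → Fin (m ^ 2)) → ℂ) {q : ℝ} (hq : 0 ≤ q)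
    (hc : ∑ a, ∑ b, L4 T (block (reducedBasis B) c a b) ^ 2 = q ^ 2) :
    ‖∑ j, ∑ k, ∑ l, ∑ p, traceTensor B j k l p * T4 T (c j) (star (c k)) (c l) (star (c p))‖ ≤
      L4 T (c 0) ^ 4 + 6 * L4 T (c 0) ^ 2 * (∑ j, if j = 0 then 0 else L4 T (c j) ^ 2) +
        4 * ((m : ℝ)⁻¹ * (L4 T (c 0) * q ^ 3)) + (m : ℝ)⁻¹ * q ^ 4 := by
  have hc' : ∑ a, ∑ b, L4 T (block (reducedBasis B) (fun j => star (c j)) a b) ^ 2 = q ^ 2 := by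
    simp only [block_star hB, L4_star hT]
    rw [Finset.sum_comm, hc]
  simp only [traceTensor_eq hB, add_mul, Finset.sum_add_distrib]
  have hz : ∀ f : Fin (m ^ 2) → ℂ, ∑ j, (indZ 0 j : ℂ) * f j = f 0 := fun f => by
    simp [indZ, apply_ite (fun x : ℝ => (x : ℂ))]
  have e1 : ∑ j, ∑ k, ∑ l, ∑ p, (indZ 0 j : ℂ) *
      ntr (reducedBasis B k * reducedBasis B l * reducedBasis B p) *
        T4 T (c j) (star (c k)) (c l) (star (c p)) =
      ∑ k, ∑ l, ∑ p, ntr (reducedBasis B k * reducedBasis B l * reducedBasis B p) *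
        T4 T (c 0) (star (c k)) (c l) (star (c p)) := by
    simp only [mul_assoc (indZ _ _ : ℂ), ← Finset.mul_sum]
    rw [hz]
  have e2 : ∑ j, ∑ k, ∑ l, ∑ p, (indZ 0 k : ℂ) *
      ntr (reducedBasis B l * reducedBasis B p * reducedBasis B j) *
        T4 T (c j) (star (c k)) (c l) (star (c p)) =
      ∑ l, ∑ p, ∑ j, ntr (reducedBasis B l * reducedBasis B p * reducedBasis B j) *
        T4 T (star (c 0)) (c l) (star (c p)) (c j) := by
    simp only [mul_assoc (indZ _ _ : ℂ), ← Finset.mul_sum, hz]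
    refine Finset.sum_comm.trans (Finset.sum_congr rfl fun l _ => Finset.sum_comm.trans
      (Finset.sum_congr rfl fun p _ => Finset.sum_congr rfl fun j _ => ?_))
    rw [T4_cyclic hT]
  have e3 : ∑ j, ∑ k, ∑ l, ∑ p, (indZ 0 l : ℂ) *
      ntr (reducedBasis B p * reducedBasis B j * reducedBasis B k) *
        T4 T (c j) (star (c k)) (c l) (star (c p)) =
      ∑ p, ∑ j, ∑ k, ntr (reducedBasis B p * reducedBasis B j * reducedBasis B k) *
        T4 T (c 0) (star (c p)) (c j) (star (c k)) := by
    simp only [mul_assoc (indZ _ _ : ℂ), ← Finset.mul_sum, hz]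
    refine (Finset.sum_congr rfl fun j _ => Finset.sum_comm).trans (Finset.sum_comm.trans
      (Finset.sum_congr rfl fun p _ => Finset.sum_congr rfl fun j _ =>
        Finset.sum_congr rfl fun k _ => ?_))
    rw [T4_cyclic hT (c j), T4_cyclic hT (star (c k))]
  have e4 : ∑ j, ∑ k, ∑ l, ∑ p, (indZ 0 p : ℂ) *
      ntr (reducedBasis B j * reducedBasis B k * reducedBasis B l) *
        T4 T (c j) (star (c k)) (c l) (star (c p)) =
      ∑ j, ∑ k, ∑ l, ntr (reducedBasis B j * reducedBasis B k * reducedBasis B l) *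
        T4 T (star (c 0)) (c j) (star (c k)) (c l) := by
    simp only [mul_assoc (indZ _ _ : ℂ), hz]
    refine Finset.sum_congr rfl fun j _ => Finset.sum_congr rfl fun k _ =>
        Finset.sum_congr rfl fun l _ => ?_
    rw [T4_cyclic hT (star (c 0))]
  rw [e1, e2, e3, e4]
  have b0 := norm_sum_wickLow_T4_le hT (0 : Fin (m ^ 2)) c
  have b1 := norm_sum_ntr_three_T4_le (reducedBasis B) hT (c 0) (fun j => star (c j)) c
    (fun j => star (c j)) hq hc' hc hc'
  have b2 := norm_sum_ntr_three_T4_le (reducedBasis B) hT (star (c 0)) c (fun j => star (c j)) c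
    hq hc hc' hc
  have b4 := norm_sum_ntr_four_T4_le (reducedBasis B) hT c (fun j => star (c j)) c
    (fun j => star (c j)) hc hc' hc hc'
  rw [L4_star hT] at b2
  refine (norm_add_le _ _).trans ?_
  refine (add_le_add ((norm_add_le _ _).trans (add_le_add b0 ((norm_add_le _ _).trans
    (add_le_add ((norm_add_le _ _).trans (add_le_add ((norm_add_le _ _).trans
      (add_le_add b1 b2)) b1)) b2)))) b4).trans (le_of_eq ?_)
  ring

/-- Parseval in the local register, separately for each label of the other registers. The factor m
is due to the normalization of the inner product. -/
theorem sum_sqn_block (hB : IsStdBasis m B) (c : Fin (m ^ 2) → (Fin n → Fin (m ^ 2)) → ℂ) :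
    ∑ a, ∑ b, sqn (block (reducedBasis B) c a b) =
      m * ∑ j, if j = 0 then 0 else sqn (c j) := by
  have h1 : ∀ σ, ∑ a, ∑ b, ‖block (reducedBasis B) c a b σ‖ ^ 2 =
      m * ∑ j, if j = 0 then 0 else ‖c j σ‖ ^ 2 := by
    intro σ
    have h := nsq_sum_smul hB.orthonormal fun j => if j = 0 then 0 else c j σ
    rw [nsq_eq_sum, inv_mul_eq_iff_eq_mul₀ (by simp [NeZero.ne m])] at h
    have e : ∑ j, (if j = 0 then 0 else ‖c j σ‖ ^ 2) =
        ∑ j, ‖if j = 0 then (0 : ℂ) else c j σ‖ ^ 2 :=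
      Finset.sum_congr rfl fun j _ => by split_ifs <;> simp
    rw [e]
    rw [Fintype.card_fin] at h
    rw [← h, Finset.sum_comm]
    refine Finset.sum_congr rfl fun b _ => Finset.sum_congr rfl fun a _ => ?_
    congr 2
    simp only [block, Finset.sum_apply, Pi.smul_apply, smul_eq_mul, Matrix.sum_apply,
      Matrix.smul_apply, reducedBasis]
    refine Finset.sum_congr rfl fun j _ => ?_
    split_ifs
    · simp
    · ring
  have h2 : ∑ a, ∑ b, sqn (block (reducedBasis B) c a b) =
      ∑ σ, ∑ a, ∑ b, ‖block (reducedBasis B) c a b σ‖ ^ 2 := by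
    simp only [sqn]
    symm
    exact Finset.sum_comm.trans (Finset.sum_congr rfl fun a _ => Finset.sum_comm)
  rw [h2]
  simp only [h1, ← Finset.mul_sum]
  congr 1
  rw [Finset.sum_comm]
  refine Finset.sum_congr rfl fun j _ => ?_
  split_ifs
  · simp
  · rfl

/-- The four cubic terms cost at most 2XY + 2MY² and the quartic one MY², so the left side is at
most X² + 8XY + 3MY². The right side is X² + 6√M XY + 9MY², hence √M ≥ 4/3 suffices, and M ≥ 2
guarantees it. This is the source of the constant 3√m. -/
theorem quartic_numeric_bound {M x s q X Y : ℝ} (hM : 2 ≤ M) (hs : 0 ≤ s)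
    (hX : x ^ 2 ≤ X) (hY : s ≤ Y) (hQ : q ^ 2 ≤ M * Y) :
    x ^ 4 + 6 * x ^ 2 * s + 4 * (M⁻¹ * (x * q ^ 3)) + M⁻¹ * q ^ 4 ≤ (X + 3 * √M * Y) ^ 2 := by
  have hXn : 0 ≤ X := (sq_nonneg x).trans hX
  have hYn : 0 ≤ Y := hs.trans hY
  have h3 : q ^ 4 ≤ (M * Y) ^ 2 := by
    calc q ^ 4 = (q ^ 2) ^ 2 := by ring
      _ ≤ _ := pow_le_pow_left₀ (sq_nonneg q) hQ 2
  have hcub : M⁻¹ * (x * q ^ 3) ≤ (X * Y + M * Y ^ 2) / 2 := by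
    have h1 : x * q ^ 3 ≤ (x ^ 2 * q ^ 2 + q ^ 4) / 2 := by
      linarith [sq_nonneg (x * q - q ^ 2), show (x * q - q ^ 2) ^ 2 =
        x ^ 2 * q ^ 2 + q ^ 4 - 2 * (x * q ^ 3) by ring]
    have h2 : x ^ 2 * q ^ 2 ≤ X * (M * Y) := mul_le_mul hX hQ (by positivity) hXn
    rw [inv_mul_le_iff₀ (by linarith)]
    calc x * q ^ 3 ≤ (X * (M * Y) + (M * Y) ^ 2) / 2 := by linarith
      _ = _ := by ring
  have hquad : M⁻¹ * q ^ 4 ≤ M * Y ^ 2 := by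
    rw [inv_mul_le_iff₀ (by linarith)]
    calc q ^ 4 ≤ (M * Y) ^ 2 := h3
      _ = _ := by ring
  have hs2 : (√M) ^ 2 = M := Real.sq_sqrt (by linarith)
  have hs1 : 4 / 3 ≤ √M := by
    apply Real.le_sqrt_of_sq_le
    norm_num
    linarith
  have h5 : x ^ 4 ≤ X ^ 2 := by
    calc x ^ 4 = (x ^ 2) ^ 2 := by ring
      _ ≤ _ := pow_le_pow_left₀ (sq_nonneg x) hX 2
  have h6 : x ^ 2 * s ≤ X * Y := mul_le_mul hX hY hs hXn
  have h7 : 4 / 3 * (X * Y) ≤ √M * (X * Y) :=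
    mul_le_mul_of_nonneg_right hs1 (mul_nonneg hXn hYn)
  have h8 : (X + 3 * √M * Y) ^ 2 = X ^ 2 + 6 * (√M * (X * Y)) + 9 * (M * Y ^ 2) := by
    linear_combination 9 * Y ^ 2 * hs2
  have h9 : 0 ≤ M * Y ^ 2 := by positivity
  rw [h8]
  linarith

theorem sqrt_norm_sum_traceTensor_T4_le (hm : 2 ≤ m) (hT : ∀ i, IsTracial (T i))
    (hB : IsStdBasis m B)
    (c : Fin (m ^ 2) → (Fin n → Fin (m ^ 2)) → ℂ) {X Y : ℝ} (hX : L4 T (c 0) ^ 2 ≤ X)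
    (hY : ∑ j, (if j = 0 then 0 else L4 T (c j) ^ 2) ≤ Y)
    (hQ : ∑ a, ∑ b, L4 T (block (reducedBasis B) c a b) ^ 2 ≤ m * Y) :
    √‖∑ j, ∑ k, ∑ l, ∑ p, traceTensor B j k l p * T4 T (c j) (star (c k)) (c l) (star (c p))‖ ≤
      X + 3 * √m * Y := by
  have hY0 : 0 ≤ ∑ j, (if j = 0 then 0 else L4 T (c j) ^ 2) :=
    Finset.sum_nonneg fun j _ => by split_ifs <;> positivity
  have hQ0 : 0 ≤ ∑ a, ∑ b, L4 T (block (reducedBasis B) c a b) ^ 2 := by positivity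
  have h := norm_sum_traceTensor_T4_le hT hB c (Real.sqrt_nonneg _) (Real.sq_sqrt hQ0).symm
  have hXn : 0 ≤ X := (sq_nonneg _).trans hX
  have hYn : 0 ≤ Y := hY0.trans hY
  exact Real.sqrt_le_iff.2 ⟨by positivity, h.trans (quartic_numeric_bound (by exact_mod_cast hm)
    hY0 hX hY (by rwa [Real.sq_sqrt hQ0]))⟩

theorem wtNZ_cons (j : Fin (m ^ 2)) (σ : Fin n → Fin (m ^ 2)) :
    wtNZ (Fin.cons j σ : Fin (n + 1) → Fin (m ^ 2)) = (if j = 0 then 0 else 1) + wtNZ σ := by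
  simp only [wtNZ, Finset.card_filter, Fin.sum_univ_succ, Fin.cons_zero, Fin.cons_succ]
  congr 1
  by_cases h : j = 0 <;> simp [h]

theorem sqn_cons (c : (Fin (n + 1) → Fin (m ^ 2)) → ℂ) :
    sqn c = sqn (fun σ => c (Fin.cons 0 σ)) +
      ∑ j, if j = 0 then 0 else sqn (fun σ => c (Fin.cons j σ)) := by
  have h : sqn c = ∑ j, sqn (fun σ => c (Fin.cons j σ)) := sum_cons _
  rw [h, ← Finset.add_sum_erase _ _ (Finset.mem_univ (0 : Fin (m ^ 2)))]
  congr 1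
  rw [← Finset.add_sum_erase _ _ (Finset.mem_univ (0 : Fin (m ^ 2)))]
  simp only [if_true, zero_add]
  exact Finset.sum_congr rfl fun j hj => by rw [if_neg (Finset.ne_of_mem_erase hj)]

theorem N4_zero (T : Fin n → Fin (m ^ 2) → Fin (m ^ 2) → Fin (m ^ 2) → Fin (m ^ 2) → ℂ) :
    N4 T 0 = 0 := by
  simp [N4, T4]

/-- Hypercontractivity: the fourth moment of an operator of degree at most `d` is controlled by its
second moment, each register being either a quantum register or a Gaussian one. -/
theorem sqrt_N4_le (hm : 2 ≤ m) (hB : IsStdBasis m B) (n : ℕ) :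
    ∀ (T : Fin n → Fin (m ^ 2) → Fin (m ^ 2) → Fin (m ^ 2) → Fin (m ^ 2) → ℂ),
      (∀ i, T i = (fun j k l p => (wick 0 j k l p : ℂ)) ∨ T i = traceTensor B) →
      ∀ (d : ℕ) (c : (Fin n → Fin (m ^ 2)) → ℂ), (∀ σ, c σ ≠ 0 → wtNZ σ ≤ d) →
        √(N4 T c) ≤ (3 * √m) ^ d * sqn c := by
  have hs1 : 1 ≤ √(m : ℝ) := Real.one_le_sqrt.2 (by exact_mod_cast (by omega : 1 ≤ m))
  induction n with
  | zero =>
    intro T _ d c _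
    have h1 : N4 T c = (‖c fun _ => 0‖ ^ 2) ^ 2 := by
      simp only [N4, T4, Fintype.sum_subsingleton _ (fun _ : Fin 0 => (0 : Fin (m ^ 2)))]
      simp
      ring
    have h2 : sqn c = ‖c fun _ => 0‖ ^ 2 := Fintype.sum_subsingleton _ _
    rw [h1, Real.sqrt_sq (by positivity), h2]
    exact le_mul_of_one_le_left (by positivity) (one_le_pow₀ (by linarith))
  | succ n ih =>
    intro T hT d c hc
    have hT' : ∀ i, IsTracial (T i) := fun i => by
      rcases hT i with h | h <;> rw [h]
      exacts [wick_isTracial 0, traceTensor_isTracial hB]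
    have ih' := ih (fun i => T i.succ) fun i => hT i.succ
    set C : Fin (m ^ 2) → (Fin n → Fin (m ^ 2)) → ℂ := fun j σ => c (Fin.cons j σ) with hC
    have hN : N4 T c = ‖∑ j, ∑ k, ∑ l, ∑ p, T 0 j k l p *
        T4 (fun i => T i.succ) (C j) (star (C k)) (C l) (star (C p))‖ := by
      rw [N4, T4_succ]
      rfl
    have hX : L4 (fun i => T i.succ) (C 0) ^ 2 ≤ (3 * √m) ^ d * sqn (C 0) := by
      rw [L4_sq]
      refine ih' d _ fun σ hσ => ?_
      have := hc _ hσ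
      rw [wtNZ_cons] at this
      omega
    -- `y` is the hypercontractive constant for degree d − 1; if d = 0 every nontrivial slice
    -- vanishes and `y = 0` works. The claim is made for all `v` supported where some nontrivial
    -- slice is nonzero, so that it covers the blocks as well as the slices.
    obtain ⟨y, hy0, hyd, hy⟩ : ∃ y : ℝ, 0 ≤ y ∧ 3 * √m * y ≤ (3 * √m) ^ d ∧
        ∀ v : (Fin n → Fin (m ^ 2)) → ℂ, (∀ σ, v σ ≠ 0 → ∃ j, j ≠ 0 ∧ C j σ ≠ 0) →
          L4 (fun i => T i.succ) v ^ 2 ≤ y * sqn v := by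
      rcases d with _ | d
      · refine ⟨0, le_rfl, by simp, fun v hv => ?_⟩
        have hv0 : v = 0 := by
          funext σ
          by_contra h
          obtain ⟨j, hj, hjσ⟩ := hv σ h
          have := hc _ hjσ
          rw [wtNZ_cons, if_neg hj] at this
          omega
        rw [L4_sq, hv0, N4_zero]
        simp
      · refine ⟨(3 * √m) ^ d, by positivity, le_of_eq (by ring), fun v hv => ?_⟩
        rw [L4_sq]
        refine ih' d v fun σ hσ => ?_
        obtain ⟨j, hj, hjσ⟩ := hv σ hσ
        have := hc _ hjσ
        rw [wtNZ_cons, if_neg hj] at this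
        omega
    have hY : ∑ j, (if j = 0 then 0 else L4 (fun i => T i.succ) (C j) ^ 2) ≤
        y * ∑ j, if j = 0 then 0 else sqn (C j) := by
      rw [Finset.mul_sum]
      refine Finset.sum_le_sum fun j _ => ?_
      split_ifs with hj
      · simp
      · exact hy _ fun σ hσ => ⟨j, hj, hσ⟩
    have hQ : ∑ a, ∑ b, L4 (fun i => T i.succ) (block (reducedBasis B) C a b) ^ 2 ≤
        m * (y * ∑ j, if j = 0 then 0 else sqn (C j)) := by
      rw [mul_left_comm, ← sum_sqn_block hB, Finset.mul_sum]
      refine Finset.sum_le_sum fun a _ => ?_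
      rw [Finset.mul_sum]
      refine Finset.sum_le_sum fun b _ => hy _ fun σ hσ => ?_
      by_contra hcon
      push Not at hcon
      refine hσ ?_
      simp only [block, Finset.sum_apply, Pi.smul_apply]
      refine Finset.sum_eq_zero fun j _ => ?_
      by_cases hj : j = 0
      · simp [reducedBasis, hj]
      · simp [hcon j hj]
    have hE : 0 ≤ ∑ j, if j = 0 then 0 else sqn (C j) :=
      Finset.sum_nonneg fun j _ => by split_ifs; exacts [le_rfl, sqn_nonneg _]
    have key : √(N4 T c) ≤ (3 * √m) ^ d * sqn (C 0) +
        3 * √m * (y * ∑ j, if j = 0 then 0 else sqn (C j)) := by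
      rw [hN]
      rcases hT 0 with h | h
      · rw [h]
        refine (sqrt_norm_sum_wick_T4_le (fun i => hT' i.succ) 0 C hX hY).trans ?_
        have := mul_nonneg hy0 hE
        gcongr
        linarith
      · rw [h]
        exact sqrt_norm_sum_traceTensor_T4_le hm (fun i => hT' i.succ) hB C hX hY hQ
    refine key.trans ?_
    rw [sqn_cons, mul_add, ← mul_assoc]
    gcongr

end AddRegister

/-! ### Moments of Gaussians -/

section GaussianMoments

theorem integrable_pow_gaussianReal (k : ℕ) :
    Integrable (fun x : ℝ => x ^ k) (gaussianReal 0 1) := by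
  have h := (memLp_id_gaussianReal (μ := 0) (v := 1) (k : NNReal)).integrable_norm_pow'
  refine (integrable_norm_iff (by fun_prop)).1 (h.congr (Filter.Eventually.of_forall fun x => ?_))
  simp

theorem integrable_pow_mul_gaussianPDFReal (k : ℕ) :
    Integrable fun x : ℝ => x ^ k * gaussianPDFReal 0 1 x := by
  have h := integrable_rpow_mul_exp_neg_mul_sq (b := 1 / 2) (by norm_num) (s := k)
    (by have : (0 : ℝ) ≤ k := Nat.cast_nonneg k
        linarith)
  refine (h.const_mul ((√(2 * Real.pi * 1))⁻¹)).congr (Filter.Eventually.of_forall fun x => ?_)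
  simp only [gaussianPDFReal, Real.rpow_natCast, NNReal.coe_one, sub_zero]
  rw [show -(1 / 2) * x ^ 2 = -x ^ 2 / (2 * 1) by ring]
  ring

theorem integral_pow_gaussianReal_eq (k : ℕ) :
    ∫ x, x ^ k ∂gaussianReal 0 1 = ∫ x, x ^ k * gaussianPDFReal 0 1 x := by
  rw [integral_gaussianReal_eq_integral_smul one_ne_zero]
  exact integral_congr_ae (Filter.Eventually.of_forall fun x => by simp [mul_comm])

/-- The recursion for the moments of the standard Gaussian. -/
theorem integral_pow_add_two_gaussianReal (k : ℕ) :
    ∫ x, x ^ (k + 2) ∂gaussianReal 0 1 = (k + 1) * ∫ x, x ^ k ∂gaussianReal 0 1 := by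
  -- The density φ satisfies φ' = −xφ; the recursion is integration by parts of x^(k+1) against φ'.
  have hv : ∀ x : ℝ, HasDerivAt (gaussianPDFReal 0 1) (-x * gaussianPDFReal 0 1 x) x := by
    intro x
    have h1 : HasDerivAt (fun x : ℝ => -(x - 0) ^ 2 / (2 * (1 : NNReal))) (-x) x := by
      have := (((hasDerivAt_id x).sub_const 0).pow 2).neg.div_const (2 * ((1 : NNReal) : ℝ))
      refine this.congr_deriv ?_
      simp
      ring
    have h2 := (h1.exp).const_mul ((√(2 * Real.pi * (1 : NNReal)))⁻¹)
    rw [gaussianPDFReal_def]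
    refine h2.congr_deriv ?_
    ring
  have hu : ∀ x : ℝ, HasDerivAt (fun x : ℝ => x ^ (k + 1)) ((k + 1) * x ^ k) x := by
    intro x
    simpa using hasDerivAt_pow (k + 1) x
  have h := integral_mul_deriv_eq_deriv_mul_of_integrable (fun x _ => hu x) (fun x _ => hv x) ?_ ?_ ?_
  · rw [integral_pow_gaussianReal_eq, integral_pow_gaussianReal_eq, ← integral_const_mul]
    have e1 : ∫ x : ℝ, x ^ (k + 2) * gaussianPDFReal 0 1 x =
        -∫ x : ℝ, x ^ (k + 1) * (-x * gaussianPDFReal 0 1 x) := by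
      rw [← integral_neg]
      exact integral_congr_ae (Filter.Eventually.of_forall fun x => by simp only; ring)
    rw [e1, h, neg_neg]
    exact integral_congr_ae (Filter.Eventually.of_forall fun x => by simp only; ring)
  · refine (integrable_pow_mul_gaussianPDFReal (k + 2)).neg.congr
      (Filter.Eventually.of_forall fun x => ?_)
    simp only [Pi.neg_apply, Pi.mul_apply]
    ring
  · refine ((integrable_pow_mul_gaussianPDFReal k).const_mul ((k : ℝ) + 1)).congr
      (Filter.Eventually.of_forall fun x => ?_)
    simp only [Pi.mul_apply]
    ring
  · exact integrable_pow_mul_gaussianPDFReal (k + 1)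

/-- The `k`-th moment of the standard Gaussian. -/
def gaussMoment (k : ℕ) : ℝ := ∫ x, x ^ k ∂gaussianReal 0 1

theorem gaussMoment_zero : gaussMoment 0 = 1 := by simp [gaussMoment]

theorem gaussMoment_one : gaussMoment 1 = 0 := by simp [gaussMoment, integral_id_gaussianReal]

theorem gaussMoment_add_two (k : ℕ) : gaussMoment (k + 2) = (k + 1) * gaussMoment k :=
  integral_pow_add_two_gaussianReal k

theorem gaussMoment_two : gaussMoment 2 = 1 := by
  rw [gaussMoment_add_two, gaussMoment_zero]; simp

theorem gaussMoment_three : gaussMoment 3 = 0 := by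
  rw [gaussMoment_add_two, gaussMoment_one]; simp

theorem gaussMoment_four : gaussMoment 4 = 3 := by
  rw [gaussMoment_add_two, gaussMoment_two]; norm_num

variable {α : Type} [Fintype α] [DecidableEq α]

/-- The coordinate `x j`, replaced by `1` for the index `z`. -/
def gcoord (z : α) (x : α → ℝ) (j : α) : ℝ := if j = z then 1 else x j

/-- The exponent of `x r` in `gcoord z x j`. -/
def gexp (z j r : α) : ℕ := if j = z then 0 else if j = r then 1 else 0

theorem gcoord_eq_prod (z : α) (x : α → ℝ) (j : α) : gcoord z x j = ∏ r, x r ^ gexp z j r := by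
  unfold gcoord gexp
  split_ifs
  · simp
  · rw [Finset.prod_eq_single j] <;> simp +contextual [eq_comm]

theorem integrable_prod_pow (a : α → ℕ) :
    Integrable (fun x : α → ℝ => ∏ r, x r ^ a r) (Measure.pi fun _ => gaussianReal 0 1) :=
  Integrable.fintype_prod fun r => integrable_pow_gaussianReal (a r)

theorem integral_prod_pow (a : α → ℕ) :
    ∫ x : α → ℝ, ∏ r, x r ^ a r ∂(Measure.pi fun _ => gaussianReal 0 1) =
      ∏ r, gaussMoment (a r) :=
  integral_fintype_prod_eq_prod (fun r (y : ℝ) => y ^ a r)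

theorem gcoord_mul_four (z : α) (x : α → ℝ) (j k l p : α) :
    gcoord z x j * gcoord z x k * gcoord z x l * gcoord z x p =
      ∏ r, x r ^ (gexp z j r + gexp z k r + gexp z l r + gexp z p r) := by
  simp only [gcoord_eq_prod, ← Finset.prod_mul_distrib, pow_add]

theorem prod_gaussMoment_one {z j : α} (hj : j ≠ z) : ∏ r, gaussMoment (gexp z j r) = 0 :=
  Finset.prod_eq_zero (Finset.mem_univ j) (by simp [gexp, hj, gaussMoment_one])

theorem prod_gaussMoment_two {z j k : α} (hj : j ≠ z) (hk : k ≠ z) :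
    ∏ r, gaussMoment (gexp z j r + gexp z k r) = if j = k then 1 else 0 := by
  split_ifs with h
  · subst h
    refine Finset.prod_eq_one fun r _ => ?_
    by_cases hr : j = r
    · subst hr; simp [gexp, hj, gaussMoment_two]
    · simp [gexp, hj, hr, gaussMoment_zero]
  · exact Finset.prod_eq_zero (Finset.mem_univ j)
      (by simp [gexp, hj, hk, Ne.symm h, gaussMoment_one])

theorem prod_gaussMoment_three {z j k l : α} (hj : j ≠ z) (hk : k ≠ z) (hl : l ≠ z) :
    ∏ r, gaussMoment (gexp z j r + gexp z k r + gexp z l r) = 0 := by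
  by_cases hjk : j = k
  · subst hjk
    refine Finset.prod_eq_zero (Finset.mem_univ l) ?_
    by_cases h : j = l <;> simp [gexp, hj, hl, h, gaussMoment_one, gaussMoment_three]
  · by_cases hjl : j = l
    · subst hjl
      exact Finset.prod_eq_zero (Finset.mem_univ k) (by simp [gexp, hj, hk, hjk, gaussMoment_one])
    · exact Finset.prod_eq_zero (Finset.mem_univ j)
        (by simp [gexp, hj, hk, hl, Ne.symm hjk, Ne.symm hjl, gaussMoment_one])

/-- An index occurring an odd number of times kills the product, so only pairings survive. When all
four indices coincide the fourth moment 3 counts the three coinciding pairings. -/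
theorem prod_gaussMoment_four {z j k l p : α} (hj : j ≠ z) (hk : k ≠ z) (hl : l ≠ z)
    (hp : p ≠ z) :
    ∏ r, gaussMoment (gexp z j r + gexp z k r + gexp z l r + gexp z p r) =
      (if j = k then 1 else 0) * (if l = p then 1 else 0) +
      (if j = l then 1 else 0) * (if k = p then 1 else 0) +
      (if j = p then 1 else 0) * (if k = l then 1 else 0) := by
  have pair : ∀ a b : α, a ≠ b → a ≠ z → b ≠ z → ∀ f : α → ℕ,
      (∀ r, f r = 2 * gexp z a r + 2 * gexp z b r) → ∏ r, gaussMoment (f r) = 1 := by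
    intro a b hab ha hb f hf
    refine Finset.prod_eq_one fun r _ => ?_
    rw [hf]
    by_cases h1 : a = r
    · subst h1; simp [gexp, ha, hb, Ne.symm hab, gaussMoment_two]
    · by_cases h2 : b = r
      · subst h2; simp [gexp, ha, hb, h1, gaussMoment_two]
      · simp [gexp, ha, hb, h1, h2, gaussMoment_zero]
  by_cases hjk : j = k
  · subst hjk
    by_cases hlp : l = p
    · subst hlp
      by_cases hjl : j = l
      · subst hjl
        rw [Finset.prod_eq_single j]
        · simp [gexp, hj, gaussMoment_four]; norm_num
        · intro r _ hr
          simp [gexp, hj, Ne.symm hr, gaussMoment_zero]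
        · simp
      · rw [pair j l hjl hj hl _ fun r => by ring]
        simp [hjl]
    · by_cases hjl : j = l
      · subst hjl
        rw [Finset.prod_eq_zero (Finset.mem_univ p)]
        · simp [hlp]
        · simp [gexp, hj, hp, hlp, gaussMoment_one]
      · rw [Finset.prod_eq_zero (Finset.mem_univ l)]
        · simp [hjl, hlp]
        · simp [gexp, hj, hl, hp, hjl, Ne.symm hlp, gaussMoment_one]
  · by_cases hjl : j = l
    · subst hjl
      by_cases hkp : k = p
      · subst hkp
        rw [pair j k hjk hj hk _ fun r => by ring]
        simp [hjk]
      · rw [Finset.prod_eq_zero (Finset.mem_univ k)]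
        · simp [hjk, hkp, Ne.symm hjk]
        · simp [gexp, hj, hk, hp, hjk, Ne.symm hkp, gaussMoment_one]
    · by_cases hjp : j = p
      · subst hjp
        by_cases hkl : k = l
        · subst hkl
          rw [pair j k hjk hj hk _ fun r => by ring]
          simp [hjk]
        · rw [Finset.prod_eq_zero (Finset.mem_univ k)]
          · simp [hjk, hjl, hkl]
          · simp [gexp, hj, hk, hl, hjk, Ne.symm hkl, gaussMoment_one]
      · rw [Finset.prod_eq_zero (Finset.mem_univ j)]
        · simp [hjk, hjl, hjp]
        · simp [gexp, hj, hk, hl, hp, Ne.symm hjk, Ne.symm hjl, Ne.symm hjp, gaussMoment_one]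

theorem gexp_self (z r : α) : gexp z z r = 0 := by simp [gexp]

theorem prod_gaussMoment_eq_wick (z j k l p : α) :
    ∏ r, gaussMoment (gexp z j r + gexp z k r + gexp z l r + gexp z p r) = wick z j k l p := by
  by_cases hj : j = z <;> by_cases hk : k = z <;> by_cases hl : l = z <;> by_cases hp : p = z <;>
    simp [hj, hk, hl, hp, gexp_self, wick, wickLow, wickPair, indZ, indD, gaussMoment_zero,
      prod_gaussMoment_one, prod_gaussMoment_two, prod_gaussMoment_three, prod_gaussMoment_four]

theorem integrable_gcoord_mul_four (z j k l p : α) :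
    Integrable (fun x => gcoord z x j * gcoord z x k * gcoord z x l * gcoord z x p)
      (Measure.pi fun _ => gaussianReal 0 1) := by
  simp only [gcoord_mul_four]
  exact integrable_prod_pow _

theorem integral_gcoord_mul_four (z j k l p : α) :
    ∫ x, gcoord z x j * gcoord z x k * gcoord z x l * gcoord z x p
      ∂(Measure.pi fun _ => gaussianReal 0 1) = wick z j k l p := by
  simp only [gcoord_mul_four]
  rw [integral_prod_pow, prod_gaussMoment_eq_wick]

theorem integrable_gcoord_mul (z j k : α) :
    Integrable (fun x => gcoord z x j * gcoord z x k) (Measure.pi fun _ => gaussianReal 0 1) := by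
  simpa [gcoord] using integrable_gcoord_mul_four z j k z z

theorem integral_gcoord_mul (z j k : α) :
    ∫ x, gcoord z x j * gcoord z x k ∂(Measure.pi fun _ => gaussianReal 0 1) =
      if j = k then 1 else 0 := by
  have h := integral_gcoord_mul_four z j k z z
  have e : wick z j k z z = if j = k then 1 else 0 := by
    by_cases hj : j = z <;> by_cases hk : k = z <;>
      simp [wick, wickLow, wickPair, indZ, indD, hj, hk]
    exact Ne.symm hk
  rw [← e, ← h]
  simp [gcoord]

theorem integrable_gcoord (z j : α) :
    Integrable (fun x => gcoord z x j) (Measure.pi fun _ => gaussianReal 0 1) := by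
  simpa [gcoord] using integrable_gcoord_mul z j z

theorem integral_gcoord (z j : α) :
    ∫ x, gcoord z x j ∂(Measure.pi fun _ => gaussianReal 0 1) = if j = z then 1 else 0 := by
  rw [← integral_gcoord_mul z j z]
  simp [gcoord]

end GaussianMoments

/-- Used to condition on all registers except `i`: the coordinate `i` is drawn afresh while the
others stay fixed, which avoids splitting the product space. -/
theorem measurePreserving_update {ι : Type} [Fintype ι] [DecidableEq ι] {X : ι → Type}
    [∀ i, MeasurableSpace (X i)] (μ : ∀ i, Measure (X i)) [∀ i, IsProbabilityMeasure (μ i)]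
    (i : ι) : MeasurePreserving (fun p : (∀ i, X i) × X i => Function.update p.1 i p.2)
      ((Measure.pi μ).prod (μ i)) (Measure.pi μ) := by
  refine ⟨measurable_update', ?_⟩
  symm
  refine Measure.pi_eq fun s hs => ?_
  rw [Measure.map_apply measurable_update' (MeasurableSet.univ_pi hs)]
  have : (fun p : (∀ i, X i) × X i => Function.update p.1 i p.2) ⁻¹' Set.univ.pi s =
      (Set.univ.pi (Function.update s i Set.univ)) ×ˢ s i := by
    ext ⟨ω, g⟩
    simp only [Set.mem_preimage, Set.mem_pi, Set.mem_univ, forall_true_left, Set.mem_prod]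
    constructor
    · intro h
      refine ⟨fun j => ?_, by simpa using h i⟩
      by_cases hj : j = i
      · subst hj; simp
      · simpa [hj] using h j
    · rintro ⟨h1, h2⟩ j
      by_cases hj : j = i
      · subst hj; simpa using h2
      · simpa [hj] using h1 j
  rw [this, Measure.prod_prod, Measure.pi_pi, ← Finset.mul_prod_erase _ _ (Finset.mem_univ i),
    ← Finset.mul_prod_erase _ _ (Finset.mem_univ i)]
  simp only [Function.update_self, measure_univ, one_mul]
  rw [mul_comm]
  congr 1
  exact Finset.prod_congr rfl fun j hj => by
    rw [Function.update_of_ne (Finset.ne_of_mem_erase hj)]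

/-! ### Hybrid operators on all the registers -/

section Hyb

variable {m n : ℕ} [NeZero m] {B : Fin (m ^ 2) → Matrix (Fin m) (Fin m) ℂ}

instance : IsProbabilityMeasure (gaussFamily m n) := by
  unfold gaussFamily; infer_instance

theorem gvar_eq_gcoord (ω : Fin n → Fin (m ^ 2) → ℝ) (i : Fin n) (j : Fin (m ^ 2)) :
    gvar ω i j = gcoord 0 (ω i) j := by
  simp [gvar, gcoord]

/-- The operator on the register `i`: a basis element if `i ∈ H`, a Gaussian multiple of the
identity otherwise. -/
def regOp (B : Fin (m ^ 2) → Matrix (Fin m) (Fin m) ℂ) (H : Finset (Fin n)) (i : Fin n)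
    (x : Fin (m ^ 2) → ℝ) (j : Fin (m ^ 2)) : Matrix (Fin m) (Fin m) ℂ :=
  if i ∈ H then B j else (gcoord 0 x j : ℂ) • 1

/-- The hybrid operator with coefficients `c`, extended by the identity to all the registers. -/
def hyb (B : Fin (m ^ 2) → Matrix (Fin m) (Fin m) ℂ) (H : Finset (Fin n))
    (c : (Fin n → Fin (m ^ 2)) → ℂ) (ω : Fin n → Fin (m ^ 2) → ℝ) : Op m (Fin n) :=
  ∑ σ, c σ • tens fun i => regOp B H i (ω i) (σ i)

theorem regOp_isHermitian (hB : IsStdBasis m B) (H : Finset (Fin n)) (i : Fin n)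
    (x : Fin (m ^ 2) → ℝ) (j : Fin (m ^ 2)) : (regOp B H i x j).IsHermitian := by
  unfold regOp
  split_ifs
  · exact hB.isHermitian j
  · simp [Matrix.IsHermitian, Matrix.conjTranspose_smul]

theorem hyb_isHermitian (hB : IsStdBasis m B) (H : Finset (Fin n))
    {c : (Fin n → Fin (m ^ 2)) → ℂ} (hc : star c = c) (ω : Fin n → Fin (m ^ 2) → ℝ) :
    (hyb B H c ω).IsHermitian := by
  rw [Matrix.IsHermitian, hyb, Matrix.conjTranspose_sum]
  refine Finset.sum_congr rfl fun σ _ => ?_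
  rw [Matrix.conjTranspose_smul, (tens_isHermitian fun i => regOp_isHermitian hB H i _ _).eq]
  congr 1
  exact congrFun hc σ

theorem continuous_hyb (B : Fin (m ^ 2) → Matrix (Fin m) (Fin m) ℂ) (H : Finset (Fin n))
    (c : (Fin n → Fin (m ^ 2)) → ℂ) : Continuous (hyb B H c) := by
  refine continuous_matrix fun a b => ?_
  simp only [hyb, Matrix.sum_apply, Matrix.smul_apply, tens, Matrix.of_apply, smul_eq_mul]
  refine continuous_finsetSum _ fun σ _ => continuous_const.mul
    (continuous_finsetProd _ fun i _ => ?_)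
  unfold regOp
  split_ifs
  · exact continuous_const
  · simp only [Matrix.smul_apply, smul_eq_mul, gcoord]
    split_ifs
    · exact continuous_const
    · fun_prop

/-- The fourth moment tensor of the register `i`. -/
def regTensor (B : Fin (m ^ 2) → Matrix (Fin m) (Fin m) ℂ) (H : Finset (Fin n)) (i : Fin n) :
    Fin (m ^ 2) → Fin (m ^ 2) → Fin (m ^ 2) → Fin (m ^ 2) → ℂ :=
  if i ∈ H then traceTensor B else fun j k l p => (wick 0 j k l p : ℂ)

theorem regTensor_cases (B : Fin (m ^ 2) → Matrix (Fin m) (Fin m) ℂ) (H : Finset (Fin n))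
    (i : Fin n) : regTensor B H i = (fun j k l p => (wick 0 j k l p : ℂ)) ∨
      regTensor B H i = traceTensor B := by
  unfold regTensor
  split_ifs <;> simp

theorem integrable_ntr_regOp (B : Fin (m ^ 2) → Matrix (Fin m) (Fin m) ℂ) (H : Finset (Fin n))
    (i : Fin n) (j k l p : Fin (m ^ 2)) :
    Integrable (fun x => ntr (regOp B H i x j * regOp B H i x k * regOp B H i x l *
      regOp B H i x p)) (Measure.pi fun _ => gaussianReal 0 1) ∧
    ∫ x, ntr (regOp B H i x j * regOp B H i x k * regOp B H i x l * regOp B H i x p)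
      ∂(Measure.pi fun _ => gaussianReal 0 1) = regTensor B H i j k l p := by
  unfold regOp regTensor
  split_ifs
  · simp [traceTensor]
  · have e : ∀ x : Fin (m ^ 2) → ℝ,
        ntr ((gcoord 0 x j : ℂ) • (1 : Matrix (Fin m) (Fin m) ℂ) * (gcoord 0 x k : ℂ) • 1 *
          (gcoord 0 x l : ℂ) • 1 * (gcoord 0 x p : ℂ) • 1) =
        ((gcoord 0 x j * gcoord 0 x k * gcoord 0 x l * gcoord 0 x p : ℝ) : ℂ) := by
      intro x
      simp only [Matrix.mul_smul, Matrix.mul_one, ntr_smul, ntr_one]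
      push_cast
      ring
    simp only [e]
    refine ⟨(integrable_gcoord_mul_four 0 j k l p).ofReal, ?_⟩
    rw [integral_complex_ofReal, integral_gcoord_mul_four]

theorem ntr_hyb_mul_four (B : Fin (m ^ 2) → Matrix (Fin m) (Fin m) ℂ) (H : Finset (Fin n))
    (a b c d : (Fin n → Fin (m ^ 2)) → ℂ) (ω : Fin n → Fin (m ^ 2) → ℝ) :
    ntr (hyb B H a ω * hyb B H b ω * hyb B H c ω * hyb B H d ω) =
      ∑ σ₁, ∑ σ₂, ∑ σ₃, ∑ σ₄, a σ₁ * b σ₂ * c σ₃ * d σ₄ *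
        ∏ i, ntr (regOp B H i (ω i) (σ₁ i) * regOp B H i (ω i) (σ₂ i) *
          regOp B H i (ω i) (σ₃ i) * regOp B H i (ω i) (σ₄ i)) := by
  simp only [← ntr_tens, ← tens_mul]
  have h : ∀ c, hyb B H c ω = ∑ σ, c σ • tens fun i => regOp B H i (ω i) (σ i) := fun _ => rfl
  rw [h a, Finset.sum_mul, Finset.sum_mul, Finset.sum_mul, ntr_sum]
  refine Finset.sum_congr rfl fun σ₁ _ => ?_
  rw [h b, Finset.mul_sum, Finset.sum_mul, Finset.sum_mul, ntr_sum]
  refine Finset.sum_congr rfl fun σ₂ _ => ?_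
  rw [h c, Finset.mul_sum, Finset.sum_mul, ntr_sum]
  refine Finset.sum_congr rfl fun σ₃ _ => ?_
  rw [h d, Finset.mul_sum, ntr_sum]
  refine Finset.sum_congr rfl fun σ₄ _ => ?_
  simp only [Matrix.smul_mul, Matrix.mul_smul, ntr_smul]
  ring

theorem integrable_ntr_hyb_mul_four (B : Fin (m ^ 2) → Matrix (Fin m) (Fin m) ℂ)
    (H : Finset (Fin n)) (a b c d : (Fin n → Fin (m ^ 2)) → ℂ) :
    Integrable (fun ω => ntr (hyb B H a ω * hyb B H b ω * hyb B H c ω * hyb B H d ω))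
      (gaussFamily m n) := by
  simp only [ntr_hyb_mul_four]
  refine integrable_finsetSum _ fun σ₁ _ => integrable_finsetSum _ fun σ₂ _ =>
    integrable_finsetSum _ fun σ₃ _ => integrable_finsetSum _ fun σ₄ _ => ?_
  refine Integrable.const_mul ?_ _
  exact Integrable.fintype_prod (f := fun i x => ntr (regOp B H i x (σ₁ i) *
    regOp B H i x (σ₂ i) * regOp B H i x (σ₃ i) * regOp B H i x (σ₄ i)))
    fun i => (integrable_ntr_regOp B H i _ _ _ _).1

/-- The normalized trace factorizes over the registers and the Gaussian registers are independent,
so each register contributes its own fourth moment tensor. This connects the random operators with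
the abstract quartic form. -/
theorem integral_ntr_hyb_mul_four (B : Fin (m ^ 2) → Matrix (Fin m) (Fin m) ℂ)
    (H : Finset (Fin n)) (a b c d : (Fin n → Fin (m ^ 2)) → ℂ) :
    ∫ ω, ntr (hyb B H a ω * hyb B H b ω * hyb B H c ω * hyb B H d ω) ∂gaussFamily m n =
      T4 (regTensor B H) a b c d := by
  have hint : ∀ σ₁ σ₂ σ₃ σ₄ : Fin n → Fin (m ^ 2), Integrable (fun ω => a σ₁ * b σ₂ * c σ₃ *
      d σ₄ * ∏ i, ntr (regOp B H i (ω i) (σ₁ i) * regOp B H i (ω i) (σ₂ i) *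
          regOp B H i (ω i) (σ₃ i) * regOp B H i (ω i) (σ₄ i))) (gaussFamily m n) := by
    intro σ₁ σ₂ σ₃ σ₄
    refine Integrable.const_mul ?_ _
    exact Integrable.fintype_prod (f := fun i x => ntr (regOp B H i x (σ₁ i) *
      regOp B H i x (σ₂ i) * regOp B H i x (σ₃ i) * regOp B H i x (σ₄ i)))
      fun i => (integrable_ntr_regOp B H i _ _ _ _).1
  simp only [ntr_hyb_mul_four]
  rw [integral_finsetSum _ fun σ₁ _ => integrable_finsetSum _ fun σ₂ _ =>
    integrable_finsetSum _ fun σ₃ _ => integrable_finsetSum _ fun σ₄ _ => hint _ _ _ _]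
  refine Finset.sum_congr rfl fun σ₁ _ => ?_
  rw [integral_finsetSum _ fun σ₂ _ =>
    integrable_finsetSum _ fun σ₃ _ => integrable_finsetSum _ fun σ₄ _ => hint _ _ _ _]
  refine Finset.sum_congr rfl fun σ₂ _ => ?_
  rw [integral_finsetSum _ fun σ₃ _ => integrable_finsetSum _ fun σ₄ _ => hint _ _ _ _]
  refine Finset.sum_congr rfl fun σ₃ _ => ?_
  rw [integral_finsetSum _ fun σ₄ _ => hint _ _ _ _]
  refine Finset.sum_congr rfl fun σ₄ _ => ?_
  rw [integral_const_mul]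
  congr 1
  refine (integral_fintype_prod_eq_prod (fun i x => ntr (regOp B H i x (σ₁ i) *
    regOp B H i x (σ₂ i) * regOp B H i x (σ₃ i) * regOp B H i x (σ₄ i)))).trans ?_
  exact Finset.prod_congr rfl fun i _ => (integrable_ntr_regOp B H i _ _ _ _).2

/-- The coefficients of the identity. -/
def coeffOne (m n : ℕ) [NeZero m] : (Fin n → Fin (m ^ 2)) → ℂ := Pi.single 0 1

theorem hyb_coeffOne (hB : IsStdBasis m B) (H : Finset (Fin n)) (ω : Fin n → Fin (m ^ 2) → ℝ) :
    hyb B H (coeffOne m n) ω = 1 := by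
  rw [hyb, Finset.sum_eq_single 0]
  · rw [coeffOne, Pi.single_eq_same, one_smul, ← tens_one]
    congr 1
    funext i
    unfold regOp
    split_ifs
    · exact hB.zero_eq_one
    · simp [gcoord]
  · intro σ _ hσ
    simp [coeffOne, hσ]
  · simp

theorem regTensor_zero_zero (hB : IsStdBasis m B) (H : Finset (Fin n)) (i : Fin n)
    (j k : Fin (m ^ 2)) : regTensor B H i j k 0 0 = if j = k then 1 else 0 := by
  by_cases h : i ∈ H
  · rw [regTensor, if_pos h, traceTensor, hB.zero_eq_one, Matrix.mul_one, Matrix.mul_one,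
      hB.ntr_mul]
  · have e := integral_gcoord_mul_four 0 j k 0 0
    have e1 : ∀ x : Fin (m ^ 2) → ℝ, gcoord 0 x 0 = 1 := fun x => by simp [gcoord]
    simp only [e1, mul_one] at e
    rw [integral_gcoord_mul] at e
    rw [regTensor, if_neg h, ← e]
    split_ifs <;> simp

/-- Lower moments are read off the quartic ones by inserting the identity operator. Quantum and
Gaussian registers are both orthonormal, so the result does not depend on `H`. -/
theorem T4_coeffOne (hB : IsStdBasis m B) (H : Finset (Fin n))
    (a b : (Fin n → Fin (m ^ 2)) → ℂ) :
    T4 (regTensor B H) a b (coeffOne m n) (coeffOne m n) = ∑ σ, a σ * b σ := by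
  rw [T4]
  refine Finset.sum_congr rfl fun σ _ => ?_
  rw [Finset.sum_eq_single σ]
  · rw [Finset.sum_eq_single 0, Finset.sum_eq_single 0]
    · simp [coeffOne, regTensor_zero_zero hB]
    · intro τ _ hτ; simp [coeffOne, hτ]
    · simp
    · intro τ _ hτ; simp [coeffOne, hτ]
    · simp
  · intro τ _ hτ
    refine Finset.sum_eq_zero fun σ₃ _ => Finset.sum_eq_zero fun σ₄ _ => ?_
    by_cases h3 : σ₃ = 0
    · by_cases h4 : σ₄ = 0
      · subst h3 h4
        obtain ⟨i, hi⟩ := Function.ne_iff.1 hτ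
        rw [Finset.prod_eq_zero (Finset.mem_univ i)]
        · simp
        · simp [regTensor_zero_zero hB, Ne.symm hi]
      · simp [coeffOne, h4]
    · simp [coeffOne, h3]
  · simp

theorem integrable_ntr_hyb_mul (hB : IsStdBasis m B) (H : Finset (Fin n))
    (a b : (Fin n → Fin (m ^ 2)) → ℂ) :
    Integrable (fun ω => ntr (hyb B H a ω * hyb B H b ω)) (gaussFamily m n) := by
  simpa [hyb_coeffOne hB] using
    integrable_ntr_hyb_mul_four B H a b (coeffOne m n) (coeffOne m n)

theorem integral_ntr_hyb_mul (hB : IsStdBasis m B) (H : Finset (Fin n))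
    (a b : (Fin n → Fin (m ^ 2)) → ℂ) :
    ∫ ω, ntr (hyb B H a ω * hyb B H b ω) ∂gaussFamily m n = ∑ σ, a σ * b σ := by
  have := integral_ntr_hyb_mul_four B H a b (coeffOne m n) (coeffOne m n)
  rw [T4_coeffOne hB] at this
  simpa [hyb_coeffOne hB] using this

theorem integrable_ntr_hyb (hB : IsStdBasis m B) (H : Finset (Fin n))
    (a : (Fin n → Fin (m ^ 2)) → ℂ) :
    Integrable (fun ω => ntr (hyb B H a ω)) (gaussFamily m n) := by
  simpa [hyb_coeffOne hB] using integrable_ntr_hyb_mul hB H a (coeffOne m n)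

theorem integral_ntr_hyb (hB : IsStdBasis m B) (H : Finset (Fin n))
    (a : (Fin n → Fin (m ^ 2)) → ℂ) :
    ∫ ω, ntr (hyb B H a ω) ∂gaussFamily m n = a 0 := by
  have := integral_ntr_hyb_mul hB H a (coeffOne m n)
  simp only [hyb_coeffOne hB, Matrix.mul_one] at this
  rw [this]
  simp [coeffOne, Pi.single_apply]

theorem integrable_nsq_hyb (hB : IsStdBasis m B) (H : Finset (Fin n))
    {c : (Fin n → Fin (m ^ 2)) → ℂ} (hc : star c = c) :
    Integrable (fun ω => nsq (hyb B H c ω)) (gaussFamily m n) := by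
  have h := (integrable_ntr_hyb_mul hB H c c).re
  refine h.congr (Filter.Eventually.of_forall fun ω => ?_)
  simp only [nsq, (hyb_isHermitian hB H hc ω).eq]
  rfl

theorem integral_nsq_hyb (hB : IsStdBasis m B) (H : Finset (Fin n))
    {c : (Fin n → Fin (m ^ 2)) → ℂ} (hc : star c = c) :
    ∫ ω, nsq (hyb B H c ω) ∂gaussFamily m n = sqn c := by
  have h := integral_ntr_hyb_mul hB H c c
  have h1 : ∀ ω, ntr (hyb B H c ω * hyb B H c ω) = (nsq (hyb B H c ω) : ℂ) := fun ω => by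
    rw [← ntr_conjTranspose_mul_self, (hyb_isHermitian hB H hc ω).eq]
  simp only [h1] at h
  rw [integral_complex_ofReal] at h
  have h2 : ∑ σ, c σ * c σ = ((sqn c : ℝ) : ℂ) := by
    rw [sqn]
    push_cast
    refine Finset.sum_congr rfl fun σ _ => ?_
    rw [← Complex.conj_mul']
    congr 1
    exact (congrFun hc σ).symm
  rw [h2] at h
  exact_mod_cast h

theorem ntr_hyb_pow_four (hB : IsStdBasis m B) (H : Finset (Fin n))
    {c : (Fin n → Fin (m ^ 2)) → ℂ} (hc : star c = c) (ω : Fin n → Fin (m ^ 2) → ℝ) :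
    ntr (hyb B H c ω * hyb B H c ω * hyb B H c ω * hyb B H c ω) =
      (nsq (hyb B H c ω * hyb B H c ω) : ℂ) := by
  rw [← ntr_conjTranspose_mul_self, Matrix.conjTranspose_mul, (hyb_isHermitian hB H hc ω).eq]
  simp only [Matrix.mul_assoc]

theorem integrable_nsq_hyb_mul (hB : IsStdBasis m B) (H : Finset (Fin n))
    {c : (Fin n → Fin (m ^ 2)) → ℂ} (hc : star c = c) :
    Integrable (fun ω => nsq (hyb B H c ω * hyb B H c ω)) (gaussFamily m n) := by
  have h := (integrable_ntr_hyb_mul_four B H c c c c).re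
  refine h.congr (Filter.Eventually.of_forall fun ω => ?_)
  simp only [ntr_hyb_pow_four hB H hc]
  simp

theorem integral_nsq_hyb_mul_le (hm : 2 ≤ m) (hB : IsStdBasis m B) (H : Finset (Fin n))
    {c : (Fin n → Fin (m ^ 2)) → ℂ} (hc : star c = c) {d : ℕ} (hd : ∀ σ, c σ ≠ 0 → wtNZ σ ≤ d) :
    ∫ ω, nsq (hyb B H c ω * hyb B H c ω) ∂gaussFamily m n ≤ ((3 * √m) ^ d * sqn c) ^ 2 := by
  have h := integral_ntr_hyb_mul_four B H c c c c
  simp only [ntr_hyb_pow_four hB H hc] at h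
  rw [integral_complex_ofReal] at h
  have h1 := sqrt_N4_le hm hB n (regTensor B H) (regTensor_cases B H) d c hd
  have h2 : N4 (regTensor B H) c = ∫ ω, nsq (hyb B H c ω * hyb B H c ω) ∂gaussFamily m n := by
    rw [N4, hc, ← h, Complex.norm_real, Real.norm_of_nonneg
      (integral_nonneg fun ω => nsq_nonneg _)]
  rw [h2] at h1
  exact (Real.sqrt_le_left (mul_nonneg (by positivity) (sqn_nonneg _))).1 h1

end Hyb

/-- By Cramer's formula for the inverse. The parameter may vary with the point, so the lemma yields
measurability in ω at fixed t as well as joint measurability in (ω, t). -/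
theorem continuousOn_ntr_res {Z κ : Type} [TopologicalSpace Z] [Fintype κ] [DecidableEq κ]
    {f : Z → Matrix κ κ ℂ} {τ : Z → ℝ} (hf : Continuous f) (hτ : Continuous τ)
    (hH : ∀ z, (f z).IsHermitian) : ContinuousOn (fun z => ntr (res (f z) (τ z))) {z | 0 < τ z} := by
  have hs : Continuous fun z => shift (f z) (τ z) := by
    unfold shift
    exact hf.sub (((Complex.continuous_ofReal.comp hτ).mul continuous_const).smul continuous_const)
  have h1 : ContinuousOn (fun z => res (f z) (τ z)) {z | 0 < τ z} := by
    simp only [res, Matrix.inv_def, Ring.inverse_eq_inv']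
    refine ContinuousOn.smul (ContinuousOn.inv₀ hs.matrix_det.continuousOn fun z hz => ?_)
      hs.matrix_adjugate.continuousOn
    exact (isUnit_det_shift (hH z) hz).ne_zero
  unfold ntr
  exact continuousOn_const.mul ((continuous_id.matrix_trace).comp_continuousOn h1)

theorem nsq_submatrix {κ κ' : Type} [Fintype κ] [Fintype κ'] (e : κ' ≃ κ) (A : Matrix κ κ ℂ) :
    nsq (A.submatrix e e) = nsq A := by
  rw [nsq, nsq, Matrix.conjTranspose_submatrix, Matrix.submatrix_mul_equiv, ntr_submatrix]

/-! ### Lindeberg replacement of one register -/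

section Lindeberg

variable {m n : ℕ} [NeZero m] {B : Fin (m ^ 2) → Matrix (Fin m) (Fin m) ℂ}

/-- The coefficient of `regOp B H i (ω i) j` when the register `i` is split off. -/
def side (B : Fin (m ^ 2) → Matrix (Fin m) (Fin m) ℂ) (H : Finset (Fin n)) (i : Fin n)
    (c : (Fin n → Fin (m ^ 2)) → ℂ) (ω : Fin n → Fin (m ^ 2) → ℝ) (j : Fin (m ^ 2)) :
    Op m {k // k ≠ i} :=
  ∑ σ, (if σ i = j then c σ else 0) • tens fun k : {k // k ≠ i} => regOp B H k (ω k) (σ k)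

/-- The equivalence splitting off the register `i`. -/
abbrev splitEquiv (m : ℕ) (i : Fin n) : Fin m × ({k // k ≠ i} → Fin m) ≃ (Fin n → Fin m) :=
  (Equiv.funSplitAt i (Fin m)).symm

theorem hyb_submatrix (B : Fin (m ^ 2) → Matrix (Fin m) (Fin m) ℂ) (H : Finset (Fin n))
    (i : Fin n) (c : (Fin n → Fin (m ^ 2)) → ℂ) (ω : Fin n → Fin (m ^ 2) → ℝ) :
    (hyb B H c ω).submatrix (splitEquiv m i) (splitEquiv m i) =
      ∑ j, regOp B H i (ω i) j ⊗ₖ side B H i c ω j := by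
  have h1 : (hyb B H c ω).submatrix (splitEquiv m i) (splitEquiv m i) =
      ∑ σ, c σ • (tens fun k => regOp B H k (ω k) (σ k)).submatrix
        (splitEquiv m i) (splitEquiv m i) := by
    ext a b
    simp [hyb, Matrix.submatrix_apply, Matrix.sum_apply, Matrix.smul_apply]
  rw [h1]
  simp only [splitEquiv, tens_submatrix_funSplitAt]
  ext a b
  simp only [Matrix.sum_apply, Matrix.kroneckerMap_apply, side, Matrix.smul_apply, smul_eq_mul,
    Finset.mul_sum]
  rw [Finset.sum_comm]
  refine Finset.sum_congr rfl fun σ _ => ?_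
  rw [Finset.sum_eq_single (σ i)]
  · simp only [if_true]
    ring
  · intro j _ hj
    rw [if_neg (Ne.symm hj)]
    ring
  · simp

theorem side_update (B : Fin (m ^ 2) → Matrix (Fin m) (Fin m) ℂ) (H : Finset (Fin n))
    (i : Fin n) (c : (Fin n → Fin (m ^ 2)) → ℂ) (ω : Fin n → Fin (m ^ 2) → ℝ)
    (g : Fin (m ^ 2) → ℝ) : side B H i c (Function.update ω i g) = side B H i c ω := by
  funext j
  unfold side
  refine Finset.sum_congr rfl fun σ _ => ?_
  congr 2
  funext k
  rw [Function.update_of_ne k.2]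

/-- Together with `side_update`: the side operators see neither the Gaussian values of register `i`
nor whether `i` belongs to `H`. Two consecutive hybrids are therefore perturbations of the same
operator. -/
theorem side_insert (B : Fin (m ^ 2) → Matrix (Fin m) (Fin m) ℂ) (H : Finset (Fin n))
    (i : Fin n) (c : (Fin n → Fin (m ^ 2)) → ℂ) (ω : Fin n → Fin (m ^ 2) → ℝ) :
    side B (insert i H) i c ω = side B H i c ω := by
  funext j
  unfold side
  refine Finset.sum_congr rfl fun σ _ => ?_
  congr 2
  funext k
  simp [regOp, k.2]

theorem side_isHermitian (hB : IsStdBasis m B) (H : Finset (Fin n)) (i : Fin n)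
    {c : (Fin n → Fin (m ^ 2)) → ℂ} (hc : star c = c) (ω : Fin n → Fin (m ^ 2) → ℝ)
    (j : Fin (m ^ 2)) : (side B H i c ω j).IsHermitian := by
  rw [Matrix.IsHermitian, side, Matrix.conjTranspose_sum]
  refine Finset.sum_congr rfl fun σ _ => ?_
  rw [Matrix.conjTranspose_smul, (tens_isHermitian fun k => regOp_isHermitian hB H _ _ _).eq]
  congr 1
  split_ifs
  · exact congrFun hc σ
  · simp

/-- The part of the coefficients which depends on the register `i`. -/
def cutAt (i : Fin n) (c : (Fin n → Fin (m ^ 2)) → ℂ) (σ : Fin n → Fin (m ^ 2)) : ℂ :=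
  if σ i = 0 then 0 else c σ

theorem star_cutAt (i : Fin n) {c : (Fin n → Fin (m ^ 2)) → ℂ} (hc : star c = c) :
    star (cutAt i c) = cutAt i c := by
  funext σ
  simp only [Pi.star_apply, cutAt]
  split_ifs
  · simp
  · exact congrFun hc σ

theorem regOp_zero (hB : IsStdBasis m B) (H : Finset (Fin n)) (i : Fin n)
    (x : Fin (m ^ 2) → ℝ) : regOp B H i x 0 = 1 := by
  unfold regOp
  split_ifs
  · exact hB.zero_eq_one
  · simp [gcoord]

/-- The local operator of index 0 is the identity whether the register is quantum or Gaussian, so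
that term is the part free of register `i`. The rest, with coefficients `cutAt i c`, plays the role
of the perturbation. -/
theorem hyb_submatrix_eq_add (hB : IsStdBasis m B) (H : Finset (Fin n)) (i : Fin n)
    (c : (Fin n → Fin (m ^ 2)) → ℂ) (ω : Fin n → Fin (m ^ 2) → ℝ) :
    (hyb B H c ω).submatrix (splitEquiv m i) (splitEquiv m i) =
      (1 : Matrix (Fin m) (Fin m) ℂ) ⊗ₖ side B H i c ω 0 +
        (hyb B H (cutAt i c) ω).submatrix (splitEquiv m i) (splitEquiv m i) := by
  rw [hyb_submatrix, hyb_submatrix, ← Finset.add_sum_erase _ _ (Finset.mem_univ 0),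
    ← Finset.add_sum_erase (a := (0 : Fin (m ^ 2))) Finset.univ
      (fun j => regOp B H i (ω i) j ⊗ₖ side B H i (cutAt i c) ω j) (Finset.mem_univ 0),
    regOp_zero hB]
  have h0 : side B H i (cutAt i c) ω 0 = 0 := by
    unfold side
    refine Finset.sum_eq_zero fun σ _ => ?_
    by_cases h : σ i = 0 <;> simp [h, cutAt]
  rw [h0]
  have h2 : (1 : Matrix (Fin m) (Fin m) ℂ) ⊗ₖ (0 : Op m {k // k ≠ i}) = 0 := by
    ext a b
    simp
  rw [h2, zero_add]
  congr 1
  refine Finset.sum_congr rfl fun j hj => ?_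
  congr 1
  unfold side
  refine Finset.sum_congr rfl fun σ _ => ?_
  congr 1
  split_ifs with h
  · rw [cutAt, if_neg (h ▸ Finset.ne_of_mem_erase hj)]
  · rfl

/-- The value of the second-order expansion of the resolvent in expectation. -/
def taylorValue {κ : Type} [Fintype κ] (R : Matrix κ κ ℂ) (Y : Fin (m ^ 2) → Matrix κ κ ℂ) : ℂ :=
  ntr R - ntr (R * Y 0 * R) + ∑ j, ntr (R * Y j * R * Y j * R)

/-- Since the unperturbed resolvent is 1 ⊗ R, the trace factorizes and the first-order term sees the
local operators only through their traces. Likewise `ntr_second_order` sees only traces of products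
of two of them. -/
theorem ntr_first_order {i : Fin n} (R : Op m {k : Fin n // k ≠ i})
    (A : Fin (m ^ 2) → Matrix (Fin m) (Fin m) ℂ) (Y : Fin (m ^ 2) → Op m {k : Fin n // k ≠ i}) :
    ntr ((1 : Matrix (Fin m) (Fin m) ℂ) ⊗ₖ R * (∑ j, A j ⊗ₖ Y j) *
      (1 : Matrix (Fin m) (Fin m) ℂ) ⊗ₖ R) = ∑ j, ntr (A j) * ntr (R * Y j * R) := by
  simp only [Finset.mul_sum, Finset.sum_mul, ntr_sum, ← Matrix.mul_kronecker_mul, ntr_kronecker,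
    Matrix.one_mul, Matrix.mul_one]

theorem ntr_second_order {i : Fin n} (R : Op m {k : Fin n // k ≠ i})
    (A : Fin (m ^ 2) → Matrix (Fin m) (Fin m) ℂ) (Y : Fin (m ^ 2) → Op m {k : Fin n // k ≠ i}) :
    ntr ((1 : Matrix (Fin m) (Fin m) ℂ) ⊗ₖ R * (∑ j, A j ⊗ₖ Y j) *
      (1 : Matrix (Fin m) (Fin m) ℂ) ⊗ₖ R * (∑ j, A j ⊗ₖ Y j) *
      (1 : Matrix (Fin m) (Fin m) ℂ) ⊗ₖ R) =
      ∑ k, ∑ j, ntr (A j * A k) * ntr (R * Y j * R * Y k * R) := by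
  simp only [Finset.mul_sum, Finset.sum_mul, ntr_sum, ← Matrix.mul_kronecker_mul, ntr_kronecker,
    Matrix.one_mul, Matrix.mul_one]

theorem norm_ntr_res_hyb_taylor_le (hB : IsStdBasis m B) (H : Finset (Fin n)) (i : Fin n)
    {c : (Fin n → Fin (m ^ 2)) → ℂ} (hc : star c = c) (ω : Fin n → Fin (m ^ 2) → ℝ)
    {t ε : ℝ} (ht : 0 < t) (hε : 0 < ε) :
    ‖ntr (res (hyb B H c ω) t) - (ntr (res (side B H i c ω 0) t) -
      ∑ j, ntr (regOp B H i (ω i) j) *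
        ntr (res (side B H i c ω 0) t * side B H i (cutAt i c) ω j * res (side B H i c ω 0) t) +
      ∑ k, ∑ j, ntr (regOp B H i (ω i) j * regOp B H i (ω i) k) *
        ntr (res (side B H i c ω 0) t * side B H i (cutAt i c) ω j * res (side B H i c ω 0) t *
          side B H i (cutAt i c) ω k * res (side B H i c ω 0) t))‖ ≤
      (t ^ 4)⁻¹ * ((ε * nsq (hyb B H (cutAt i c) ω) +
        ε⁻¹ * nsq (hyb B H (cutAt i c) ω * hyb B H (cutAt i c) ω)) / 2) := by
  have hY := (hyb_isHermitian hB H (star_cutAt i hc) ω).submatrix (splitEquiv m i)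
  have hX : ((1 : Matrix (Fin m) (Fin m) ℂ) ⊗ₖ side B H i c ω 0).IsHermitian := by
    rw [Matrix.IsHermitian, Matrix.conjTranspose_kronecker, Matrix.conjTranspose_one,
      (side_isHermitian hB H i hc ω 0).eq]
  have h := norm_ntr_res_taylor_le hX hY ht hε
  rw [← hyb_submatrix_eq_add hB, res_submatrix, ntr_submatrix, res_one_kronecker] at h
  rw [Matrix.submatrix_mul_equiv, nsq_submatrix, nsq_submatrix, hyb_submatrix, ntr_kronecker,
    ntr_one, one_mul, ntr_first_order, ntr_second_order] at h
  exact h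

/-- The integrand of the bound for one replacement. -/
def stepBound (B : Fin (m ^ 2) → Matrix (Fin m) (Fin m) ℂ) (H : Finset (Fin n)) (i : Fin n)
    (c : (Fin n → Fin (m ^ 2)) → ℂ) (t ε : ℝ) (ω : Fin n → Fin (m ^ 2) → ℝ) : ℝ :=
  (t ^ 4)⁻¹ * ((ε * nsq (hyb B H (cutAt i c) ω) +
    ε⁻¹ * nsq (hyb B H (cutAt i c) ω * hyb B H (cutAt i c) ω)) / 2)

theorem integrable_stepBound (hB : IsStdBasis m B) (H : Finset (Fin n)) (i : Fin n)
    {c : (Fin n → Fin (m ^ 2)) → ℂ} (hc : star c = c) (t ε : ℝ) :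
    Integrable (stepBound B H i c t ε) (gaussFamily m n) :=
  ((((integrable_nsq_hyb hB H (star_cutAt i hc)).const_mul ε).add
    ((integrable_nsq_hyb_mul hB H (star_cutAt i hc)).const_mul ε⁻¹)).div_const 2).const_mul _

theorem integral_stepBound_le (hm : 2 ≤ m) (hB : IsStdBasis m B) (H : Finset (Fin n)) (i : Fin n)
    {c : (Fin n → Fin (m ^ 2)) → ℂ} (hc : star c = c) {d : ℕ} (hd : ∀ σ, c σ ≠ 0 → wtNZ σ ≤ d)
    (t : ℝ) {ε : ℝ} (hε : 0 < ε) :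
    ∫ ω, stepBound B H i c t ε ω ∂gaussFamily m n ≤
      (t ^ 4)⁻¹ * ((ε * sqn (cutAt i c) + ε⁻¹ * ((3 * √m) ^ d * sqn (cutAt i c)) ^ 2) / 2) := by
  simp only [stepBound]
  rw [integral_const_mul, integral_div, integral_add
    ((integrable_nsq_hyb hB H (star_cutAt i hc)).const_mul ε)
    ((integrable_nsq_hyb_mul hB H (star_cutAt i hc)).const_mul ε⁻¹), integral_const_mul,
    integral_const_mul, integral_nsq_hyb hB H (star_cutAt i hc)]
  have := integral_nsq_hyb_mul_le hm hB H (star_cutAt i hc) (d := d) fun σ hσ => hd σ fun h => by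
    simp [cutAt, h] at hσ
  gcongr

theorem integrable_ntr_res_hyb (hB : IsStdBasis m B) (H : Finset (Fin n))
    {c : (Fin n → Fin (m ^ 2)) → ℂ} (hc : star c = c) {t : ℝ} (ht : 0 < t) :
    Integrable (fun ω => ntr (res (hyb B H c ω) t)) (gaussFamily m n) := by
  have h := continuousOn_ntr_res (continuous_hyb B H c) (τ := fun _ => t) continuous_const
    (hyb_isHermitian hB H hc)
  rw [show {ω : Fin n → Fin (m ^ 2) → ℝ | 0 < t} = Set.univ by simp [ht],
    continuousOn_univ] at h
  refine (integrable_const (t⁻¹)).mono' h.aestronglyMeasurable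
    (Filter.Eventually.of_forall fun ω => norm_ntr_res_le (hyb_isHermitian hB H hc ω) ht)

/-- With register `i` quantum, the traces of one and two basis elements are Kronecker symbols, so
the expansion equals `taylorValue` pointwise, without any averaging. -/
theorem norm_ntr_res_hyb_sub_taylorValue_le (hB : IsStdBasis m B) (H : Finset (Fin n)) (i : Fin n)
    {c : (Fin n → Fin (m ^ 2)) → ℂ} (hc : star c = c) (ω : Fin n → Fin (m ^ 2) → ℝ)
    {t ε : ℝ} (ht : 0 < t) (hε : 0 < ε) :
    ‖ntr (res (hyb B (insert i H) c ω) t) -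
      taylorValue (res (side B H i c ω 0) t) (side B H i (cutAt i c) ω)‖ ≤
      stepBound B (insert i H) i c t ε ω := by
  have h := norm_ntr_res_hyb_taylor_le hB (insert i H) i hc ω ht hε
  rw [side_insert, side_insert] at h
  simpa [regOp, hB.ntr_eq, hB.ntr_mul, taylorValue, stepBound] using h

/-- With register `i` Gaussian, averaging over that register alone turns the expansion into the same
`taylorValue`, because the first two moments of the Gaussians match the traces of the basis. The
integrability hypotheses are supplied later by Fubini for almost every ω. -/
theorem norm_integral_ntr_res_hyb_sub_taylorValue_le (hB : IsStdBasis m B) {H : Finset (Fin n)}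
    {i : Fin n} (hi : i ∉ H)
    {c : (Fin n → Fin (m ^ 2)) → ℂ} (hc : star c = c) (ω : Fin n → Fin (m ^ 2) → ℝ)
    {t ε : ℝ} (ht : 0 < t) (hε : 0 < ε)
    (hint : Integrable (fun g => ntr (res (hyb B H c (Function.update ω i g)) t))
      (Measure.pi fun _ => gaussianReal 0 1))
    (hint' : Integrable (fun g => stepBound B H i c t ε (Function.update ω i g))
      (Measure.pi fun _ => gaussianReal 0 1)) :
    ‖(∫ g, ntr (res (hyb B H c (Function.update ω i g)) t)
        ∂(Measure.pi fun _ => gaussianReal 0 1)) -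
      taylorValue (res (side B H i c ω 0) t) (side B H i (cutAt i c) ω)‖ ≤
      ∫ g, stepBound B H i c t ε (Function.update ω i g)
        ∂(Measure.pi fun _ => gaussianReal 0 1) := by
  set R := res (side B H i c ω 0) t with hR
  set Y := side B H i (cutAt i c) ω with hY
  set ν : Measure (Fin (m ^ 2) → ℝ) := Measure.pi fun _ => gaussianReal 0 1 with hν
  have h1 : ∀ j, Integrable (fun g : Fin (m ^ 2) → ℝ => (gcoord 0 g j : ℂ) * ntr (R * Y j * R))
      ν := fun j => (integrable_gcoord 0 j).ofReal.mul_const _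
  have h2 : ∀ k j, Integrable (fun g : Fin (m ^ 2) → ℝ =>
      ((gcoord 0 g j * gcoord 0 g k : ℝ) : ℂ) * ntr (R * Y j * R * Y k * R)) ν := fun k j =>
    (integrable_gcoord_mul 0 j k).ofReal.mul_const _
  have hS1 : Integrable (fun g : Fin (m ^ 2) → ℝ => ∑ j, (gcoord 0 g j : ℂ) * ntr (R * Y j * R)) ν :=
    integrable_finsetSum _ fun j _ => h1 j
  have hA : Integrable (fun g : Fin (m ^ 2) → ℝ => ntr R -
      ∑ j, (gcoord 0 g j : ℂ) * ntr (R * Y j * R)) ν := (integrable_const _).sub hS1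
  have hC : Integrable (fun g : Fin (m ^ 2) → ℝ =>
      ∑ k, ∑ j, ((gcoord 0 g j * gcoord 0 g k : ℝ) : ℂ) * ntr (R * Y j * R * Y k * R)) ν :=
    integrable_finsetSum _ fun k _ => integrable_finsetSum _ fun j _ => h2 k j
  have hT : Integrable (fun g : Fin (m ^ 2) → ℝ => ntr R -
      ∑ j, (gcoord 0 g j : ℂ) * ntr (R * Y j * R) +
      ∑ k, ∑ j, ((gcoord 0 g j * gcoord 0 g k : ℝ) : ℂ) * ntr (R * Y j * R * Y k * R)) ν :=
    hA.add hC
  have hTv : ∫ g : Fin (m ^ 2) → ℝ, (ntr R -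
      ∑ j, (gcoord 0 g j : ℂ) * ntr (R * Y j * R) +
      ∑ k, ∑ j, ((gcoord 0 g j * gcoord 0 g k : ℝ) : ℂ) * ntr (R * Y j * R * Y k * R)) ∂ν =
      taylorValue R Y := by
    rw [integral_add hA hC, integral_sub (integrable_const _) hS1,
      integral_finsetSum _ fun j _ => h1 j,
      integral_finsetSum _ fun k _ => integrable_finsetSum _ fun j _ => h2 k j, taylorValue]
    congr 1
    · congr 1
      · simp
      · rw [Finset.sum_eq_single 0]
        · rw [integral_mul_const, integral_complex_ofReal, integral_gcoord]
          simp
        · intro j _ hj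
          rw [integral_mul_const, integral_complex_ofReal, integral_gcoord, if_neg hj]
          simp
        · simp
    · refine Finset.sum_congr rfl fun k _ => ?_
      rw [integral_finsetSum _ fun j _ => h2 k j, Finset.sum_eq_single k]
      · rw [integral_mul_const, integral_complex_ofReal, integral_gcoord_mul]
        simp
      · intro j _ hj
        rw [integral_mul_const, integral_complex_ofReal, integral_gcoord_mul, if_neg hj]
        simp
      · simp
  rw [← hTv, ← integral_sub hint hT]
  refine norm_integral_le_of_norm_le hint' (Filter.Eventually.of_forall fun g => ?_)
  have h := norm_ntr_res_hyb_taylor_le hB H i hc (Function.update ω i g) ht hε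
  rw [side_update, side_update, ← hR, ← hY] at h
  have e1 : ∀ j, ntr (regOp B H i g j) = (gcoord 0 g j : ℂ) := fun j => by
    rw [regOp, if_neg hi, ntr_smul, ntr_one, mul_one]
  have e2 : ∀ j k, ntr (regOp B H i g j * regOp B H i g k) =
      ((gcoord 0 g j * gcoord 0 g k : ℝ) : ℂ) := fun j k => by
    rw [regOp, if_neg hi, regOp, if_neg hi, Matrix.smul_mul, Matrix.mul_smul, ntr_smul, ntr_smul,
      Matrix.one_mul, ntr_one, mul_one, Complex.ofReal_mul]
  simp only [Function.update_self, e1, e2] at h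
  exact h

/-- Replacing the register `i` by Gaussian variables changes the expected trace of the resolvent
only a little. -/
theorem norm_integral_ntr_res_step_le (hm : 2 ≤ m) (hB : IsStdBasis m B) {H : Finset (Fin n)}
    {i : Fin n} (hi : i ∉ H) {c : (Fin n → Fin (m ^ 2)) → ℂ} (hc : star c = c) {d : ℕ}
    (hd : ∀ σ, c σ ≠ 0 → wtNZ σ ≤ d) {t ε : ℝ} (ht : 0 < t) (hε : 0 < ε) :
    ‖(∫ ω, ntr (res (hyb B H c ω) t) ∂gaussFamily m n) -
      ∫ ω, ntr (res (hyb B (insert i H) c ω) t) ∂gaussFamily m n‖ ≤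
      (t ^ 4)⁻¹ * (ε * sqn (cutAt i c) + ε⁻¹ * ((3 * √m) ^ d * sqn (cutAt i c)) ^ 2) := by
  set ν : Measure (Fin (m ^ 2) → ℝ) := Measure.pi fun _ => gaussianReal 0 1 with hν
  have hmp := measurePreserving_update (fun _ : Fin n => ν) i
  change MeasurePreserving _ ((gaussFamily m n).prod ν) (gaussFamily m n) at hmp
  have hF := integrable_ntr_res_hyb hB H hc ht
  have hF' := integrable_ntr_res_hyb hB (insert i H) hc ht
  have hS := integrable_stepBound hB H i hc t ε
  have hS' := integrable_stepBound hB (insert i H) i hc t ε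
  have hFp := hmp.integrable_comp_of_integrable hF
  have hSp := hmp.integrable_comp_of_integrable hS
  have eF : ∫ ω, ntr (res (hyb B H c ω) t) ∂gaussFamily m n =
      ∫ ω, ∫ g, ntr (res (hyb B H c (Function.update ω i g)) t) ∂ν ∂gaussFamily m n := by
    have h := integral_map hmp.measurable.aemeasurable
      (hmp.map_eq.symm ▸ hF.aestronglyMeasurable)
    rw [hmp.map_eq] at h
    exact h.trans (integral_prod _ hFp)
  have eS : ∫ ω, stepBound B H i c t ε ω ∂gaussFamily m n =
      ∫ ω, ∫ g, stepBound B H i c t ε (Function.update ω i g) ∂ν ∂gaussFamily m n := by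
    have h := integral_map hmp.measurable.aemeasurable
      (hmp.map_eq.symm ▸ hS.aestronglyMeasurable)
    rw [hmp.map_eq] at h
    exact h.trans (integral_prod _ hSp)
  have hSi : Integrable (fun ω => ∫ g, stepBound B H i c t ε (Function.update ω i g) ∂ν)
      (gaussFamily m n) := hSp.integral_prod_left
  have hFi : Integrable (fun ω => ∫ g, ntr (res (hyb B H c (Function.update ω i g)) t) ∂ν)
      (gaussFamily m n) := hFp.integral_prod_left
  rw [eF, ← integral_sub hFi hF']
  -- Triangle inequality through `taylorValue`, for almost every ω: the Gaussian hybrid is close to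
  -- it after averaging over the fresh coordinate, the quantum one already at ω.
  have hb := norm_integral_le_of_norm_le (hSi.add hS') (f := fun ω =>
    (∫ g, ntr (res (hyb B H c (Function.update ω i g)) t) ∂ν) -
      ntr (res (hyb B (insert i H) c ω) t)) (by
    filter_upwards [hFp.prod_right_ae, hSp.prod_right_ae] with ω h1 h2
    have b1 := norm_integral_ntr_res_hyb_sub_taylorValue_le hB hi hc ω ht hε h1 h2
    have b2 := norm_ntr_res_hyb_sub_taylorValue_le hB H i hc ω ht hε
    have := norm_sub_le_norm_sub_add_norm_sub
      (∫ g, ntr (res (hyb B H c (Function.update ω i g)) t) ∂ν)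
      (taylorValue (res (side B H i c ω 0) t) (side B H i (cutAt i c) ω))
      (ntr (res (hyb B (insert i H) c ω) t))
    rw [norm_sub_rev (taylorValue _ _)] at this
    exact this.trans (add_le_add b1 b2))
  refine hb.trans ?_
  have e : ∫ ω, ((fun ω => ∫ g, stepBound B H i c t ε (Function.update ω i g) ∂ν) +
      stepBound B (insert i H) i c t ε) ω ∂gaussFamily m n =
      (∫ ω, stepBound B H i c t ε ω ∂gaussFamily m n) +
        ∫ ω, stepBound B (insert i H) i c t ε ω ∂gaussFamily m n := by
    rw [eS]
    exact integral_add hSi hS'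
  rw [e]
  refine (add_le_add (integral_stepBound_le hm hB H i hc hd t hε)
    (integral_stepBound_le hm hB (insert i H) i hc hd t hε)).trans (le_of_eq ?_)
  ring

end Lindeberg

/-! ### Optimizing one replacement and iterating over the registers -/

section Iterate

variable {m n : ℕ} [NeZero m] {B : Fin (m ^ 2) → Matrix (Fin m) (Fin m) ℂ}

theorem norm_integral_ntr_res_step_le_mul_sqrt (hm : 2 ≤ m) (hB : IsStdBasis m B)
    {H : Finset (Fin n)} {i : Fin n} (hi : i ∉ H) {c : (Fin n → Fin (m ^ 2)) → ℂ}
    (hc : star c = c) {d : ℕ} (hd : ∀ σ, c σ ≠ 0 → wtNZ σ ≤ d) {t : ℝ} (ht : 0 < t) :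
    ‖(∫ ω, ntr (res (hyb B H c ω) t) ∂gaussFamily m n) -
      ∫ ω, ntr (res (hyb B (insert i H) c ω) t) ∂gaussFamily m n‖ ≤
      (t ^ 4)⁻¹ * (2 * (3 * √m) ^ d * (sqn (cutAt i c) * √(sqn (cutAt i c)))) := by
  have hI := sqn_nonneg (cutAt i c)
  have hK : 0 < (3 * √(m : ℝ)) ^ d := by
    have : 0 < m := by omega
    positivity
  have hstep := fun ε (hε : 0 < ε) => norm_integral_ntr_res_step_le hm hB hi hc hd ht hε
  generalize sqn (cutAt i c) = I at hI hstep ⊢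
  generalize (3 * √(m : ℝ)) ^ d = K at hK hstep ⊢
  rcases hI.eq_or_lt with h0 | h0
  · subst h0
    simpa using hstep 1 one_pos
  -- This weight makes `ε * I` and `ε⁻¹ * (K * I) ^ 2` equal, each being K I^{3/2}. The case I = 0
  -- is treated apart because this weight would vanish.
  · refine (hstep (K * √I) (by positivity)).trans (le_of_eq ?_)
    have h2 : √I * √I = I := Real.mul_self_sqrt hI
    congr 1
    have h3 : (K * √I)⁻¹ * (K * I) ^ 2 = K * (I * √I) := by
      have : 0 < √I := Real.sqrt_pos.2 h0
      field_simp
      nlinarith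
    rw [h3]
    ring

/-- Replacing the registers in `s` by Gaussian variables. -/
theorem norm_integral_ntr_res_sub_le (hm : 2 ≤ m) (hB : IsStdBasis m B)
    {c : (Fin n → Fin (m ^ 2)) → ℂ} (hc : star c = c) {d : ℕ} (hd : ∀ σ, c σ ≠ 0 → wtNZ σ ≤ d)
    {t : ℝ} (ht : 0 < t) (s : Finset (Fin n)) :
    ‖(∫ ω, ntr (res (hyb B sᶜ c ω) t) ∂gaussFamily m n) -
      ∫ ω, ntr (res (hyb B Finset.univ c ω) t) ∂gaussFamily m n‖ ≤
      (t ^ 4)⁻¹ * (2 * (3 * √m) ^ d * ∑ i ∈ s, sqn (cutAt i c) * √(sqn (cutAt i c))) := by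
  induction s using Finset.induction_on with
  | empty => simp
  | insert i s his ih =>
    have hi : i ∉ (insert i s)ᶜ := by simp
    have h := norm_integral_ntr_res_step_le_mul_sqrt hm hB hi hc hd ht
    have e : insert i (insert i s)ᶜ = sᶜ := by
      ext j
      by_cases hj : j = i
      · subst hj; simp [his]
      · simp [hj]
    rw [e] at h
    rw [Finset.sum_insert his, mul_add, mul_add]
    exact (norm_sub_le_norm_sub_add_norm_sub _ _ _).trans (add_le_add h ih)

theorem hyb_univ (B : Fin (m ^ 2) → Matrix (Fin m) (Fin m) ℂ) (c : (Fin n → Fin (m ^ 2)) → ℂ)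
    (ω : Fin n → Fin (m ^ 2) → ℝ) :
    hyb B Finset.univ c ω = ∑ σ, c σ • tensorBasis B σ := by
  simp only [hyb, regOp, Finset.mem_univ, if_true]
  rfl

end Iterate

/-! ### Spectral formulas -/

section Spectral

variable {κ : Type} [Fintype κ] [DecidableEq κ]

/-- The average of `f` over the spectrum of `X`. -/
def specAvg {X : Matrix κ κ ℂ} (hX : X.IsHermitian) (f : ℝ → ℝ) : ℝ :=
  (Fintype.card κ : ℝ)⁻¹ * ∑ k, f (hX.eigenvalues k)

theorem ntr_conjStarAlgAut_diagonal (U : Matrix.unitaryGroup κ ℂ) (v : κ → ℂ) :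
    ntr (Unitary.conjStarAlgAut ℂ _ U (Matrix.diagonal v)) =
      (Fintype.card κ : ℂ)⁻¹ * ∑ k, v k := by
  rw [Unitary.conjStarAlgAut_apply, ntr_mul_comm, ← Matrix.mul_assoc,
    Unitary.coe_star_mul_self, Matrix.one_mul, ntr, Matrix.trace_diagonal]

theorem trZeta_eq {X : Matrix κ κ ℂ} (hX : X.IsHermitian) :
    (Fintype.card κ : ℝ)⁻¹ * trZeta X = specAvg hX zeta := by
  have h := ntr_conjStarAlgAut_diagonal hX.eigenvectorUnitary
    (RCLike.ofReal ∘ zeta ∘ hX.eigenvalues)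
  have h2 : (ntr (cfc zeta X)) = (specAvg hX zeta : ℂ) := by
    rw [hX.cfc_eq, Matrix.IsHermitian.cfc, h, specAvg]
    push_cast
    rfl
  rw [trZeta, ← Complex.re_ofReal_mul, ← Complex.ofReal_re (specAvg hX zeta), ← h2, ntr]
  push_cast
  rfl

theorem specAvg_ntr {X : Matrix κ κ ℂ} (hX : X.IsHermitian) :
    (ntr X).re = specAvg hX fun x => x := by
  have h := ntr_conjStarAlgAut_diagonal hX.eigenvectorUnitary
    (RCLike.ofReal ∘ hX.eigenvalues)
  rw [← hX.spectral_theorem] at h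
  rw [h, ← Complex.ofReal_re (specAvg _ _), specAvg]
  push_cast
  rfl

theorem specAvg_sq {X : Matrix κ κ ℂ} (hX : X.IsHermitian) :
    nsq X = specAvg hX fun x => x ^ 2 := by
  have h := ntr_conjStarAlgAut_diagonal hX.eigenvectorUnitary
    (fun k => (RCLike.ofReal ∘ hX.eigenvalues) k * (RCLike.ofReal ∘ hX.eigenvalues) k)
  rw [← Matrix.diagonal_mul_diagonal, map_mul, ← hX.spectral_theorem] at h
  rw [nsq, hX.eq, h, ← Complex.ofReal_re (specAvg _ _), specAvg]
  push_cast
  congr 2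
  exact Finset.sum_congr rfl fun k _ => (sq _).symm

theorem specAvg_pow_four {X : Matrix κ κ ℂ} (hX : X.IsHermitian) :
    nsq (X * X) = specAvg hX fun x => x ^ 4 := by
  have h := ntr_conjStarAlgAut_diagonal hX.eigenvectorUnitary
    (fun k => (RCLike.ofReal ∘ hX.eigenvalues) k * (RCLike.ofReal ∘ hX.eigenvalues) k *
      ((RCLike.ofReal ∘ hX.eigenvalues) k * (RCLike.ofReal ∘ hX.eigenvalues) k))
  rw [← Matrix.diagonal_mul_diagonal, ← Matrix.diagonal_mul_diagonal, map_mul, map_mul,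
    ← hX.spectral_theorem] at h
  rw [nsq, Matrix.conjTranspose_mul, hX.eq, h, ← Complex.ofReal_re (specAvg _ _), specAvg]
  push_cast
  congr 2
  refine Finset.sum_congr rfl fun k _ => ?_
  simp only [Function.comp_apply, Complex.coe_algebraMap]
  ring

theorem res_eq {X : Matrix κ κ ℂ} (hX : X.IsHermitian) {t : ℝ} (ht : 0 < t) :
    res X t = Unitary.conjStarAlgAut ℂ _ hX.eigenvectorUnitary
      (Matrix.diagonal fun k => ((hX.eigenvalues k : ℂ) - t * Complex.I)⁻¹) := by
  refine Matrix.inv_eq_right_inv ?_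
  have h1 : shift X t = Unitary.conjStarAlgAut ℂ _ hX.eigenvectorUnitary
      (Matrix.diagonal fun k => (hX.eigenvalues k : ℂ) - t * Complex.I) := by
    have h2 : (Matrix.diagonal fun k => (hX.eigenvalues k : ℂ) - t * Complex.I) =
        Matrix.diagonal (RCLike.ofReal ∘ hX.eigenvalues) -
          ((t : ℂ) * Complex.I) • (1 : Matrix κ κ ℂ) := by
      ext j k
      by_cases hjk : j = k <;> simp [hjk]
    rw [h2, map_sub, map_smul, map_one, ← hX.spectral_theorem, shift]
  rw [h1, ← map_mul, Matrix.diagonal_mul_diagonal]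
  have : (Matrix.diagonal fun k => ((hX.eigenvalues k : ℂ) - t * Complex.I) *
      ((hX.eigenvalues k : ℂ) - t * Complex.I)⁻¹) = (1 : Matrix κ κ ℂ) := by
    rw [← Matrix.diagonal_one]
    congr 1
    funext k
    refine mul_inv_cancel₀ fun h => ?_
    have := congrArg Complex.im h
    simp at this
    exact ht.ne' this
  rw [this, map_one]

theorem specAvg_res {X : Matrix κ κ ℂ} (hX : X.IsHermitian) {t : ℝ} (ht : 0 < t) :
    (ntr (res X t)).re = specAvg hX fun x => x / (x ^ 2 + t ^ 2) := by
  have h := ntr_conjStarAlgAut_diagonal hX.eigenvectorUnitary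
    (fun k => ((hX.eigenvalues k : ℂ) - t * Complex.I)⁻¹)
  rw [← res_eq hX ht] at h
  have e : (Fintype.card κ : ℂ)⁻¹ = (((Fintype.card κ : ℝ)⁻¹ : ℝ) : ℂ) := by push_cast; rfl
  rw [h, e, Complex.re_ofReal_mul, Complex.re_sum, specAvg]
  congr 1
  refine Finset.sum_congr rfl fun k _ => ?_
  simp [Complex.inv_re, Complex.normSq_apply, sq]

/-- The integrand in the formula for `ζ`. -/
def resPart (X : Matrix κ κ ℂ) (t : ℝ) : ℝ := (ntr X).re - t ^ 2 * (ntr (res X t)).re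

theorem resPart_eq {X : Matrix κ κ ℂ} (hX : X.IsHermitian) {t : ℝ} (ht : 0 < t) :
    resPart X t = specAvg hX fun x => x ^ 3 / (x ^ 2 + t ^ 2) := by
  rw [resPart, specAvg_ntr hX, specAvg_res hX ht]
  simp only [specAvg]
  rw [mul_left_comm, ← mul_sub, Finset.mul_sum, ← Finset.sum_sub_distrib]
  congr 1
  refine Finset.sum_congr rfl fun k _ => ?_
  have : (hX.eigenvalues k) ^ 2 + t ^ 2 ≠ 0 := by positivity
  field_simp
  ring

/-- A crude majorant, integrable in t and involving only even moments up to the fourth in x. It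
serves to justify Fubini and plays no role in the final rate. -/
theorem abs_cube_div_le (x t : ℝ) (ht : 0 < t) :
    |x ^ 3 / (x ^ 2 + t ^ 2)| ≤ (1 + 2 * x ^ 2 + x ^ 4) * (1 + t ^ 2)⁻¹ := by
  rw [abs_div, abs_pow, abs_of_pos (by positivity : 0 < x ^ 2 + t ^ 2), ← div_eq_mul_inv,
    div_le_div_iff₀ (by positivity) (by positivity), ← sq_abs x, ← Even.pow_abs (by decide) (n := 4)]
  have h : 0 ≤ |x| := abs_nonneg x
  generalize |x| = y at h
  have h1 : y ^ 3 ≤ (1 + 2 * y ^ 2 + y ^ 4) * y ^ 2 := by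
    nlinarith [mul_nonneg (sq_nonneg y) (sq_nonneg (y - 1)), sq_nonneg (y ^ 2), sq_nonneg (y^3)]
  have h2 : y ^ 3 ≤ 1 + 2 * y ^ 2 + y ^ 4 := by
    nlinarith [mul_nonneg (sq_nonneg y) (sq_nonneg (y - 1))]
  nlinarith [mul_le_mul_of_nonneg_right h2 (sq_nonneg t)]

theorem abs_resPart_le [Nonempty κ] {X : Matrix κ κ ℂ} (hX : X.IsHermitian) {t : ℝ} (ht : 0 < t) :
    |resPart X t| ≤ (1 + 2 * nsq X + nsq (X * X)) * (1 + t ^ 2)⁻¹ := by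
  rw [resPart_eq hX ht, specAvg_sq hX, specAvg_pow_four hX]
  have e : (1 + 2 * specAvg hX (fun x => x ^ 2) + specAvg hX fun x => x ^ 4) * (1 + t ^ 2)⁻¹ =
      specAvg hX fun x => (1 + 2 * x ^ 2 + x ^ 4) * (1 + t ^ 2)⁻¹ := by
    simp only [specAvg]
    rw [← Finset.sum_mul, Finset.sum_add_distrib, Finset.sum_add_distrib, ← Finset.mul_sum]
    have : (Fintype.card κ : ℝ) ≠ 0 := by simp
    simp only [Finset.sum_const, Finset.card_univ, nsmul_eq_mul, mul_one]
    field_simp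
  rw [e, specAvg, specAvg, abs_mul, abs_of_nonneg (by positivity)]
  gcongr
  exact (Finset.abs_sum_le_sum_abs _ _).trans
    (Finset.sum_le_sum fun k _ => abs_cube_div_le _ _ ht)

theorem integrableOn_cube_div (x : ℝ) :
    IntegrableOn (fun t : ℝ => x ^ 3 / (x ^ 2 + t ^ 2)) (Set.Ioi 0) := by
  have h : Integrable (fun t : ℝ => (1 + 2 * x ^ 2 + x ^ 4) * (1 + t ^ 2)⁻¹)
      (volume.restrict (Set.Ioi 0)) := (integrable_inv_one_add_sq.const_mul _).restrict
  refine h.mono' (Measurable.aestronglyMeasurable (by fun_prop)) ?_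
  exact (ae_restrict_iff' measurableSet_Ioi).2
    (Filter.Eventually.of_forall fun t ht => abs_cube_div_le x t ht)

theorem integral_cube_div (x : ℝ) :
    ∫ t in Set.Ioi (0 : ℝ), x ^ 3 / (x ^ 2 + t ^ 2) = Real.pi / 2 * (x * |x|) := by
  rcases eq_or_ne x 0 with rfl | hx
  · simp
  have hx' : 0 < |x| := abs_pos.2 hx
  have h := integral_comp_mul_left_Ioi (fun u : ℝ => x * (1 + u ^ 2)⁻¹) 0 (inv_pos.2 hx')
  -- In the variable u = t/|x| the integrand is x/(1+u²); the change of variables contributes the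
  -- factor |x|, hence x|x|.
  have e : ∀ t : ℝ, x ^ 3 / (x ^ 2 + t ^ 2) = x * (1 + (|x|⁻¹ * t) ^ 2)⁻¹ := fun t => by
    rw [mul_pow, inv_pow, sq_abs]
    have : x ^ 2 + t ^ 2 ≠ 0 := by positivity
    field_simp
  simp only [e]
  rw [h, mul_zero, integral_const_mul, integral_Ioi_inv_one_add_sq, Real.arctan_zero, inv_inv,
    smul_eq_mul]
  ring

/-- ζ(x) = (x² − x|x|)/2, and the sign-sensitive term x|x| is the one represented by the integral.
-/
theorem zeta_eq (x : ℝ) :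
    zeta x = x ^ 2 / 2 - Real.pi⁻¹ * ∫ t in Set.Ioi (0 : ℝ), x ^ 3 / (x ^ 2 + t ^ 2) := by
  rw [integral_cube_div, zeta]
  have := Real.pi_ne_zero
  field_simp
  split_ifs with h
  · rw [abs_of_nonpos h]; ring
  · rw [abs_of_pos (not_le.1 h)]; ring

theorem specAvg_zeta {X : Matrix κ κ ℂ} (hX : X.IsHermitian) :
    (Fintype.card κ : ℝ)⁻¹ * trZeta X =
      nsq X / 2 - Real.pi⁻¹ * ∫ t in Set.Ioi (0 : ℝ), resPart X t := by
  have h1 : ∫ t in Set.Ioi (0 : ℝ), resPart X t =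
      specAvg hX fun x => ∫ t in Set.Ioi (0 : ℝ), x ^ 3 / (x ^ 2 + t ^ 2) := by
    rw [setIntegral_congr_fun measurableSet_Ioi fun t ht => resPart_eq hX ht]
    simp only [specAvg]
    rw [integral_const_mul, integral_finsetSum _ fun k _ => integrableOn_cube_div _]
  rw [trZeta_eq hX, h1, specAvg_sq hX]
  simp only [specAvg, zeta_eq, Finset.sum_sub_distrib, ← Finset.mul_sum, ← Finset.sum_div]
  ring

end Spectral

/-! ### The invariance principle for `ζ` -/

/-- Cut at `lam`: the linear bound integrates to `lam ^ 2` below it, the quadratic decay to `S /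
lam` above it. The free parameter of the invariance principle is this cut. -/
theorem integral_le_of_le_two_mul_of_le_div {f : ℝ → ℝ} {S lam : ℝ} (hlam : 0 < lam)
    (hf : IntegrableOn f (Set.Ioi 0)) (h1 : ∀ t, 0 < t → |f t| ≤ 2 * t)
    (h2 : ∀ t, 0 < t → |f t| ≤ S / t ^ 2) :
    |∫ t in Set.Ioi (0 : ℝ), f t| ≤ lam ^ 2 + S / lam := by
  have hu : Set.Ioi (0 : ℝ) = Set.Ioc 0 lam ∪ Set.Ioi lam :=
    (Set.Ioc_union_Ioi_eq_Ioi hlam.le).symm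
  have hdis : Disjoint (Set.Ioc (0 : ℝ) lam) (Set.Ioi lam) := by
    rw [Set.disjoint_left]
    intro t ht ht'
    exact not_lt.2 ht.2 ht'
  have hf1 : IntegrableOn f (Set.Ioc 0 lam) := hf.mono_set fun t ht => ht.1
  have hf2 : IntegrableOn f (Set.Ioi lam) := hf.mono_set fun t ht => hlam.trans ht
  rw [hu, setIntegral_union hdis measurableSet_Ioi hf1 hf2]
  have b1 : |∫ t in Set.Ioc (0 : ℝ) lam, f t| ≤ lam ^ 2 := by
    have hg : IntegrableOn (fun t : ℝ => 2 * t) (Set.Ioc 0 lam) :=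
      (Continuous.integrableOn_Icc (by fun_prop)).mono_set Set.Ioc_subset_Icc_self
    have := norm_integral_le_of_norm_le hg (f := f)
      ((ae_restrict_iff' measurableSet_Ioc).2 (Filter.Eventually.of_forall fun t ht => h1 t ht.1))
    refine this.trans (le_of_eq ?_)
    rw [← intervalIntegral.integral_of_le hlam.le, intervalIntegral.integral_const_mul,
      integral_id]
    ring
  have b2 : |∫ t in Set.Ioi lam, f t| ≤ S / lam := by
    have e : ∀ t ∈ Set.Ioi lam, S / t ^ 2 = S * t ^ (-2 : ℝ) := fun t ht => by
      have : 0 < t := hlam.trans ht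
      rw [Real.rpow_neg this.le, div_eq_mul_inv]
      norm_num
    have hg : IntegrableOn (fun t : ℝ => S * t ^ (-2 : ℝ)) (Set.Ioi lam) :=
      (integrableOn_Ioi_rpow_of_lt (by norm_num) hlam).const_mul S
    have := norm_integral_le_of_norm_le hg (f := f)
      ((ae_restrict_iff' measurableSet_Ioi).2 (Filter.Eventually.of_forall fun t ht => by
        have := h2 t (hlam.trans ht)
        rwa [e t ht] at this))
    refine this.trans (le_of_eq ?_)
    rw [integral_const_mul, integral_Ioi_rpow_of_lt (by norm_num) hlam]
    norm_num
    rw [Real.rpow_neg_one, div_eq_mul_inv]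
  exact (abs_add_le _ _).trans (add_le_add b1 b2)

section Invariance

variable {m n : ℕ} [NeZero m] {B : Fin (m ^ 2) → Matrix (Fin m) (Fin m) ℂ}

theorem integrable_resPart_hyb_prod (hB : IsStdBasis m B) (H : Finset (Fin n))
    {c : (Fin n → Fin (m ^ 2)) → ℂ} (hc : star c = c) :
    Integrable (fun p : (Fin n → Fin (m ^ 2) → ℝ) × ℝ => resPart (hyb B H c p.1) p.2)
      ((gaussFamily m n).prod (volume.restrict (Set.Ioi 0))) := by
  have h1 : Integrable (fun ω => 1 + 2 * nsq (hyb B H c ω) + nsq (hyb B H c ω * hyb B H c ω))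
      (gaussFamily m n) :=
    ((integrable_const _).add ((integrable_nsq_hyb hB H hc).const_mul 2)).add
      (integrable_nsq_hyb_mul hB H hc)
  have h2 : Integrable (fun t : ℝ => (1 + t ^ 2)⁻¹) (volume.restrict (Set.Ioi 0)) :=
    integrable_inv_one_add_sq.restrict
  have hμ : (gaussFamily m n).prod (volume.restrict (Set.Ioi (0 : ℝ))) =
      ((gaussFamily m n).prod volume).restrict {p | 0 < p.2} := by
    conv_lhs => rw [← Measure.restrict_univ (μ := gaussFamily m n)]
    rw [Measure.prod_restrict]
    congr 1
    ext p
    simp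
  have hs : MeasurableSet {p : (Fin n → Fin (m ^ 2) → ℝ) × ℝ | 0 < p.2} :=
    measurableSet_lt measurable_const measurable_snd
  refine (h1.mul_prod h2).mono' ?_ ?_
  · rw [hμ]
    refine ContinuousOn.aestronglyMeasurable ?_ hs
    have hcr := continuousOn_ntr_res (Z := (Fin n → Fin (m ^ 2) → ℝ) × ℝ)
      (f := fun p => hyb B H c p.1) (τ := fun p => p.2)
      ((continuous_hyb B H c).comp continuous_fst) continuous_snd
      fun p => hyb_isHermitian hB H hc p.1
    have ht : Continuous fun p : (Fin n → Fin (m ^ 2) → ℝ) × ℝ => ntr (hyb B H c p.1) := by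
      unfold ntr
      exact continuous_const.mul ((continuous_hyb B H c).comp continuous_fst).matrix_trace
    exact (Complex.continuous_re.comp ht).continuousOn.sub
      ((continuous_snd.pow 2).continuousOn.mul (Complex.continuous_re.comp_continuousOn hcr))
  · rw [hμ]
    exact (ae_restrict_iff' hs).2 (Filter.Eventually.of_forall fun p hp =>
      abs_resPart_le (hyb_isHermitian hB H hc p.1) hp)

theorem card_registers_inv : (Fintype.card (Fin n → Fin m) : ℝ)⁻¹ = ((m : ℝ) ^ n)⁻¹ := by
  simp

theorem integrable_trZeta_hyb (hB : IsStdBasis m B) (H : Finset (Fin n))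
    {c : (Fin n → Fin (m ^ 2)) → ℂ} (hc : star c = c) :
    Integrable (fun ω => ((m : ℝ) ^ n)⁻¹ * trZeta (hyb B H c ω)) (gaussFamily m n) := by
  have h := ((integrable_nsq_hyb hB H hc).div_const 2).sub
    ((integrable_resPart_hyb_prod hB H hc).integral_prod_left.const_mul Real.pi⁻¹)
  refine h.congr (Filter.Eventually.of_forall fun ω => ?_)
  beta_reduce
  rw [← card_registers_inv, specAvg_zeta (hyb_isHermitian hB H hc ω)]
  rfl

/-- The quadratic part depends only on the coefficients and so cancels between two hybrids; the
difference is carried by the integral over t. -/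
theorem integral_trZeta_hyb (hB : IsStdBasis m B) (H : Finset (Fin n))
    {c : (Fin n → Fin (m ^ 2)) → ℂ} (hc : star c = c) :
    ∫ ω, ((m : ℝ) ^ n)⁻¹ * trZeta (hyb B H c ω) ∂gaussFamily m n =
      sqn c / 2 - Real.pi⁻¹ * ∫ t in Set.Ioi (0 : ℝ),
        ∫ ω, resPart (hyb B H c ω) t ∂gaussFamily m n := by
  have hp := integrable_resPart_hyb_prod hB H hc
  have e : ∀ ω, ((m : ℝ) ^ n)⁻¹ * trZeta (hyb B H c ω) = nsq (hyb B H c ω) / 2 -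
      Real.pi⁻¹ * ∫ t in Set.Ioi (0 : ℝ), resPart (hyb B H c ω) t := fun ω => by
    rw [← card_registers_inv, specAvg_zeta (hyb_isHermitian hB H hc ω)]
  simp only [e]
  have hi : Integrable (fun ω => ∫ t in Set.Ioi (0 : ℝ), resPart (hyb B H c ω) t)
    (gaussFamily m n) := hp.integral_prod_left
  rw [integral_sub ((integrable_nsq_hyb hB H hc).div_const 2) (hi.const_mul _), integral_div,
    integral_nsq_hyb hB H hc, integral_const_mul]
  congr 2
  exact integral_integral_swap hp

theorem integral_resPart_hyb (hB : IsStdBasis m B) (H : Finset (Fin n))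
    {c : (Fin n → Fin (m ^ 2)) → ℂ} (hc : star c = c) {t : ℝ} (ht : 0 < t) :
    ∫ ω, resPart (hyb B H c ω) t ∂gaussFamily m n =
      (c 0).re - t ^ 2 * (∫ ω, ntr (res (hyb B H c ω) t) ∂gaussFamily m n).re := by
  have h1 := integrable_ntr_hyb hB H c
  have h2 := integrable_ntr_res_hyb hB H hc ht
  have h1' : Integrable (fun ω => (ntr (hyb B H c ω)).re) (gaussFamily m n) := h1.re
  have h2' : Integrable (fun ω => (ntr (res (hyb B H c ω) t)).re) (gaussFamily m n) := h2.re
  simp only [resPart]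
  rw [integral_sub h1' (h2'.const_mul _), integral_const_mul]
  have e1 := integral_re h1
  have e2 := integral_re h2
  rw [← integral_ntr_hyb hB H c]
  exact congrArg₂ (· - t ^ 2 * ·) e1 e2

theorem norm_integral_ntr_res_hyb_le (hB : IsStdBasis m B) (H : Finset (Fin n))
    {c : (Fin n → Fin (m ^ 2)) → ℂ} (hc : star c = c) {t : ℝ} (ht : 0 < t) :
    ‖∫ ω, ntr (res (hyb B H c ω) t) ∂gaussFamily m n‖ ≤ t⁻¹ := by
  refine (norm_integral_le_of_norm_le (integrable_const t⁻¹)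
    (Filter.Eventually.of_forall fun ω => norm_ntr_res_le (hyb_isHermitian hB H hc ω) ht)).trans
    (le_of_eq (by simp))

/-- The invariance principle for `ζ`, in terms of the coefficients. -/
theorem abs_integral_trZeta_hyb_sub_le (hm : 2 ≤ m) (hB : IsStdBasis m B) (H : Finset (Fin n))
    {c : (Fin n → Fin (m ^ 2)) → ℂ} (hc : star c = c) {d : ℕ} (hd : ∀ σ, c σ ≠ 0 → wtNZ σ ≤ d)
    {lam : ℝ} (hlam : 0 < lam) :
    |(∫ ω, ((m : ℝ) ^ n)⁻¹ * trZeta (hyb B H c ω) ∂gaussFamily m n) -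
      ((m : ℝ) ^ n)⁻¹ * trZeta (∑ σ, c σ • tensorBasis B σ)| ≤
      lam ^ 2 + (3 * √m) ^ d / lam * ∑ i ∈ Hᶜ, sqn (cutAt i c) * √(sqn (cutAt i c)) := by
  set Φ : Finset (Fin n) → ℝ → ℝ := fun H t => ∫ ω, resPart (hyb B H c ω) t ∂gaussFamily m n
    with hΦ
  set T := ∑ i ∈ Hᶜ, sqn (cutAt i c) * √(sqn (cutAt i c)) with hT
  set K := (3 * √(m : ℝ)) ^ d with hK
  have hΦi : ∀ H, IntegrableOn (Φ H) (Set.Ioi 0) := fun H =>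
    (integrable_resPart_hyb_prod hB H hc).integral_prod_right
  have e1 := integral_trZeta_hyb hB H hc
  have e2 := integral_trZeta_hyb hB Finset.univ hc
  simp only [hyb_univ] at e2
  rw [integral_const, probReal_univ, one_smul] at e2
  have key : |∫ t in Set.Ioi (0 : ℝ), (Φ H t - Φ Finset.univ t)| ≤
      lam ^ 2 + (2 * K * T) / lam := by
    -- The first goal uses only that each resolvent trace is at most 1/t, giving t² · 2/t. The
    -- second uses the iterated Lindeberg bound, giving t² · t⁻⁴ · 2KT. The means `c 0` cancel in
    -- both.
    refine integral_le_of_le_two_mul_of_le_div hlam ((hΦi H).sub (hΦi Finset.univ)) ?_ ?_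
    · intro t ht
      simp only [hΦ]
      rw [integral_resPart_hyb hB H hc ht, integral_resPart_hyb hB Finset.univ hc ht]
      have b1 := (Complex.abs_re_le_norm _).trans (norm_integral_ntr_res_hyb_le hB H hc ht)
      have b2 := (Complex.abs_re_le_norm _).trans
        (norm_integral_ntr_res_hyb_le hB Finset.univ hc ht)
      generalize (∫ ω, ntr (res (hyb B H c ω) t) ∂gaussFamily m n).re = a at b1
      generalize (∫ ω, ntr (res (hyb B Finset.univ c ω) t) ∂gaussFamily m n).re = b at b2
      rw [show (c 0).re - t ^ 2 * a - ((c 0).re - t ^ 2 * b) = t ^ 2 * (b - a) by ring, abs_mul,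
        abs_of_pos (by positivity)]
      have : |b - a| ≤ t⁻¹ + t⁻¹ := (abs_sub _ _).trans (add_le_add b2 b1)
      calc t ^ 2 * |b - a| ≤ t ^ 2 * (t⁻¹ + t⁻¹) := by gcongr
        _ = 2 * t := by field_simp; ring
    · intro t ht
      simp only [hΦ]
      rw [integral_resPart_hyb hB H hc ht, integral_resPart_hyb hB Finset.univ hc ht]
      have b := norm_integral_ntr_res_sub_le hm hB hc hd ht Hᶜ
      rw [compl_compl, ← hT, ← hK] at b
      have b' := (Complex.abs_re_le_norm _).trans b
      rw [Complex.sub_re] at b'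
      generalize (∫ ω, ntr (res (hyb B H c ω) t) ∂gaussFamily m n).re = a at b'
      generalize (∫ ω, ntr (res (hyb B Finset.univ c ω) t) ∂gaussFamily m n).re = b0 at b'
      rw [show (c 0).re - t ^ 2 * a - ((c 0).re - t ^ 2 * b0) = -(t ^ 2 * (a - b0)) by ring,
        abs_neg, abs_mul, abs_of_pos (by positivity)]
      calc t ^ 2 * |a - b0| ≤ t ^ 2 * ((t ^ 4)⁻¹ * (2 * K * T)) := by gcongr
        _ = 2 * K * T / t ^ 2 := by field_simp
  rw [integral_sub (hΦi H) (hΦi Finset.univ)] at key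
  have hU : ∀ t, Φ Finset.univ t = ∫ ω, resPart (∑ σ, c σ • tensorBasis B σ) t ∂gaussFamily m n :=
    fun t => by simp only [hΦ, hyb_univ]
  have e1' : (∫ ω, ((m : ℝ) ^ n)⁻¹ * trZeta (hyb B H c ω) ∂gaussFamily m n) =
      sqn c / 2 - Real.pi⁻¹ * ∫ t in Set.Ioi (0 : ℝ), Φ H t := e1
  have e2' : ((m : ℝ) ^ n)⁻¹ * trZeta (∑ σ, c σ • tensorBasis B σ) =
      sqn c / 2 - Real.pi⁻¹ * ∫ t in Set.Ioi (0 : ℝ), Φ Finset.univ t := by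
    simp only [hU]
    exact e2
  rw [e1', e2']
  have hS : 0 ≤ T := Finset.sum_nonneg fun i _ =>
    mul_nonneg (sqn_nonneg _) (Real.sqrt_nonneg _)
  have hK0 : 0 ≤ K := by positivity
  clear_value K T
  generalize ∫ t in Set.Ioi (0 : ℝ), Φ H t = a at key
  generalize ∫ t in Set.Ioi (0 : ℝ), Φ Finset.univ t = b at key
  rw [show sqn c / 2 - Real.pi⁻¹ * a - (sqn c / 2 - Real.pi⁻¹ * b) = -(Real.pi⁻¹ * (a - b)) by ring,
    abs_neg, abs_mul, abs_of_pos (inv_pos.2 Real.pi_pos)]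
  -- The prefactor 1/π absorbs the factor 2 of the Lindeberg bound, so the final constant is 1.
  have hpi : Real.pi⁻¹ ≤ 1 / 2 := by
    rw [one_div]
    exact inv_anti₀ two_pos Real.two_le_pi
  calc Real.pi⁻¹ * |a - b| ≤ 1 / 2 * (lam ^ 2 + 2 * K * T / lam) := by gcongr
    _ = lam ^ 2 / 2 + K / lam * T := by ring
    _ ≤ lam ^ 2 + K / lam * T := by
      have : 0 ≤ lam ^ 2 := sq_nonneg _
      linarith

end Invariance

/-! ### Removing identity factors -/

section OneKronecker

variable {κ κ' : Type} [Fintype κ] [DecidableEq κ] [Fintype κ'] [DecidableEq κ'] [Nonempty κ']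

theorem ntr_one_kronecker (X : Matrix κ κ ℂ) : ntr ((1 : Matrix κ' κ' ℂ) ⊗ₖ X) = ntr X := by
  rw [ntr_kronecker, ntr_one, one_mul]

theorem nsq_one_kronecker (X : Matrix κ κ ℂ) : nsq ((1 : Matrix κ' κ' ℂ) ⊗ₖ X) = nsq X := by
  rw [nsq, Matrix.conjTranspose_kronecker, ← Matrix.mul_kronecker_mul, Matrix.conjTranspose_one,
    Matrix.one_mul, ntr_one_kronecker, nsq]

/-- By the integral formula the normalized trace of ζ depends only on normalized traces of X, of X²
and of resolvents, none of which sees an identity factor. No functional calculus on the tensor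
product is needed. -/
theorem trZeta_one_kronecker_submatrix {κ'' : Type} [Fintype κ''] [DecidableEq κ'']
    (e : κ'' ≃ κ' × κ) {X : Matrix κ κ ℂ} (hX : X.IsHermitian) :
    (Fintype.card κ'' : ℝ)⁻¹ * trZeta (((1 : Matrix κ' κ' ℂ) ⊗ₖ X).submatrix e e) =
      (Fintype.card κ : ℝ)⁻¹ * trZeta X := by
  have h1 : ((1 : Matrix κ' κ' ℂ) ⊗ₖ X).IsHermitian := by
    rw [Matrix.IsHermitian, Matrix.conjTranspose_kronecker, Matrix.conjTranspose_one, hX.eq]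
  rw [specAvg_zeta (h1.submatrix e), specAvg_zeta hX, nsq_submatrix, nsq_one_kronecker]
  congr 2
  refine congrArg (fun f : ℝ → ℝ => ∫ t in Set.Ioi (0 : ℝ), f t) ?_
  funext t
  rw [resPart, resPart, res_submatrix, ntr_submatrix, ntr_submatrix, res_one_kronecker,
    ntr_one_kronecker, ntr_one_kronecker]

end OneKronecker

/-! ### From the hybrid operators on the registers in `H` to all the registers -/

section Hybrid

variable {m n : ℕ} [NeZero m] {B : Fin (m ^ 2) → Matrix (Fin m) (Fin m) ℂ}

/-- The hybrid operator with coefficients `c`. -/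
def hybridSum (B : Fin (m ^ 2) → Matrix (Fin m) (Fin m) ℂ) (H : Finset (Fin n))
    (c : (Fin n → Fin (m ^ 2)) → ℂ) (ω : Fin n → Fin (m ^ 2) → ℝ) : Op m {i // i ∈ H} :=
  ∑ σ, c σ • hybridBasis B H ω σ

/-- The coefficients of the low-degree part. -/
def lowCoeff (B : Fin (m ^ 2) → Matrix (Fin m) (Fin m) ℂ) (M : Op m (Fin n)) (d : ℕ)
    (σ : Fin n → Fin (m ^ 2)) : ℂ :=
  if wtNZ σ ≤ d then fourierCoeff B M σ else 0

theorem hybridLow_eq_hybridSum (H : Finset (Fin n)) (d : ℕ) (M : Op m (Fin n))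
    (ω : Fin n → Fin (m ^ 2) → ℝ) :
    hybridLow B H d M ω = hybridSum B H (lowCoeff B M d) ω := by
  rw [hybridLow, filter_sum_eq]
  rfl

theorem lowDegree_eq_sum_lowCoeff (M : Op m (Fin n)) (d : ℕ) :
    lowDegree B M d = ∑ σ, lowCoeff B M d σ • tensorBasis B σ := by
  rw [lowDegree, filter_sum_eq]
  rfl

/-- The registers outside `H` followed by the registers in `H`. -/
def cutEquiv (m : ℕ) (H : Finset (Fin n)) :
    (Fin n → Fin m) ≃ ({i // i ∉ H} → Fin m) × ({i // i ∈ H} → Fin m) :=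
  (Equiv.piEquivPiSubtypeProd (fun i => i ∈ H) fun _ => Fin m).trans (Equiv.prodComm _ _)

theorem hyb_eq_submatrix (H : Finset (Fin n)) (c : (Fin n → Fin (m ^ 2)) → ℂ)
    (ω : Fin n → Fin (m ^ 2) → ℝ) :
    hyb B H c ω = ((1 : Op m {i // i ∉ H}) ⊗ₖ hybridSum B H c ω).submatrix
      (cutEquiv m H) (cutEquiv m H) := by
  ext a b
  rw [Matrix.submatrix_apply, Matrix.kroneckerMap_apply, hyb, hybridSum, Matrix.sum_apply,
    Matrix.sum_apply, Finset.mul_sum]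
  refine Finset.sum_congr rfl fun σ _ => ?_
  simp only [Matrix.smul_apply, hybridBasis, tens, tensorBasis, Matrix.of_apply, smul_eq_mul]
  rw [← Finset.prod_mul_prod_compl H, ← Finset.prod_coe_sort H]
  have h1 : ∏ i : {i // i ∈ H}, regOp B H i (ω i) (σ i) (a i) (b i) =
      ∏ i : {i // i ∈ H}, B (σ i) ((cutEquiv m H a).2 i) ((cutEquiv m H b).2 i) :=
    Finset.prod_congr rfl fun i _ => by
      rw [regOp, if_pos i.2]
      rfl
  have h2 : ∏ i ∈ Hᶜ, regOp B H i (ω i) (σ i) (a i) (b i) =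
      (1 : Op m {i // i ∉ H}) (cutEquiv m H a).1 (cutEquiv m H b).1 *
        ((∏ i ∈ Hᶜ, gvar ω i (σ i) : ℝ) : ℂ) := by
    have h3 : ∀ i ∈ Hᶜ, regOp B H i (ω i) (σ i) (a i) (b i) =
        (if a i = b i then 1 else 0) * (gvar ω i (σ i) : ℂ) := fun i hi => by
      rw [regOp, if_neg (Finset.mem_compl.1 hi), gvar_eq_gcoord, Matrix.smul_apply,
        Matrix.one_apply, smul_eq_mul, mul_comm]
    rw [Finset.prod_congr rfl h3, Finset.prod_mul_distrib, Complex.ofReal_prod,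
      Finset.prod_ite_zero, Finset.prod_const_one, Matrix.one_apply]
    by_cases h : (cutEquiv m H a).1 = (cutEquiv m H b).1
    · have h' : ∀ i ∈ Hᶜ, a i = b i := fun i hi => congrFun h ⟨i, Finset.mem_compl.1 hi⟩
      rw [if_pos h, if_pos h']
    · rw [if_neg h, if_neg fun h' => h (funext fun i => h' i (Finset.mem_compl.2 i.2))]
  exact (congrArg₂ (fun x y => c σ * (x * y)) h1 h2).trans (by ring)

theorem hybridSum_isHermitian (hB : IsStdBasis m B) (H : Finset (Fin n))
    {c : (Fin n → Fin (m ^ 2)) → ℂ} (hc : star c = c) (ω : Fin n → Fin (m ^ 2) → ℝ) :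
    (hybridSum B H c ω).IsHermitian := by
  rw [Matrix.IsHermitian, hybridSum, Matrix.conjTranspose_sum]
  refine Finset.sum_congr rfl fun σ _ => ?_
  rw [hybridBasis, Matrix.conjTranspose_smul, Matrix.conjTranspose_smul,
    (tensorBasis_isHermitian hB _).eq]
  congr 1
  · exact congrFun hc σ
  · congr 1
    simp

theorem trZeta_hyb (hB : IsStdBasis m B) (H : Finset (Fin n))
    {c : (Fin n → Fin (m ^ 2)) → ℂ} (hc : star c = c) (ω : Fin n → Fin (m ^ 2) → ℝ) :
    ((m : ℝ) ^ n)⁻¹ * trZeta (hyb B H c ω) =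
      ((m : ℝ) ^ H.card)⁻¹ * trZeta (hybridSum B H c ω) := by
  have h := trZeta_one_kronecker_submatrix (κ' := {i // i ∉ H} → Fin m) (cutEquiv m H)
    (hybridSum_isHermitian hB H hc ω)
  rw [← hyb_eq_submatrix] at h
  simpa using h

theorem integrable_trZeta_hybridSum (hB : IsStdBasis m B) (H : Finset (Fin n))
    {c : (Fin n → Fin (m ^ 2)) → ℂ} (hc : star c = c) :
    Integrable (fun ω => trZeta (hybridSum B H c ω)) (gaussFamily m n) := by
  have h := (integrable_trZeta_hyb hB H hc).const_mul ((m : ℝ) ^ H.card)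
  refine h.congr (Filter.Eventually.of_forall fun ω => ?_)
  beta_reduce
  rw [trZeta_hyb hB H hc, mul_inv_cancel_left₀]
  exact pow_ne_zero _ (Nat.cast_ne_zero.2 (NeZero.ne m))

/-! ### Influences -/

theorem ntr_reduced (S : Finset (Fin n)) (P : Op m (Fin n)) : ntr (reduced S P) = ntr P := by
  have e : P.trace = ∑ a : {i // i ∈ S} → Fin m, ∑ b : {i // i ∉ S} → Fin m,
      P ((Equiv.piEquivPiSubtypeProd (fun i => i ∈ S) fun _ => Fin m).symm (a, b))
        ((Equiv.piEquivPiSubtypeProd (fun i => i ∈ S) fun _ => Fin m).symm (a, b)) := by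
    rw [← Fintype.sum_prod_type', Matrix.trace]
    exact (Equiv.sum_comp (Equiv.piEquivPiSubtypeProd (fun i => i ∈ S) fun _ => Fin m).symm
      fun a => P a a).symm
  rw [ntr, ntr, e, Matrix.trace]
  simp only [reduced, Matrix.diag, Matrix.of_apply, ← Finset.mul_sum]
  rw [← mul_assoc]
  congr 1
  have hc : S.card + Sᶜ.card = n := by rw [Finset.card_add_card_compl, Fintype.card_fin]
  simp only [Fintype.card_pi, Fintype.card_fin, Finset.prod_const, Finset.card_univ,
    Fintype.card_coe]
  push_cast
  rw [← mul_inv, ← pow_add, hc]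

/-- Extension of a label by zero. -/
def extZero (S : Finset (Fin n)) (ν : {i // i ∈ S} → Fin (m ^ 2)) : Fin n → Fin (m ^ 2) :=
  (Equiv.piEquivPiSubtypeProd (fun i => i ∈ S) fun _ => Fin (m ^ 2)).symm (ν, 0)

theorem tensorBasis_extZero (hB : IsStdBasis m B) (S : Finset (Fin n))
    (ν : {i // i ∈ S} → Fin (m ^ 2)) (a a' : {i // i ∈ S} → Fin m)
    (b b' : {i // i ∉ S} → Fin m) :
    tensorBasis B (extZero S ν)
      ((Equiv.piEquivPiSubtypeProd (fun i => i ∈ S) fun _ => Fin m).symm (a, b))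
      ((Equiv.piEquivPiSubtypeProd (fun i => i ∈ S) fun _ => Fin m).symm (a', b')) =
      if b = b' then tensorBasis B ν a a' else 0 := by
  simp only [tensorBasis, Matrix.of_apply]
  rw [← Finset.prod_mul_prod_compl S, ← Finset.prod_coe_sort S]
  have h1 : ∏ i : {i // i ∈ S}, B (extZero S ν i)
      ((Equiv.piEquivPiSubtypeProd (fun i => i ∈ S) fun _ => Fin m).symm (a, b) i)
      ((Equiv.piEquivPiSubtypeProd (fun i => i ∈ S) fun _ => Fin m).symm (a', b') i) =
      ∏ i, B (ν i) (a i) (a' i) := Finset.prod_congr rfl fun i _ => by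
    simp [extZero, Equiv.piEquivPiSubtypeProd]
  have h2 : ∏ i ∈ Sᶜ, B (extZero S ν i)
      ((Equiv.piEquivPiSubtypeProd (fun i => i ∈ S) fun _ => Fin m).symm (a, b) i)
      ((Equiv.piEquivPiSubtypeProd (fun i => i ∈ S) fun _ => Fin m).symm (a', b') i) =
      if b = b' then 1 else 0 := by
    rw [Finset.prod_subtype (s := Sᶜ) (p := fun i => i ∉ S) (F := inferInstance) (f := fun i =>
      B (extZero S ν i)
      ((Equiv.piEquivPiSubtypeProd (fun i => i ∈ S) fun _ => Fin m).symm (a, b) i)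
      ((Equiv.piEquivPiSubtypeProd (fun i => i ∈ S) fun _ => Fin m).symm (a', b') i))
      (fun i => Finset.mem_compl)]
    have h3 : ∀ i : {i // i ∉ S}, B (extZero S ν i)
      ((Equiv.piEquivPiSubtypeProd (fun i => i ∈ S) fun _ => Fin m).symm (a, b) i)
      ((Equiv.piEquivPiSubtypeProd (fun i => i ∈ S) fun _ => Fin m).symm (a', b') i) =
      if b i = b' i then 1 else 0 := fun i => by
      simp [extZero, Equiv.piEquivPiSubtypeProd, i.2, hB.zero_eq_one, Matrix.one_apply]
    simp only [h3, Finset.prod_ite_zero, funext_iff]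
    simp
  exact (congrArg₂ (· * ·) h1 h2).trans (by split_ifs <;> simp)

/-- The normalized partial trace preserves the normalized trace, and a factor acting as the identity
outside S can be moved through it. Coefficients of the reduced operator are thus those of labels
extended by zero. -/
theorem fourierCoeff_reduced (hB : IsStdBasis m B) (S : Finset (Fin n)) (P : Op m (Fin n))
    (ν : {i // i ∈ S} → Fin (m ^ 2)) :
    fourierCoeff B (reduced S P) ν = fourierCoeff B P (extZero S ν) := by
  have e : (tensorBasis B ν).conjTranspose * reduced S P =
      reduced S ((tensorBasis B (extZero S ν)).conjTranspose * P) := by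
    ext a a'
    simp only [reduced, Matrix.mul_apply, Matrix.of_apply, Matrix.conjTranspose_apply]
    have h : ∀ b : {i // i ∉ S} → Fin m, ∑ x,
        star (tensorBasis B (extZero S ν) x
          ((Equiv.piEquivPiSubtypeProd (fun i => i ∈ S) fun _ => Fin m).symm (a, b))) *
        P x ((Equiv.piEquivPiSubtypeProd (fun i => i ∈ S) fun _ => Fin m).symm (a', b)) =
        ∑ a'', star (tensorBasis B ν a'' a) *
          P ((Equiv.piEquivPiSubtypeProd (fun i => i ∈ S) fun _ => Fin m).symm (a'', b))
            ((Equiv.piEquivPiSubtypeProd (fun i => i ∈ S) fun _ => Fin m).symm (a', b)) := by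
      intro b
      rw [← Equiv.sum_comp (Equiv.piEquivPiSubtypeProd (fun i => i ∈ S) fun _ => Fin m).symm,
        Fintype.sum_prod_type]
      refine Finset.sum_congr rfl fun a'' _ => ?_
      rw [Finset.sum_eq_single b]
      · rw [tensorBasis_extZero hB, if_pos rfl]
      · intro b' _ hb'
        rw [tensorBasis_extZero hB, if_neg hb', star_zero, zero_mul]
      · simp
    simp only [h]
    rw [Finset.sum_comm, Finset.mul_sum]
    refine Finset.sum_congr rfl fun a'' _ => ?_
    rw [← Finset.mul_sum]
    ring
  rw [fourierCoeff, fourierCoeff, ninner_eq_ntr, ninner_eq_ntr, e, ntr_reduced]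

theorem nsq_reduced (hB : IsStdBasis m B) (S : Finset (Fin n)) (P : Op m (Fin n)) :
    nsq (reduced S P) = ∑ σ, if ∀ i ∉ S, σ i = 0 then ‖fourierCoeff B P σ‖ ^ 2 else 0 := by
  rw [nsq_eq_sum_fourierCoeff hB,
    ← Equiv.sum_comp (Equiv.piEquivPiSubtypeProd (fun i => i ∈ S) fun _ => Fin (m ^ 2)).symm,
    Fintype.sum_prod_type]
  refine Finset.sum_congr rfl fun ν _ => ?_
  have hiff : ∀ μ : {i // i ∉ S} → Fin (m ^ 2), (∀ i ∉ S,
      (Equiv.piEquivPiSubtypeProd (fun i => i ∈ S) fun _ => Fin (m ^ 2)).symm (ν, μ) i = 0) ↔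
      μ = 0 := fun μ => by
    constructor
    · intro h
      funext i
      have := h i i.2
      simpa [Equiv.piEquivPiSubtypeProd, i.2] using this
    · rintro rfl i hi
      simp [Equiv.piEquivPiSubtypeProd, hi]
  rw [Finset.sum_eq_single 0, if_pos ((hiff 0).2 rfl), fourierCoeff_reduced hB]
  · rfl
  · intro μ _ hμ
    rw [if_neg fun h => hμ ((hiff μ).1 h)]
  · simp

/-- A difference of two Parseval sums, over all σ and over those with σ i = 0. The influence is
therefore the mean squared norm of the perturbation in the Lindeberg step. -/
theorem influence_eq (hB : IsStdBasis m B) (i : Fin n) (P : Op m (Fin n)) :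
    influence i P = sqn (cutAt i (fourierCoeff B P)) := by
  rw [influence, ninner_eq_ntr, Matrix.conjTranspose_one, Matrix.one_mul, varOp, ntr_sub,
    ntr_reduced, Complex.sub_re, ← nsq, ← nsq, nsq_reduced hB, nsq_eq_sum_fourierCoeff hB,
    ← Finset.sum_sub_distrib, sqn]
  refine Finset.sum_congr rfl fun σ _ => ?_
  by_cases h : σ i = 0 <;> simp [cutAt, h]

end Hybrid

/-! ### The invariance principle in terms of influences -/

section InvarianceTheorems

variable {m n : ℕ} [NeZero m] {B : Fin (m ^ 2) → Matrix (Fin m) (Fin m) ℂ}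

theorem three_mul_sqrt_pow (d : ℕ) :
    (3 * √(m : ℝ)) ^ d = 3 ^ d * (m : ℝ) ^ ((d : ℝ) / 2) := by
  rw [mul_pow, Real.sqrt_eq_rpow, ← Real.rpow_natCast ((m : ℝ) ^ (1 / 2 : ℝ)),
    ← Real.rpow_mul (Nat.cast_nonneg m)]
  congr 2
  ring

theorem mul_sqrt_eq_rpow {x : ℝ} (hx : 0 ≤ x) : x * √x = x ^ (3 / 2 : ℝ) := by
  rw [show (3 / 2 : ℝ) = 1 + 1 / 2 by norm_num, Real.rpow_add_of_nonneg hx (by norm_num)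
    (by norm_num), Real.rpow_one, Real.sqrt_eq_rpow]

theorem star_fourierCoeff_eq (hB : IsStdBasis m B) (M : HermOp m (Fin n)) :
    star (fourierCoeff B (M : Op m (Fin n))) = fourierCoeff B (M : Op m (Fin n)) :=
  funext fun σ => star_fourierCoeff hB M.2 σ

theorem star_lowCoeff_eq (hB : IsStdBasis m B) (M : HermOp m (Fin n)) (d : ℕ) :
    star (lowCoeff B (M : Op m (Fin n)) d) = lowCoeff B (M : Op m (Fin n)) d := by
  funext σ
  simp only [Pi.star_apply, lowCoeff]
  split_ifs
  · exact star_fourierCoeff hB M.2 σ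
  · simp

theorem wtNZ_le_opDegree (M : Op m (Fin n)) (σ : Fin n → Fin (m ^ 2))
    (hσ : fourierCoeff B M σ ≠ 0) : wtNZ σ ≤ opDegree B M := by
  classical
  exact Finset.le_sup (f := wtNZ) (Finset.mem_filter.2 ⟨Finset.mem_univ σ, hσ⟩)

theorem invariance_of_degree (hm : 2 ≤ m) (hB : IsStdBasis m B) (H : Finset (Fin n))
    {c : (Fin n → Fin (m ^ 2)) → ℂ} (hc : star c = c) {d : ℕ} (hd : ∀ σ, c σ ≠ 0 → wtNZ σ ≤ d)
    {lam : ℝ} (hlam : 0 < lam) :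
    |(∫ ω, ((m : ℝ) ^ H.card)⁻¹ * trZeta (hybridSum B H c ω) ∂gaussFamily m n) -
      ((m : ℝ) ^ n)⁻¹ * trZeta (∑ σ, c σ • tensorBasis B σ)| ≤
      lam ^ 2 + 3 ^ d * (m : ℝ) ^ ((d : ℝ) / 2) / lam *
        ∑ i ∈ Hᶜ, sqn (cutAt i c) * √(sqn (cutAt i c)) := by
  have h := abs_integral_trZeta_hyb_sub_le hm hB H hc hd hlam
  simpa only [trZeta_hyb hB H hc, three_mul_sqrt_pow] using h

/-- Double counting: a label σ contributes once for each of its nonzero entries, of which there are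
at most d whenever its coefficient is nonzero. -/
theorem sum_sqn_cutAt_le (c : (Fin n → Fin (m ^ 2)) → ℂ) {d : ℕ} (hd : ∀ σ, c σ ≠ 0 → wtNZ σ ≤ d)
    (s : Finset (Fin n)) : ∑ i ∈ s, sqn (cutAt i c) ≤ d * sqn c := by
  have h1 : ∑ i ∈ s, sqn (cutAt i c) ≤ ∑ i, sqn (cutAt i c) :=
    Finset.sum_le_univ_sum_of_nonneg fun i => sqn_nonneg _
  refine h1.trans ?_
  simp only [sqn]
  rw [Finset.sum_comm, Finset.mul_sum]
  refine Finset.sum_le_sum fun σ _ => ?_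
  have h2 : ∀ i, ‖cutAt i c σ‖ ^ 2 = if (σ i : ℕ) ≠ 0 then ‖c σ‖ ^ 2 else 0 := fun i => by
    have : σ i = 0 ↔ (σ i : ℕ) = 0 := by rw [Fin.ext_iff, Fin.val_zero]
    by_cases h : σ i = 0
    · simp [cutAt, h]
    · simp [cutAt, h, mt this.2 h]
  simp only [h2]
  rw [← Finset.sum_filter, Finset.sum_const, nsmul_eq_mul]
  by_cases hσ : c σ = 0
  · simp [hσ]
  · gcongr
    exact hd σ hσ

theorem lowCoeff_ne_zero {M : Op m (Fin n)} {d : ℕ} (σ : Fin n → Fin (m ^ 2))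
    (h : lowCoeff B M d σ ≠ 0) : wtNZ σ ≤ d := by
  by_contra h'
  exact h (if_neg h')

theorem norm_lowCoeff_le (M : Op m (Fin n)) (d : ℕ) (σ : Fin n → Fin (m ^ 2)) :
    ‖lowCoeff B M d σ‖ ≤ ‖fourierCoeff B M σ‖ := by
  unfold lowCoeff
  split_ifs
  · exact le_rfl
  · simp

theorem invariance_low (hm : 2 ≤ m) (hB : IsStdBasis m B) {d : ℕ} (hd : 0 < d) {τ : ℝ}
    (hτ : 0 < τ) (M : HermOp m (Fin n)) (H : Finset (Fin n))
    (hM : nnorm2 (M : Op m (Fin n)) ≤ 1)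
    (hinf : ∀ i, i ∉ H → influence i (M : Op m (Fin n)) ≤ τ) :
    |((m : ℝ) ^ H.card)⁻¹ *
          (∫ ω, trZeta (hybridLow B H d (M : Op m (Fin n)) ω) ∂gaussFamily m n) -
        ((m : ℝ) ^ n)⁻¹ * trZeta (lowDegree B (M : Op m (Fin n)) d)| ≤
      2 * ((3 : ℝ) ^ d * (m : ℝ) ^ ((d : ℝ) / 2) * Real.sqrt τ * d) ^ (2 / 3 : ℝ) := by
  set c := lowCoeff B (M : Op m (Fin n)) d with hcdef
  have hc := star_lowCoeff_eq hB M d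
  have hcd : ∀ σ, c σ ≠ 0 → wtNZ σ ≤ d := fun σ => lowCoeff_ne_zero σ
  have hm0 : (0 : ℝ) < m := by
    have : 0 < m := by omega
    exact_mod_cast this
  set K : ℝ := 3 ^ d * (m : ℝ) ^ ((d : ℝ) / 2) with hK
  have hKpos : 0 < K := by positivity
  have hXpos : 0 < K * √τ * d := by positivity
  -- One factor √I of I^{3/2} is bounded by √τ; the remaining influences add up to at most d.
  have hsum : ∑ i ∈ Hᶜ, sqn (cutAt i c) * √(sqn (cutAt i c)) ≤ √τ * d := by
    have hle : ∀ i ∈ Hᶜ, sqn (cutAt i c) ≤ τ := fun i hi => by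
      refine le_trans ?_ (hinf i (Finset.mem_compl.1 hi))
      rw [influence_eq hB]
      refine Finset.sum_le_sum fun σ _ => ?_
      unfold cutAt
      split_ifs
      · exact le_rfl
      · exact pow_le_pow_left₀ (norm_nonneg _) (norm_lowCoeff_le _ _ _) 2
    have hs1 : sqn c ≤ 1 := by
      have h1 : nsq (M : Op m (Fin n)) ≤ 1 := by
        rw [← nnorm2_sq]
        exact pow_le_one₀ (Real.sqrt_nonneg _) hM
      refine le_trans ?_ h1
      rw [nsq_eq_sum_fourierCoeff hB]
      exact Finset.sum_le_sum fun σ _ =>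
        pow_le_pow_left₀ (norm_nonneg _) (norm_lowCoeff_le _ _ _) 2
    calc ∑ i ∈ Hᶜ, sqn (cutAt i c) * √(sqn (cutAt i c))
        ≤ ∑ i ∈ Hᶜ, sqn (cutAt i c) * √τ := Finset.sum_le_sum fun i hi =>
          mul_le_mul_of_nonneg_left (Real.sqrt_le_sqrt (hle i hi)) (sqn_nonneg _)
      _ = (∑ i ∈ Hᶜ, sqn (cutAt i c)) * √τ := by rw [Finset.sum_mul]
      _ ≤ (d * 1) * √τ := by
          gcongr
          exact (sum_sqn_cutAt_le c hcd _).trans (by gcongr)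
      _ = √τ * d := by ring
  set X := K * √τ * d with hX
  -- The choice λ = X^{1/3} balances λ² with X/λ. Each is X^{2/3}, whence the constant 2.
  have h := invariance_of_degree hm hB H hc hcd (lam := X ^ (1 / 3 : ℝ)) (by positivity)
  rw [integral_const_mul, ← lowDegree_eq_sum_lowCoeff, ← hK] at h
  simp only [hybridLow_eq_hybridSum]
  refine h.trans ?_
  have e1 : (X ^ (1 / 3 : ℝ)) ^ 2 = X ^ (2 / 3 : ℝ) := by
    rw [← Real.rpow_natCast, ← Real.rpow_mul hXpos.le]
    norm_num
  have e2 : X / X ^ (1 / 3 : ℝ) = X ^ (2 / 3 : ℝ) := by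
    rw [div_eq_iff (by positivity), ← Real.rpow_add hXpos]
    norm_num
  have e3 : K / X ^ (1 / 3 : ℝ) * ∑ i ∈ Hᶜ, sqn (cutAt i c) * √(sqn (cutAt i c)) ≤
      X ^ (2 / 3 : ℝ) := by
    calc _ ≤ K / X ^ (1 / 3 : ℝ) * (√τ * d) := by gcongr
      _ = X / X ^ (1 / 3 : ℝ) := by rw [hX]; ring
      _ = _ := e2
  rw [e1]
  linarith

theorem integrable_trZeta_hybridLow (hB : IsStdBasis m B) (H : Finset (Fin n)) (d : ℕ)
    (M : HermOp m (Fin n)) :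
    Integrable (fun ω => trZeta (hybridLow B H d (M : Op m (Fin n)) ω)) (gaussFamily m n) := by
  simp only [hybridLow_eq_hybridSum]
  exact integrable_trZeta_hybridSum hB H (star_lowCoeff_eq hB M d)

end InvarianceTheorems

theorem invariance_exists :
    ∃ C : ℝ, 0 < C ∧
      ∀ (m n : ℕ), 1 < m →
      ∀ (B : Fin (m ^ 2) → Matrix (Fin m) (Fin m) ℂ), IsStdBasis m B →
      ∀ (M : HermOp m (Fin n)) (H : Finset (Fin n)) (lam : ℝ), 0 < lam →
        Integrable (fun ω => trZeta (hybrid B H (M : Op m (Fin n)) ω)) (gaussFamily m n) ∧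
        |(∫ ω, ((m : ℝ) ^ H.card)⁻¹ * trZeta (hybrid B H (M : Op m (Fin n)) ω) ∂gaussFamily m n) -
            ((m : ℝ) ^ n)⁻¹ * trZeta (M : Op m (Fin n))| ≤
          C * (lam ^ 2 +
            (3 : ℝ) ^ opDegree B (M : Op m (Fin n)) *
              (m : ℝ) ^ ((opDegree B (M : Op m (Fin n)) : ℝ) / 2) / lam *
              ∑ i ∈ Hᶜ, influence i (M : Op m (Fin n)) ^ (3 / 2 : ℝ)) := by
  refine ⟨1, one_pos, fun m n hm B hB M H lam hlam => ?_⟩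
  have : NeZero m := ⟨by omega⟩
  refine ⟨integrable_trZeta_hybridSum hB H (star_fourierCoeff_eq hB M), ?_⟩
  have h := invariance_of_degree hm hB H (star_fourierCoeff_eq hB M)
    (wtNZ_le_opDegree (B := B) (M : Op m (Fin n))) hlam
  rw [sum_fourierCoeff hB] at h
  rw [one_mul]
  refine h.trans (le_of_eq ?_)
  congr 2
  refine Finset.sum_congr rfl fun i _ => ?_
  rw [influence_eq hB, mul_sqrt_eq_rpow (sqn_nonneg _)]

theorem invariance_low_exists :
    ∃ C : ℝ, 0 < C ∧
      ∀ (m n d : ℕ), 1 < m → 0 < d →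
      ∀ (τ : ℝ), 0 < τ → τ < 1 →
      ∀ (B : Fin (m ^ 2) → Matrix (Fin m) (Fin m) ℂ), IsStdBasis m B →
      ∀ (M : HermOp m (Fin n)) (H : Finset (Fin n)),
        nnorm2 (M : Op m (Fin n)) ≤ 1 →
        (∀ i, i ∉ H → influence i (M : Op m (Fin n)) ≤ τ) →
        Integrable (fun ω => trZeta (hybridLow B H d (M : Op m (Fin n)) ω)) (gaussFamily m n) ∧
        |((m : ℝ) ^ H.card)⁻¹ *
              (∫ ω, trZeta (hybridLow B H d (M : Op m (Fin n)) ω) ∂gaussFamily m n) -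
            ((m : ℝ) ^ n)⁻¹ * trZeta (lowDegree B (M : Op m (Fin n)) d)| ≤
          C * ((3 : ℝ) ^ d * (m : ℝ) ^ ((d : ℝ) / 2) * Real.sqrt τ * d) ^ (2 / 3 : ℝ) := by
  refine ⟨2, two_pos, fun m n d hm hd τ hτ _ B hB M H hM hinf => ?_⟩
  have : NeZero m := ⟨by omega⟩
  exact ⟨integrable_trZeta_hybridLow hB H d M, invariance_low hm hB hd hτ M H hM hinf⟩

/-! ### Standard orthonormal bases -/

section Combination

variable {κ J K : Type} [Fintype κ] [DecidableEq κ] [Fintype K] [DecidableEq K]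

theorem sum_real_smul_isHermitian {F : K → Matrix κ κ ℂ} (hF : ∀ k, (F k).IsHermitian)
    (w : K → ℝ) : (∑ k, (w k : ℂ) • F k).IsHermitian := by
  rw [Matrix.IsHermitian, Matrix.conjTranspose_sum]
  refine Finset.sum_congr rfl fun k _ => ?_
  rw [Matrix.conjTranspose_smul, (hF k).eq]
  simp

theorem ninner_sum_real_smul {F : K → Matrix κ κ ℂ}
    (hF : ∀ i j, ninner (F i) (F j) = if i = j then 1 else 0) (v w : K → ℝ) :
    ninner (∑ k, (v k : ℂ) • F k) (∑ k, (w k : ℂ) • F k) = ((∑ k, v k * w k : ℝ) : ℂ) := by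
  rw [ninner_sum_left]
  push_cast
  refine Finset.sum_congr rfl fun k _ => ?_
  rw [ninner_sum_right]
  simp [hF]

end Combination

/-- An orthonormal basis of the `m × m` matrices consisting of Hermitian matrices. -/
def hermUnit (m : ℕ) (p : Fin m × Fin m) : Matrix (Fin m) (Fin m) ℂ :=
  ((√m : ℝ) : ℂ) • (((1 + Complex.I) / 2) • Matrix.single p.1 p.2 1 +
    ((1 - Complex.I) / 2) • Matrix.single p.2 p.1 1)

theorem hermUnit_isHermitian (m : ℕ) (p : Fin m × Fin m) : (hermUnit m p).IsHermitian := by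
  rw [Matrix.IsHermitian, hermUnit]
  simp only [Matrix.conjTranspose_smul, Matrix.conjTranspose_add, Matrix.conjTranspose_single,
    star_one]
  rw [add_comm]
  congr 2
  · simp
  · congr 1
    simp
  · congr 1
    simp [sub_eq_add_neg]

/-- The weights (1 ± i)/2 treat all positions uniformly. On the diagonal they add up to 1. Off the
diagonal their squared moduli add up to 1, and the elements at (a, b) and (b, a) are orthogonal
because ((1 − i)/2)² is purely imaginary. -/
theorem ninner_hermUnit {m : ℕ} (hm : 0 < m) (p q : Fin m × Fin m) :
    ninner (hermUnit m p) (hermUnit m q) = if p = q then 1 else 0 := by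
  obtain ⟨a, b⟩ := p
  obtain ⟨c, d⟩ := q
  have hm' : (m : ℂ) ≠ 0 := by exact_mod_cast hm.ne'
  have hs : ((√m : ℝ) : ℂ) * ((√m : ℝ) : ℂ) = m := by
    rw [← Complex.ofReal_mul, Real.mul_self_sqrt (Nat.cast_nonneg m)]
    simp
  have key : ∀ X Y : Matrix (Fin m) (Fin m) ℂ,
      ninner (((√m : ℝ) : ℂ) • X) (((√m : ℝ) : ℂ) • Y) = (X.conjTranspose * Y).trace := by
    intro X Y
    rw [ninner_eq_ntr, Matrix.conjTranspose_smul, Matrix.smul_mul, Matrix.mul_smul, ntr_smul,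
      ntr_smul, ← mul_assoc, Complex.star_def, Complex.conj_ofReal, hs, ntr, Fintype.card_fin,
      mul_inv_cancel_left₀ hm']
  have tr : ∀ i j k l : Fin m, (Matrix.single i j (1 : ℂ) * Matrix.single k l 1).trace =
      if j = k ∧ i = l then 1 else 0 := by
    intro i j k l
    by_cases h : j = k
    · subst h
      rw [Matrix.single_mul_single_same, one_mul]
      by_cases h' : i = l
      · subst h'; simp
      · simp [h', Matrix.trace_single_eq_of_ne i l _ h']
    · simp [Matrix.single_mul_single_of_ne _ _ _ _ h, h]
  rw [hermUnit, hermUnit, key]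
  simp only [Matrix.conjTranspose_smul, Matrix.conjTranspose_add, Matrix.conjTranspose_single,
    star_one, Matrix.add_mul, Matrix.mul_add, Matrix.smul_mul, Matrix.mul_smul, Matrix.trace_add,
    Matrix.trace_smul, tr, Prod.mk.injEq, smul_eq_mul]
  have e1 : star ((1 + Complex.I) / 2) = (1 - Complex.I) / 2 := by simp [sub_eq_add_neg]
  have e2 : star ((1 - Complex.I) / 2) = (1 + Complex.I) / 2 := by simp
  rw [e1, e2]
  have i1 : (a = c ∧ b = d) ↔ (b = d ∧ a = c) := and_comm
  have i2 : (a = d ∧ b = c) ↔ (b = c ∧ a = d) := and_comm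
  simp only [i1, i2]
  generalize (if b = d ∧ a = c then (1 : ℂ) else 0) = x
  generalize (if b = c ∧ a = d then (1 : ℂ) else 0) = y
  linear_combination (y / 2 - x / 2) * Complex.I_sq

/-- In the coordinates of `hermUnit` the identity is the real unit vector `u`. Extending it to an
orthonormal basis of real vectors keeps the matrices Hermitian and orthonormal. -/
theorem exists_isStdBasis {m : ℕ} (hm : 0 < m) :
    ∃ B : Fin (m ^ 2) → Matrix (Fin m) (Fin m) ℂ, IsStdBasis m B := by
  have : NeZero m := ⟨hm.ne'⟩
  set u : EuclideanSpace ℝ (Fin m × Fin m) :=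
    WithLp.toLp 2 fun p => if p.1 = p.2 then (√(m : ℝ))⁻¹ else 0 with hu
  have hm0 : (0 : ℝ) < m := by exact_mod_cast hm
  have hunorm : ‖u‖ = 1 := by
    rw [EuclideanSpace.norm_eq, Real.sqrt_eq_one, Fintype.sum_prod_type]
    simp [hu, ite_pow]
  obtain ⟨b, hb⟩ := Orthonormal.exists_orthonormalBasis_extension_of_card_eq (𝕜 := ℝ)
    (E := EuclideanSpace ℝ (Fin m × Fin m)) (ι := Fin (m ^ 2)) (by simp [sq])
    (v := fun _ => u) (s := {0}) (by
      refine ⟨fun i => hunorm, fun i j hij => ?_⟩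
      exact absurd (Subtype.ext (i.2.trans j.2.symm)) hij)
  refine ⟨fun j => ∑ p, (b j p : ℂ) • hermUnit m p, ?_, ?_, ?_⟩
  · exact fun j => sum_real_smul_isHermitian (hermUnit_isHermitian m) _
  · intro i j
    rw [ninner_sum_real_smul (ninner_hermUnit hm)]
    have h := (orthonormal_iff_ite.1 b.orthonormal) i j
    rw [PiLp.inner_apply] at h
    have h' : ∑ k, b i k * b j k = if i = j then 1 else 0 := by
      rw [← h]
      exact Finset.sum_congr rfl fun k _ => by simp [mul_comm]
    rw [h']
    split_ifs <;> simp
  · intro i hi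
    have hi0 : i = 0 := Fin.ext (by simpa using hi)
    subst hi0
    rw [hb 0 rfl]
    ext a c
    have hs : ((√m : ℝ) : ℂ) ≠ 0 := by
      exact_mod_cast (Real.sqrt_pos.2 hm0).ne'
    rw [Matrix.sum_apply, Fintype.sum_prod_type]
    simp only [hu, hermUnit, Matrix.smul_apply, Matrix.add_apply, Matrix.single_apply, smul_eq_mul]
    simp only [apply_ite Complex.ofReal, Complex.ofReal_zero, ite_mul, zero_mul,
      Finset.sum_ite_eq, Finset.mem_univ, if_true, Matrix.one_apply]
    rw [Finset.sum_eq_single a]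
    · by_cases hac : a = c
      · subst hac
        simp
        field_simp
        ring
      · simp [hac]
    · intro k _ hk
      simp [hk]
    · simp

/-- The singular value decomposition of a real square matrix. -/
theorem exists_singular_decomposition {J : Type} [Fintype J] [DecidableEq J]
    (C : Matrix J J ℝ) : ∃ (u v : OrthonormalBasis J ℝ (EuclideanSpace ℝ J)) (s : J → ℝ),
      ∀ a b, ∑ j, ∑ k, u a j * C j k * v b k = if a = b then s a else 0 := by
  have hS : (C.transpose * C).IsHermitian := by
    simp [Matrix.IsHermitian, Matrix.conjTranspose_eq_transpose_of_trivial,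
      Matrix.transpose_mul]
  set v := hS.eigenvectorBasis with hv
  set w : J → EuclideanSpace ℝ J := fun b => WithLp.toLp 2 (C.mulVec (v b)) with hw
  have hwi : ∀ a b, inner ℝ (w a) (w b) = if a = b then hS.eigenvalues b else 0 := by
    intro a b
    have h1 : inner ℝ (w a) (w b) =
        (v a : J → ℝ) ⬝ᵥ ((C.transpose * C).mulVec (v b : J → ℝ)) := by
      rw [← Matrix.mulVec_mulVec, Matrix.dotProduct_mulVec, Matrix.vecMul_transpose]
      simp [hw, PiLp.inner_apply, dotProduct, mul_comm]
    rw [h1, hS.mulVec_eigenvectorBasis, dotProduct_smul]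
    have h2 := (orthonormal_iff_ite.1 v.orthonormal) a b
    have h3 : (v a : J → ℝ) ⬝ᵥ (v b : J → ℝ) = if a = b then 1 else 0 := by
      rw [← h2]
      simp [PiLp.inner_apply, dotProduct, mul_comm]
    rw [← hv, h3]
    split_ifs <;> simp
  have hnn : ∀ b, 0 ≤ hS.eigenvalues b := fun b => by
    have := hwi b b
    rw [if_pos rfl] at this
    rw [← this]
    exact real_inner_self_nonneg
  -- The left singular vectors are the normalized images of the right ones. Where the eigenvalue is
  -- zero the image vanishes, and any completion to an orthonormal basis will do.
  obtain ⟨u, hu⟩ := Orthonormal.exists_orthonormalBasis_extension_of_card_eq (𝕜 := ℝ)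
    (E := EuclideanSpace ℝ J) (ι := J) (by simp)
    (v := fun b => (√(hS.eigenvalues b))⁻¹ • w b) (s := {b | hS.eigenvalues b ≠ 0}) (by
      rw [orthonormal_iff_ite]
      rintro ⟨a, ha⟩ ⟨b, hb⟩
      simp only [Set.domRestrict_apply, inner_smul_left, inner_smul_right, hwi, Subtype.mk.injEq]
      by_cases hab : a = b
      · subst hab
        have h := Real.mul_self_sqrt (hnn a)
        have h0 : √(hS.eigenvalues a) ≠ 0 := fun h0 => ha (by rw [← h, h0, zero_mul])
        simp only [if_true, RCLike.conj_to_real]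
        nth_rewrite 3 [← h]
        field_simp
      · simp [hab])
  refine ⟨u, v, fun a => √(hS.eigenvalues a), fun a b => ?_⟩
  have h1 : ∑ j, ∑ k, u a j * C j k * v b k = inner ℝ (u a) (w b) := by
    simp only [PiLp.inner_apply, hw, Matrix.mulVec, dotProduct]
    refine Finset.sum_congr rfl fun j _ => ?_
    simp only [RCLike.inner_apply, conj_trivial, Finset.sum_mul]
    exact Finset.sum_congr rfl fun k _ => by ring
  rw [h1]
  by_cases hb : hS.eigenvalues b = 0
  · have : w b = 0 := by
      rw [← inner_self_eq_zero (𝕜 := ℝ), hwi, if_pos rfl, hb]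
    rw [this, inner_zero_right]
    split_ifs with h
    · simp [h, hb]
    · rfl
  · have h2 : w b = √(hS.eigenvalues b) • u b := by
      rw [hu b hb, smul_smul, mul_inv_cancel₀, one_smul]
      exact (Real.sqrt_ne_zero (hnn b)).2 hb
    rw [h2, inner_smul_right, orthonormal_iff_ite.1 u.orthonormal]
    split_ifs with h
    · rw [h, mul_one]
    · rw [mul_zero]

/-! ### Correlations in a bipartite state -/

section Correlation

variable {m : ℕ}

/-- `Tr ((A ⊗ B) ψ)` for one register. -/
def pairVal (ψ : Matrix (Fin m × Fin m) (Fin m × Fin m) ℂ) (A B : Matrix (Fin m) (Fin m) ℂ) : ℂ :=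
  ((A ⊗ₖ B) * ψ).trace

theorem sum_smul_kronecker_sum_smul {κ J J' : Type} [Fintype κ] [Fintype J] [Fintype J']
    (c : J → ℂ) (A : J → Matrix κ κ ℂ) (c' : J' → ℂ) (A' : J' → Matrix κ κ ℂ) :
    (∑ j, c j • A j) ⊗ₖ (∑ k, c' k • A' k) = ∑ j, ∑ k, (c j * c' k) • (A j ⊗ₖ A' k) := by
  ext ⟨a, b⟩ ⟨a', b'⟩
  simp only [Matrix.kroneckerMap_apply, Matrix.sum_apply, Matrix.smul_apply, smul_eq_mul,
    Finset.sum_mul, Finset.mul_sum]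
  rw [Finset.sum_comm]
  exact Finset.sum_congr rfl fun j _ => Finset.sum_congr rfl fun k _ => by ring

theorem trace_kronecker_sum_smul {κ J J' : Type} [Fintype κ] [Fintype J] [Fintype J']
    (Ψ : Matrix (κ × κ) (κ × κ) ℂ)
    (c : J → ℂ) (A : J → Matrix κ κ ℂ) (c' : J' → ℂ) (A' : J' → Matrix κ κ ℂ) :
    (((∑ j, c j • A j) ⊗ₖ (∑ k, c' k • A' k)) * Ψ).trace =
      ∑ j, ∑ k, c j * c' k * ((A j ⊗ₖ A' k) * Ψ).trace := by
  simp only [sum_smul_kronecker_sum_smul, Matrix.sum_mul, Matrix.trace_sum, Matrix.smul_mul,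
    Matrix.trace_smul, smul_eq_mul]

theorem corrValue_tens {ι : Type} [Fintype ι] [DecidableEq ι]
    (ψ : Matrix (Fin m × Fin m) (Fin m × Fin m) ℂ) (A A' : ι → Matrix (Fin m) (Fin m) ℂ) :
    corrValue ψ (tens A) (tens A') = ∏ i, pairVal ψ (A i) (A' i) := by
  have h1 : corrValue ψ (tens A) (tens A') = ∑ x : ι → Fin m × Fin m, ∑ y : ι → Fin m × Fin m,
      ∏ i, (A i (x i).1 (y i).1 * A' i (x i).2 (y i).2 * ψ (y i) (x i)) := by
    rw [corrValue, Matrix.trace, ← Equiv.sum_comp (Equiv.arrowProdEquivProdArrow ι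
      (fun _ => Fin m) (fun _ => Fin m))]
    refine Finset.sum_congr rfl fun x _ => ?_
    rw [Matrix.diag, Matrix.mul_apply, ← Equiv.sum_comp (Equiv.arrowProdEquivProdArrow ι
      (fun _ => Fin m) (fun _ => Fin m))]
    refine Finset.sum_congr rfl fun y _ => ?_
    simp only [Matrix.kroneckerMap_apply, tens, tensorState, Matrix.of_apply,
      Finset.prod_mul_distrib]
    rfl
  have h2 : ∀ i, pairVal ψ (A i) (A' i) = ∑ p : Fin m × Fin m, ∑ q : Fin m × Fin m,
      A i p.1 q.1 * A' i p.2 q.2 * ψ q p := fun i => by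
    simp only [pairVal, Matrix.trace, Matrix.diag, Matrix.mul_apply, Matrix.kroneckerMap_apply]
  simp only [h2, Finset.prod_univ_sum, Fintype.piFinset_univ]
  rw [h1]

theorem corrValue_sum_tensorBasis {ι : Type} [Fintype ι] [DecidableEq ι]
    (ψ : Matrix (Fin m × Fin m) (Fin m × Fin m) ℂ) {J J' : Type} [Fintype J] [Fintype J']
    (c : J → ℂ) (A : J → ι → Matrix (Fin m) (Fin m) ℂ) (c' : J' → ℂ)
    (A' : J' → ι → Matrix (Fin m) (Fin m) ℂ) :
    corrValue ψ (∑ j, c j • tens (A j)) (∑ k, c' k • tens (A' k)) =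
      ∑ j, ∑ k, c j * c' k * ∏ i, pairVal ψ (A j i) (A' k i) := by
  rw [corrValue, trace_kronecker_sum_smul]
  exact Finset.sum_congr rfl fun j _ => Finset.sum_congr rfl fun k _ => by
    rw [← corrValue_tens]
    rfl

theorem pairVal_one_right {ψ : Matrix (Fin m × Fin m) (Fin m × Fin m) ℂ}
    (h : margA ψ = (m : ℂ)⁻¹ • (1 : Matrix (Fin m) (Fin m) ℂ)) (A : Matrix (Fin m) (Fin m) ℂ) :
    pairVal ψ A 1 = ntr A := by
  have e : pairVal ψ A 1 = (A * margA ψ).trace := by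
    simp only [pairVal, Matrix.trace, Matrix.diag, Matrix.mul_apply, Matrix.kroneckerMap_apply,
      Fintype.sum_prod_type, margA, Matrix.of_apply, Matrix.one_apply]
    refine Finset.sum_congr rfl fun a _ => ?_
    rw [Finset.sum_comm]
    refine Finset.sum_congr rfl fun a' _ => ?_
    rw [Finset.mul_sum]
    refine Finset.sum_congr rfl fun b _ => ?_
    simp
  rw [e, h, Matrix.mul_smul, Matrix.mul_one, Matrix.trace_smul, ntr, Fintype.card_fin, smul_eq_mul]

theorem pairVal_one_left {ψ : Matrix (Fin m × Fin m) (Fin m × Fin m) ℂ}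
    (h : margB ψ = (m : ℂ)⁻¹ • (1 : Matrix (Fin m) (Fin m) ℂ)) (A : Matrix (Fin m) (Fin m) ℂ) :
    pairVal ψ 1 A = ntr A := by
  have e : pairVal ψ 1 A = (A * margB ψ).trace := by
    simp only [pairVal, Matrix.trace, Matrix.diag, Matrix.mul_apply, Matrix.kroneckerMap_apply,
      Fintype.sum_prod_type, margB, Matrix.of_apply, Matrix.one_apply]
    rw [Finset.sum_comm]
    refine Finset.sum_congr rfl fun b _ => ?_
    have : ∀ a, ∑ a', ∑ b', (if a = a' then (1 : ℂ) else 0) * A b b' * ψ (a', b') (a, b) =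
        ∑ b', A b b' * ψ (a, b') (a, b) := fun a => by
      rw [Finset.sum_eq_single a]
      · simp
      · intro a' _ ha'
        simp [Ne.symm ha']
      · simp
    simp only [this]
    rw [Finset.sum_comm]
    exact Finset.sum_congr rfl fun b' _ => by rw [Finset.mul_sum]
  rw [e, h, Matrix.mul_smul, Matrix.mul_one, Matrix.trace_smul, ntr, Fintype.card_fin, smul_eq_mul]

theorem star_pairVal {ψ : Matrix (Fin m × Fin m) (Fin m × Fin m) ℂ} (hψ : ψ.IsHermitian)
    {A B : Matrix (Fin m) (Fin m) ℂ} (hA : A.IsHermitian) (hB : B.IsHermitian) :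
    star (pairVal ψ A B) = pairVal ψ A B := by
  rw [pairVal, ← Matrix.trace_conjTranspose, Matrix.conjTranspose_mul,
    Matrix.conjTranspose_kronecker, hψ.eq, hA.eq, hB.eq, Matrix.trace_mul_comm]

theorem norm_pairVal_le_maxCorr {ψ : Matrix (Fin m × Fin m) (Fin m × Fin m) ℂ}
    (hpos : 0 < maxCorr ψ) {A B : Matrix (Fin m) (Fin m) ℂ} (hA : A.IsHermitian)
    (hA0 : A.trace = 0) (hB0 : B.trace = 0) (hA1 : nnorm2 A = 1) (hB1 : nnorm2 B = 1) :
    ‖pairVal ψ A B‖ ≤ maxCorr ψ := by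
  refine le_csSup ?_ ⟨A, B, hA0, hB0, hA1, hB1, by rw [hA.eq]; rfl⟩
  -- The supremum of an unbounded set of reals is 0 by convention, so the positivity of `maxCorr ψ`
  -- yields boundedness.
  by_contra h
  exact hpos.ne' (Real.sSup_of_not_bddAbove h)

/-- Rotation of the nontrivial part of a standard basis. -/
def rotBasis [NeZero m] (E : Fin (m ^ 2) → Matrix (Fin m) (Fin m) ℂ)
    (u : {j : Fin (m ^ 2) // j ≠ 0} → {j : Fin (m ^ 2) // j ≠ 0} → ℝ) (j : Fin (m ^ 2)) :
    Matrix (Fin m) (Fin m) ℂ :=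
  if h : j = 0 then 1 else ∑ k, (u ⟨j, h⟩ k : ℂ) • E k

theorem rotBasis_isStdBasis [NeZero m] {E : Fin (m ^ 2) → Matrix (Fin m) (Fin m) ℂ}
    (hE : IsStdBasis m E) {u : {j : Fin (m ^ 2) // j ≠ 0} → {j : Fin (m ^ 2) // j ≠ 0} → ℝ}
    (hu : ∀ a b, ∑ k, u a k * u b k = if a = b then 1 else 0) :
    IsStdBasis m (rotBasis E u) := by
  have hE' : ∀ i j : {j : Fin (m ^ 2) // j ≠ 0}, ninner (E i) (E j) = if i = j then 1 else 0 :=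
    fun i j => by simp [hE.orthonormal, Subtype.ext_iff]
  have h0 : ∀ a : {j : Fin (m ^ 2) // j ≠ 0}, ninner 1 (∑ k, (u a k : ℂ) • E k) = 0 := fun a => by
    rw [ninner_sum_right, ← hE.zero_eq_one]
    refine Finset.sum_eq_zero fun k _ => ?_
    rw [hE.orthonormal, if_neg (Ne.symm k.2), mul_zero]
  have h0' : ∀ a : {j : Fin (m ^ 2) // j ≠ 0}, ninner (∑ k, (u a k : ℂ) • E k) 1 = 0 := fun a => by
    rw [ninner_sum_left, ← hE.zero_eq_one]
    refine Finset.sum_eq_zero fun k _ => ?_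
    rw [hE.orthonormal, if_neg k.2, mul_zero]
  refine ⟨fun j => ?_, fun i j => ?_, fun j hj => ?_⟩
  · unfold rotBasis
    split_ifs
    · exact Matrix.isHermitian_one
    · exact sum_real_smul_isHermitian (fun k => hE.isHermitian _) _
  · unfold rotBasis
    by_cases hi : i = 0
    · by_cases hj : j = 0
      · subst hi hj
        simp only [dif_pos]
        have := hE.orthonormal 0 0
        rwa [hE.zero_eq_one] at this
      · rw [dif_pos hi, dif_neg hj, h0, if_neg fun h : i = j => hj (h.symm.trans hi)]
    · by_cases hj : j = 0
      · rw [dif_neg hi, dif_pos hj, h0', if_neg fun h : i = j => hi (h.trans hj)]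
      · rw [dif_neg hi, dif_neg hj, ninner_sum_real_smul hE', hu]
        by_cases hij : i = j <;> simp [hij]
  · have : j = 0 := Fin.ext (by simpa using hj)
    rw [rotBasis, dif_pos this]

theorem nnorm2_of_isStdBasis {A : Fin (m ^ 2) → Matrix (Fin m) (Fin m) ℂ} (hA : IsStdBasis m A)
    (j : Fin (m ^ 2)) : nnorm2 (A j) = 1 := by
  rw [nnorm2, hA.orthonormal, if_pos rfl, Complex.one_re, Real.sqrt_one]

/-- A pair of standard bases which diagonalizes the correlations of a noisy maximally entangled
state. -/
theorem exists_diagonal_bases [NeZero m] {ψ : Matrix (Fin m × Fin m) (Fin m × Fin m) ℂ}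
    (hψ : IsNoisyMES ψ) (hpos : 0 < maxCorr ψ) :
    ∃ (A B : Fin (m ^ 2) → Matrix (Fin m) (Fin m) ℂ) (c : Fin (m ^ 2) → ℝ), IsStdBasis m A ∧
      IsStdBasis m B ∧ c 0 = 1 ∧ (∀ j, j ≠ 0 → |c j| ≤ maxCorr ψ) ∧
      ∀ j k, pairVal ψ (A j) (B k) = if j = k then (c j : ℂ) else 0 := by
  obtain ⟨E, hE⟩ := exists_isStdBasis (Nat.pos_of_neZero m)
  -- Pairings of Hermitian matrices in the Hermitian state are real, so a real decomposition applies
  -- and its rotations keep the bases Hermitian. The identity is left out: the maximally mixed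
  -- marginals make it uncorrelated with every traceless matrix.
  set C : Matrix {j : Fin (m ^ 2) // j ≠ 0} {j : Fin (m ^ 2) // j ≠ 0} ℝ :=
    Matrix.of fun j k => (pairVal ψ (E j) (E k)).re with hC
  have hCv : ∀ j k : {j : Fin (m ^ 2) // j ≠ 0}, pairVal ψ (E j) (E k) = (C j k : ℂ) := by
    intro j k
    have h := star_pairVal hψ.posSemidef.isHermitian (hE.isHermitian j) (hE.isHermitian k)
    exact (Complex.conj_eq_iff_re.1 h).symm
  obtain ⟨u, v, s, hs⟩ := exists_singular_decomposition C
  have orth : ∀ u : OrthonormalBasis {j : Fin (m ^ 2) // j ≠ 0} ℝ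
      (EuclideanSpace ℝ {j : Fin (m ^ 2) // j ≠ 0}), ∀ a b, ∑ k, u a k * u b k =
        if a = b then 1 else 0 := fun u a b => by
    rw [← (orthonormal_iff_ite.1 u.orthonormal) a b, PiLp.inner_apply]
    exact Finset.sum_congr rfl fun k _ => by simp [mul_comm]
  set A := rotBasis E (fun a k => u a k) with hAdef
  set B := rotBasis E (fun a k => v a k) with hBdef
  have hA : IsStdBasis m A := rotBasis_isStdBasis hE (orth u)
  have hB : IsStdBasis m B := rotBasis_isStdBasis hE (orth v)
  have hval : ∀ a b : {j : Fin (m ^ 2) // j ≠ 0}, pairVal ψ (A a) (B b) =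
      if a = b then (s a : ℂ) else 0 := by
    intro a b
    rw [hAdef, hBdef, rotBasis, dif_neg a.2, rotBasis, dif_neg b.2, pairVal,
      trace_kronecker_sum_smul]
    have h := congrArg (fun x : ℝ => (x : ℂ)) (hs a b)
    simp only [apply_ite Complex.ofReal, Complex.ofReal_zero] at h
    rw [← h]
    push_cast
    refine Finset.sum_congr rfl fun j _ => Finset.sum_congr rfl fun k _ => ?_
    rw [← hCv, pairVal]
    ring
  refine ⟨A, B, fun j => if h : j = 0 then 1 else s ⟨j, h⟩, hA, hB, by simp, ?_, ?_⟩
  · intro j hj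
    have h := hval ⟨j, hj⟩ ⟨j, hj⟩
    rw [if_pos rfl] at h
    have htr : ∀ {A : Fin (m ^ 2) → Matrix (Fin m) (Fin m) ℂ}, IsStdBasis m A →
        (A j).trace = 0 := fun {A} hA => by
      have h1 := hA.orthonormal 0 j
      rw [if_neg (Ne.symm hj), hA.zero_eq_one, ninner, Matrix.conjTranspose_one,
        Matrix.one_mul] at h1
      refine (mul_eq_zero.1 h1).resolve_left ?_
      simp [NeZero.ne m]
    have h2 := norm_pairVal_le_maxCorr hpos (hA.isHermitian j) (htr hA) (htr hB)
      (nnorm2_of_isStdBasis hA j) (nnorm2_of_isStdBasis hB j)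
    rw [h, Complex.norm_real] at h2
    simpa [hj] using h2
  · intro j k
    by_cases hj : j = 0
    · subst hj
      rw [hA.zero_eq_one, pairVal_one_left hψ.margB_eq, hB.ntr_eq]
      by_cases hk : k = 0
      · simp [hk]
      · simp [hk, Ne.symm hk]
    · by_cases hk : k = 0
      · subst hk
        rw [hB.zero_eq_one, pairVal_one_right hψ.margA_eq, hA.ntr_eq]
        simp [hj]
      · rw [hval ⟨j, hj⟩ ⟨k, hk⟩]
        simp [hj]

end Correlation

/-! ### Regrouping the coordinates of a product measure -/

section Regroup

theorem measurePreserving_curry {I J Y : Type} [Fintype I] [Fintype J] [MeasurableSpace Y]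
    (μ : Measure Y) [IsProbabilityMeasure μ] :
    MeasurePreserving (MeasurableEquiv.curry I J Y) (Measure.pi fun _ => μ)
      (Measure.pi fun _ => Measure.pi fun _ => μ) := by
  refine ⟨MeasurableEquiv.measurable _, ?_⟩
  have h := Measure.infinitePi_map_curry (ι := I) (κ := J) (X := Y) (fun _ _ => μ)
  simpa only [Measure.infinitePi_eq_pi] using h

theorem measurePreserving_comp_equiv {I J Y : Type} [Fintype I] [Fintype J] [MeasurableSpace Y]
    (μ : Measure Y) [IsProbabilityMeasure μ] (e : I ≃ J) :
    MeasurePreserving (fun x : J → Y => fun i => x (e i)) (Measure.pi fun _ => μ)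
      (Measure.pi fun _ => μ) := by
  have h := (measurePreserving_piCongrLeft (fun _ : J => μ) e).symm
  exact h

/-- Regrouping coordinates in pairs. -/
theorem measurePreserving_cells {K Y : Type} [Fintype K] [MeasurableSpace Y] {N : ℕ}
    (μ : Measure Y) [IsProbabilityMeasure μ] (e : K × Fin 2 ≃ Fin N) :
    MeasurePreserving (fun (x : Fin N → Y) (k : K) => (x (e (k, 0)), x (e (k, 1))))
      (Measure.pi fun _ => μ) (Measure.pi fun _ => μ.prod μ) := by
  have h1 := measurePreserving_comp_equiv μ e
  have h2 := measurePreserving_curry (I := K) (J := Fin 2) μ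
  have h3 := measurePreserving_pi (fun _ : K => Measure.pi fun _ : Fin 2 => μ)
    (fun _ => μ.prod μ) fun _ => measurePreserving_finTwoArrow μ
  exact h3.comp (h2.comp h1)

theorem measurePreserving_linear_comb {a b : ℝ} (hab : a ^ 2 + b ^ 2 = 1) :
    MeasurePreserving (fun z : ℝ × ℝ => a * z.1 + b * z.2)
      ((gaussianReal 0 1).prod (gaussianReal 0 1)) (gaussianReal 0 1) := by
  refine ⟨by fun_prop, ?_⟩
  have h1 : (fun z : ℝ × ℝ => a * z.1 + b * z.2) =
      (fun z : ℝ × ℝ => z.1 + z.2) ∘ Prod.map (a * ·) (b * ·) := rfl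
  rw [h1, ← Measure.map_map (by fun_prop) (by fun_prop),
    ← Measure.map_prod_map _ _ (by fun_prop) (by fun_prop), gaussianReal_map_const_mul,
    gaussianReal_map_const_mul]
  have h2 := gaussianReal_conv_gaussianReal (m₁ := 0) (m₂ := 0)
    (v₁ := .mk (a ^ 2) (sq_nonneg _) * 1) (v₂ := .mk (b ^ 2) (sq_nonneg _) * 1)
  rw [mul_zero, mul_zero]
  rw [Measure.conv] at h2
  rw [h2, add_zero]
  congr 1
  ext
  simpa using hab

end Regroup

/-! ### The Gaussian variables used for the registers outside `H` -/

section Cells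

variable {m n : ℕ} [NeZero m]

instance (N : ℕ) : IsProbabilityMeasure (gaussN N) := by
  unfold gaussN; infer_instance

/-- The cells: pairs of a register outside `H` and a nontrivial basis index. -/
abbrev Cell (m : ℕ) [NeZero m] (H : Finset (Fin n)) : Type :=
  {k : Fin n × Fin (m ^ 2) // k.1 ∉ H ∧ k.2 ≠ 0}

theorem card_cell_mul_two (H : Finset (Fin n)) :
    Fintype.card (Cell m H × Fin 2) = 2 * (m ^ 2 - 1) * (n - H.card) := by
  have e : Cell m H ≃ {i // i ∉ H} × {j : Fin (m ^ 2) // j ≠ 0} :=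
    Equiv.subtypeProdEquivProd (p := fun i => i ∉ H) (q := fun j : Fin (m ^ 2) => j ≠ 0)
  rw [Fintype.card_prod, Fintype.card_congr e, Fintype.card_prod, Fintype.card_fin]
  have h1 : Fintype.card {i // i ∉ H} = n - H.card := by
    rw [Fintype.card_subtype_compl, Fintype.card_fin, Fintype.card_coe]
  have h2 : Fintype.card {j : Fin (m ^ 2) // j ≠ 0} = m ^ 2 - 1 := by
    rw [Fintype.card_subtype_compl, Fintype.card_fin]
    simp
  rw [h1, h2]
  ring

/-- Two Gaussian coordinates for each cell. -/
def cellEquiv (m : ℕ) [NeZero m] (H : Finset (Fin n)) :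
    Cell m H × Fin 2 ≃ Fin (2 * (m ^ 2 - 1) * (n - H.card)) :=
  Fintype.equivFinOfCardEq (card_cell_mul_two H)

/-- Extension by zero of the cell variables. -/
def extCell (H : Finset (Fin n)) (z : Cell m H → ℝ) (i : Fin n) (j : Fin (m ^ 2)) : ℝ :=
  if h : i ∉ H ∧ j ≠ 0 then z ⟨(i, j), h⟩ else 0

/-- The Gaussian variables `a j x_{i,j,0} + b j x_{i,j,1}`. -/
def cellVars (H : Finset (Fin n)) (a b : Fin (m ^ 2) → ℝ)
    (x : Fin (2 * (m ^ 2 - 1) * (n - H.card)) → ℝ) (k : Cell m H) : ℝ :=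
  a k.1.2 * x (cellEquiv m H (k, 0)) + b k.1.2 * x (cellEquiv m H (k, 1))

theorem measurePreserving_cellVars (H : Finset (Fin n)) {a b : Fin (m ^ 2) → ℝ}
    (hab : ∀ j, a j ^ 2 + b j ^ 2 = 1) :
    MeasurePreserving (cellVars H a b) (gaussN _) (Measure.pi fun _ => gaussianReal 0 1) :=
  (measurePreserving_pi (fun _ : Cell m H => (gaussianReal 0 1).prod (gaussianReal 0 1))
    (fun _ => gaussianReal 0 1) fun k => measurePreserving_linear_comb (hab k.1.2)).comp
    (measurePreserving_cells (gaussianReal 0 1) (cellEquiv m H))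

/-- Gluing the cell variables and the irrelevant variables. -/
def glue (H : Finset (Fin n)) (a b : Fin (m ^ 2) → ℝ)
    (p : (Fin (2 * (m ^ 2 - 1) * (n - H.card)) → ℝ) ×
      ({k : Fin n × Fin (m ^ 2) // ¬ (k.1 ∉ H ∧ k.2 ≠ 0)} → ℝ)) : Fin n → Fin (m ^ 2) → ℝ :=
  MeasurableEquiv.curry (Fin n) (Fin (m ^ 2)) ℝ
    ((MeasurableEquiv.piEquivPiSubtypeProd (fun _ : Fin n × Fin (m ^ 2) => ℝ)
      fun k => k.1 ∉ H ∧ k.2 ≠ 0).symm (cellVars H a b p.1, p.2))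

theorem measurePreserving_glue (H : Finset (Fin n)) {a b : Fin (m ^ 2) → ℝ}
    (hab : ∀ j, a j ^ 2 + b j ^ 2 = 1) :
    MeasurePreserving (glue H a b) ((gaussN _).prod (Measure.pi fun _ => gaussianReal 0 1))
      (gaussFamily m n) := by
  have h1 := (measurePreserving_cellVars H hab).prod
    (MeasurePreserving.id (Measure.pi fun _ : {k : Fin n × Fin (m ^ 2) // ¬ (k.1 ∉ H ∧ k.2 ≠ 0)} =>
      gaussianReal 0 1))
  have h2 := (measurePreserving_piEquivPiSubtypeProd
    (fun _ : Fin n × Fin (m ^ 2) => gaussianReal 0 1) fun k => k.1 ∉ H ∧ k.2 ≠ 0).symm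
  exact (measurePreserving_curry (gaussianReal 0 1)).comp (h2.comp h1)

theorem glue_of_cell (H : Finset (Fin n)) (a b : Fin (m ^ 2) → ℝ)
    (p : (Fin (2 * (m ^ 2 - 1) * (n - H.card)) → ℝ) ×
      ({k : Fin n × Fin (m ^ 2) // ¬ (k.1 ∉ H ∧ k.2 ≠ 0)} → ℝ)) {i : Fin n} {j : Fin (m ^ 2)}
    (h : i ∉ H ∧ j ≠ 0) : glue H a b p i j = extCell H (cellVars H a b p.1) i j := by
  rw [extCell, dif_pos h]
  exact dif_pos h

/-- The hybrid reads only the Gaussians of cells, since index 0 stands for the constant 1 and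
registers in `H` carry none. This permits discarding the other coordinates of the full family. -/
theorem hybridSum_congr (B : Fin (m ^ 2) → Matrix (Fin m) (Fin m) ℂ) (H : Finset (Fin n))
    (c : (Fin n → Fin (m ^ 2)) → ℂ) {ω ω' : Fin n → Fin (m ^ 2) → ℝ}
    (h : ∀ i j, i ∉ H ∧ j ≠ 0 → ω i j = ω' i j) : hybridSum B H c ω = hybridSum B H c ω' := by
  unfold hybridSum hybridBasis
  refine Finset.sum_congr rfl fun σ _ => ?_
  congr 3
  refine Finset.prod_congr rfl fun i hi => ?_
  unfold gvar
  split_ifs with h0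
  · rfl
  · exact h i _ ⟨Finset.mem_compl.1 hi, fun h' => h0 (by rw [h', Fin.val_zero])⟩

/-- Passing from the family of all Gaussian variables to the coordinates used. -/
theorem transfer_hybridSum (B : Fin (m ^ 2) → Matrix (Fin m) (Fin m) ℂ) (H : Finset (Fin n))
    (c : (Fin n → Fin (m ^ 2)) → ℂ) {a b : Fin (m ^ 2) → ℝ}
    (hab : ∀ j, a j ^ 2 + b j ^ 2 = 1) (G : Op m {i // i ∈ H} → ℝ)
    (hG : Integrable (fun ω => G (hybridSum B H c ω)) (gaussFamily m n)) :
    Integrable (fun x => G (hybridSum B H c (extCell H (cellVars H a b x)))) (gaussN _) ∧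
      ∫ x, G (hybridSum B H c (extCell H (cellVars H a b x))) ∂gaussN _ =
        ∫ ω, G (hybridSum B H c ω) ∂gaussFamily m n := by
  have hmp := measurePreserving_glue H hab
  have e : ∀ p, G (hybridSum B H c (glue H a b p)) =
      G (hybridSum B H c (extCell H (cellVars H a b p.1))) := fun p =>
    congrArg G (hybridSum_congr B H c fun i j h => glue_of_cell H a b p h)
  have hi : Integrable (fun p : (Fin (2 * (m ^ 2 - 1) * (n - H.card)) → ℝ) ×
      ({k : Fin n × Fin (m ^ 2) // ¬ (k.1 ∉ H ∧ k.2 ≠ 0)} → ℝ) =>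
      G (hybridSum B H c (extCell H (cellVars H a b p.1))))
      ((gaussN _).prod (Measure.pi fun _ => gaussianReal 0 1)) := by
    have := hmp.integrable_comp_of_integrable hG
    exact this.congr (Filter.Eventually.of_forall e)
  constructor
  -- The integrand ignores the irrelevant coordinates, so integrability of a single section is
  -- already the claim.
  · obtain ⟨y, hy⟩ := hi.prod_left_ae.exists
    exact hy
  · have h := integral_map hmp.measurable.aemeasurable
      (hmp.map_eq.symm ▸ hG.aestronglyMeasurable)
    rw [hmp.map_eq] at h
    rw [h]
    simp only [e]
    rw [integral_prod _ hi]
    simp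

/-- A product of Gaussian variables as a product over the cells. -/
theorem prod_gvar_extCell (H : Finset (Fin n)) (z : Cell m H → ℝ) (σ : Fin n → Fin (m ^ 2)) :
    ∏ i ∈ Hᶜ, gvar (extCell H z) i (σ i) = ∏ k : Cell m H, if σ k.1.1 = k.1.2 then z k else 1 := by
  have h1 : ∏ k : Cell m H, (if σ k.1.1 = k.1.2 then z k else 1) =
      ∏ k : Cell m H, (fun p : Fin n × Fin (m ^ 2) =>
        if σ p.1 = p.2 then extCell H z p.1 p.2 else 1) k.1 := by
    refine Finset.prod_congr rfl fun k _ => ?_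
    simp only [extCell, dif_pos k.2]
  rw [h1, ← Finset.prod_subtype (Finset.univ.filter fun k : Fin n × Fin (m ^ 2) =>
    k.1 ∉ H ∧ k.2 ≠ 0) (by simp) (fun p : Fin n × Fin (m ^ 2) =>
        if σ p.1 = p.2 then extCell H z p.1 p.2 else 1), Finset.prod_filter, Fintype.prod_prod_type,
    ← Finset.prod_filter_mul_prod_filter_not Finset.univ (fun i => i ∈ Hᶜ)]
  have h2 : Finset.univ.filter (fun i => i ∈ Hᶜ) = Hᶜ := by ext; simp
  have h3 : ∏ i ∈ Finset.univ.filter (fun i => ¬ i ∈ Hᶜ), ∏ j : Fin (m ^ 2),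
      (if i ∉ H ∧ j ≠ 0 then (if σ i = j then extCell H z i j else 1) else 1) = 1 := by
    refine Finset.prod_eq_one fun i hi => Finset.prod_eq_one fun j _ => ?_
    rw [if_neg]
    rintro ⟨h, _⟩
    simp at hi
    exact h hi
  rw [h3, mul_one, h2]
  refine Finset.prod_congr rfl fun i hi => ?_
  rw [Finset.prod_eq_single (σ i)]
  · have hi' := Finset.mem_compl.1 hi
    unfold gvar
    by_cases h0 : σ i = 0
    · simp [h0]
    · have : (σ i : ℕ) ≠ 0 := fun h => h0 (Fin.ext (by simpa using h))
      simp [h0, hi']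
  · intro j _ hj
    rw [if_neg (Ne.symm hj), ite_self]
  · simp

end Cells

/-! ### Hermite polynomials and Gaussian integrals -/

section Hermite

open Polynomial

theorem integrable_aeval_gaussianReal (p : ℤ[X]) :
    Integrable (fun x : ℝ => aeval x p) (gaussianReal 0 1) := by
  induction p using Polynomial.induction_on' with
  | add p q hp hq => exact (hp.add hq).congr (Filter.Eventually.of_forall fun x => by simp)
  | monomial n a => simpa [aeval_monomial] using (integrable_pow_gaussianReal n).const_mul (a : ℝ)

theorem integrable_mul_aeval_gaussianReal (p : ℤ[X]) :
    Integrable (fun x : ℝ => x * aeval x p) (gaussianReal 0 1) :=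
  (integrable_aeval_gaussianReal (X * p)).congr
    (Filter.Eventually.of_forall fun x => by simp only [map_mul, aeval_X])

/-- Gaussian integration by parts, which on monomials is the moment recursion. Combined with the
recursion H_{n+1} = x H_n − H_n', it gives the orthogonality of higher Hermite polynomials to 1 and
x, all that functions affine in each coordinate require. -/
theorem integral_mul_aeval_gaussianReal (p : ℤ[X]) :
    ∫ x : ℝ, x * aeval x p ∂gaussianReal 0 1 =
      ∫ x : ℝ, aeval x (derivative p) ∂gaussianReal 0 1 := by
  induction p using Polynomial.induction_on' with
  | add p q hp hq =>
    simp only [map_add, mul_add]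
    rw [integral_add (integrable_mul_aeval_gaussianReal p) (integrable_mul_aeval_gaussianReal q),
      integral_add (integrable_aeval_gaussianReal _) (integrable_aeval_gaussianReal _), hp, hq]
  | monomial n a =>
    have e : ∀ x : ℝ, x * aeval x (monomial n a) = (a : ℝ) * x ^ (n + 1) := fun x => by
      rw [aeval_monomial]
      simp only [eq_intCast]
      ring
    simp only [e]
    simp only [derivative_monomial, aeval_monomial]
    rw [integral_const_mul, integral_const_mul]
    cases n with
    | zero => simp
    | succ n =>
      rw [integral_pow_add_two_gaussianReal]
      simp
      ring

theorem integral_aeval_hermite_succ (n : ℕ) :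
    ∫ x : ℝ, aeval x (hermite (n + 1)) ∂gaussianReal 0 1 = 0 := by
  simp only [hermite_succ, map_sub, map_mul, aeval_X]
  rw [integral_sub (integrable_mul_aeval_gaussianReal _) (integrable_aeval_gaussianReal _),
    integral_mul_aeval_gaussianReal, sub_self]

theorem integral_mul_aeval_hermite_add_two (n : ℕ) :
    ∫ x : ℝ, x * aeval x (hermite (n + 2)) ∂gaussianReal 0 1 = 0 := by
  rw [hermite_succ]
  simp only [map_sub, mul_sub]
  rw [integral_sub (integrable_mul_aeval_gaussianReal _) (integrable_mul_aeval_gaussianReal _),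
    integral_mul_aeval_gaussianReal]
  simp only [derivative_mul, derivative_X, one_mul, map_add, map_mul, aeval_X]
  rw [integral_add (integrable_aeval_gaussianReal _) (integrable_mul_aeval_gaussianReal _),
    integral_aeval_hermite_succ]
  ring

/-- The normalized Hermite polynomial. -/
def hermNorm (s : ℕ) (x : ℝ) : ℝ := aeval x (hermite s) / √(s.factorial : ℝ)

theorem integrable_hermNorm (s : ℕ) : Integrable (hermNorm s) (gaussianReal 0 1) :=
  (integrable_aeval_gaussianReal _).div_const _

theorem integrable_mul_hermNorm (s : ℕ) :
    Integrable (fun x => x * hermNorm s x) (gaussianReal 0 1) := by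
  refine ((integrable_mul_aeval_gaussianReal (hermite s)).div_const (√(s.factorial : ℝ))).congr
    (Filter.Eventually.of_forall fun x => ?_)
  simp only [hermNorm]
  ring

theorem integral_hermNorm {s : ℕ} (hs : 0 < s) : ∫ x, hermNorm s x ∂gaussianReal 0 1 = 0 := by
  obtain ⟨n, rfl⟩ : ∃ n, s = n + 1 := ⟨s - 1, by omega⟩
  simp only [hermNorm]
  rw [integral_div, integral_aeval_hermite_succ, zero_div]

theorem integral_mul_hermNorm {s : ℕ} (hs : 1 < s) :
    ∫ x, x * hermNorm s x ∂gaussianReal 0 1 = 0 := by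
  obtain ⟨n, rfl⟩ : ∃ n, s = n + 2 := ⟨s - 2, by omega⟩
  simp only [hermNorm, ← mul_div_assoc]
  rw [integral_div, integral_mul_aeval_hermite_add_two, zero_div]

/-- The factor of one cell in a Hermite coefficient. -/
def cellFactor (a b : ℝ) (q : Prop) [Decidable q] (s t : ℕ) (z : ℝ × ℝ) : ℝ :=
  hermNorm s z.1 * hermNorm t z.2 * if q then a * z.1 + b * z.2 else 1

theorem cellFactor_of_true (a b : ℝ) {q : Prop} [Decidable q] (hq : q) (s t : ℕ) :
    cellFactor a b q s t = fun z => a * ((z.1 * hermNorm s z.1) * hermNorm t z.2) +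
      b * (hermNorm s z.1 * (z.2 * hermNorm t z.2)) := by
  funext z
  rw [cellFactor, if_pos hq]
  ring

theorem cellFactor_of_false (a b : ℝ) {q : Prop} [Decidable q] (hq : ¬ q) (s t : ℕ) :
    cellFactor a b q s t = fun z => hermNorm s z.1 * hermNorm t z.2 := by
  funext z
  rw [cellFactor, if_neg hq, mul_one]

theorem integrable_cellFactor (a b : ℝ) (q : Prop) [Decidable q] (s t : ℕ) :
    Integrable (cellFactor a b q s t) ((gaussianReal 0 1).prod (gaussianReal 0 1)) := by
  by_cases hq : q
  · rw [cellFactor_of_true a b hq]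
    exact (((integrable_mul_hermNorm s).mul_prod (integrable_hermNorm t)).const_mul a).add
      (((integrable_hermNorm s).mul_prod (integrable_mul_hermNorm t)).const_mul b)
  · rw [cellFactor_of_false a b hq]
    exact (integrable_hermNorm s).mul_prod (integrable_hermNorm t)

/-- A cell carries a linear form in its two coordinates if it is selected and a constant otherwise.
Either one is orthogonal to any product of Hermite polynomials of larger total degree. -/
theorem integral_cellFactor_eq_zero (a b : ℝ) (q : Prop) [Decidable q] {s t : ℕ}
    (h : (if q then 1 else 0) < s + t) :
    ∫ z, cellFactor a b q s t z ∂(gaussianReal 0 1).prod (gaussianReal 0 1) = 0 := by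
  by_cases hq : q
  · rw [if_pos hq] at h
    rw [cellFactor_of_true a b hq, integral_add
      (((integrable_mul_hermNorm s).mul_prod (integrable_hermNorm t)).const_mul a)
      (((integrable_hermNorm s).mul_prod (integrable_mul_hermNorm t)).const_mul b),
      integral_const_mul, integral_const_mul,
      integral_prod_mul (fun u => u * hermNorm s u) (hermNorm t),
      integral_prod_mul (hermNorm s) (fun v => v * hermNorm t v)]
    rcases Nat.eq_zero_or_pos s with rfl | hs
    · rw [integral_hermNorm (s := t) (by omega), integral_mul_hermNorm (s := t) (by omega)]
      simp
    · rw [integral_hermNorm hs]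
      rcases Nat.eq_zero_or_pos t with rfl | ht
      · rw [integral_mul_hermNorm (s := s) (by omega)]
        simp
      · rw [integral_hermNorm ht]
        simp
  · rw [if_neg hq] at h
    rw [cellFactor_of_false a b hq, integral_prod_mul (hermNorm s) (hermNorm t)]
    rcases Nat.eq_zero_or_pos s with rfl | hs
    · rw [integral_hermNorm (s := t) (by omega), mul_zero]
    · rw [integral_hermNorm hs, zero_mul]

end Hermite

/-! ### Hermite expansion of the Gaussian hybrid operators -/

section Expansion

variable {m n : ℕ} [NeZero m]

/-- The product of the Gaussian variables selected by `σ`. -/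
def cellMono (H : Finset (Fin n)) (a b : Fin (m ^ 2) → ℝ) (σ : Fin n → Fin (m ^ 2))
    (x : Fin (2 * (m ^ 2 - 1) * (n - H.card)) → ℝ) : ℝ :=
  ∏ i ∈ Hᶜ, gvar (extCell H (cellVars H a b x)) i (σ i)

theorem hermiteFn_mul_cellMono (H : Finset (Fin n)) (a b : Fin (m ^ 2) → ℝ)
    (σ : Fin n → Fin (m ^ 2)) (τ : Fin (2 * (m ^ 2 - 1) * (n - H.card)) → ℕ)
    (x : Fin (2 * (m ^ 2 - 1) * (n - H.card)) → ℝ) :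
    hermiteFn τ x * cellMono H a b σ x = ∏ k : Cell m H,
      cellFactor (a k.1.2) (b k.1.2) (σ k.1.1 = k.1.2) (τ (cellEquiv m H (k, 0)))
        (τ (cellEquiv m H (k, 1))) (x (cellEquiv m H (k, 0)), x (cellEquiv m H (k, 1))) := by
  have h1 : hermiteFn τ x = ∏ k : Cell m H,
      hermNorm (τ (cellEquiv m H (k, 0))) (x (cellEquiv m H (k, 0))) *
        hermNorm (τ (cellEquiv m H (k, 1))) (x (cellEquiv m H (k, 1))) := by
    rw [hermiteFn, ← Equiv.prod_comp (cellEquiv m H), Fintype.prod_prod_type]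
    refine Finset.prod_congr rfl fun k _ => ?_
    rw [Fin.prod_univ_two]
    rfl
  rw [h1, cellMono, prod_gvar_extCell, ← Finset.prod_mul_distrib]
  rfl

theorem integrable_hermiteFn_mul_cellMono (H : Finset (Fin n)) (a b : Fin (m ^ 2) → ℝ)
    (σ : Fin n → Fin (m ^ 2)) (τ : Fin (2 * (m ^ 2 - 1) * (n - H.card)) → ℕ) :
    Integrable (fun x => hermiteFn τ x * cellMono H a b σ x) (gaussN _) := by
  simp only [hermiteFn_mul_cellMono]
  have h : Integrable (fun z : Cell m H → ℝ × ℝ => ∏ k : Cell m H,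
      cellFactor (a k.1.2) (b k.1.2) (σ k.1.1 = k.1.2) (τ (cellEquiv m H (k, 0)))
        (τ (cellEquiv m H (k, 1))) (z k))
      (Measure.pi fun _ => (gaussianReal 0 1).prod (gaussianReal 0 1)) :=
    Integrable.fintype_prod fun k => integrable_cellFactor _ _ _ _ _
  exact (measurePreserving_cells (gaussianReal 0 1) (cellEquiv m H)).integrable_comp_of_integrable h

theorem integral_hermiteFn_mul_cellMono_eq_zero (H : Finset (Fin n)) (a b : Fin (m ^ 2) → ℝ)
    (σ : Fin n → Fin (m ^ 2)) (τ : Fin (2 * (m ^ 2 - 1) * (n - H.card)) → ℕ) {k : Cell m H}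
    (hk : (if σ k.1.1 = k.1.2 then 1 else 0) <
      τ (cellEquiv m H (k, 0)) + τ (cellEquiv m H (k, 1))) :
    ∫ x, hermiteFn τ x * cellMono H a b σ x ∂gaussN _ = 0 := by
  simp only [hermiteFn_mul_cellMono]
  have hmp := measurePreserving_cells (gaussianReal 0 1) (cellEquiv m H)
  have h : Integrable (fun z : Cell m H → ℝ × ℝ => ∏ k : Cell m H,
      cellFactor (a k.1.2) (b k.1.2) (σ k.1.1 = k.1.2) (τ (cellEquiv m H (k, 0)))
        (τ (cellEquiv m H (k, 1))) (z k))
      (Measure.pi fun _ => (gaussianReal 0 1).prod (gaussianReal 0 1)) :=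
    Integrable.fintype_prod fun k => integrable_cellFactor _ _ _ _ _
  have h2 := integral_map hmp.measurable.aemeasurable
    (hmp.map_eq.symm ▸ h.aestronglyMeasurable)
  rw [hmp.map_eq, integral_fintype_prod_eq_prod (fun k : Cell m H =>
    cellFactor (a k.1.2) (b k.1.2) (σ k.1.1 = k.1.2) (τ (cellEquiv m H (k, 0)))
        (τ (cellEquiv m H (k, 1)))), Finset.prod_eq_zero (Finset.mem_univ k)
        (integral_cellFactor_eq_zero _ _ _ hk)] at h2
  exact h2.symm

/-- The Gaussian hybrid operator with coefficients `c`. -/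
def gaussOp (A : Fin (m ^ 2) → Matrix (Fin m) (Fin m) ℂ) (H : Finset (Fin n))
    (c : (Fin n → Fin (m ^ 2)) → ℂ) (a b : Fin (m ^ 2) → ℝ)
    (x : Fin (2 * (m ^ 2 - 1) * (n - H.card)) → ℝ) : Op m {i // i ∈ H} :=
  hybridSum A H c (extCell H (cellVars H a b x))

theorem gaussOp_eq_sum (A : Fin (m ^ 2) → Matrix (Fin m) (Fin m) ℂ) (H : Finset (Fin n))
    (c : (Fin n → Fin (m ^ 2)) → ℂ) (a b : Fin (m ^ 2) → ℝ)
    (x : Fin (2 * (m ^ 2 - 1) * (n - H.card)) → ℝ) :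
    gaussOp A H c a b x = ∑ σ, (c σ * (cellMono H a b σ x : ℂ)) •
      tensorBasis A fun i : {i // i ∈ H} => σ i := by
  rw [gaussOp, hybridSum]
  refine Finset.sum_congr rfl fun σ _ => ?_
  rw [hybridBasis, smul_smul]
  rfl

theorem fourierCoeff_gaussOp (A B : Fin (m ^ 2) → Matrix (Fin m) (Fin m) ℂ) (H : Finset (Fin n))
    (c : (Fin n → Fin (m ^ 2)) → ℂ) (a b : Fin (m ^ 2) → ℝ)
    (x : Fin (2 * (m ^ 2 - 1) * (n - H.card)) → ℝ) (ν : {i // i ∈ H} → Fin (m ^ 2)) :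
    fourierCoeff B (gaussOp A H c a b x) ν = ∑ σ, (cellMono H a b σ x : ℂ) *
      (c σ * ninner (tensorBasis B ν) (tensorBasis A fun i : {i // i ∈ H} => σ i)) := by
  rw [gaussOp_eq_sum, fourierCoeff, ninner_sum_right]
  exact Finset.sum_congr rfl fun σ _ => by ring

/-- Some monomial of the expansion must contribute, and its integral factorizes over the cells. The
two coordinates of a cell together then have degree at most one, and degree zero unless σ selects
the cell. Multilinearity and the degree bound both follow. -/
theorem exists_of_hermiteCoeff_ne_zero (A B : Fin (m ^ 2) → Matrix (Fin m) (Fin m) ℂ)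
    (H : Finset (Fin n)) (c : (Fin n → Fin (m ^ 2)) → ℂ) (a b : Fin (m ^ 2) → ℝ)
    (ν : {i // i ∈ H} → Fin (m ^ 2)) (τ : Fin (2 * (m ^ 2 - 1) * (n - H.card)) → ℕ)
    (hτ : hermiteCoeff (fun x => fourierCoeff B (gaussOp A H c a b x) ν) τ ≠ 0) :
    ∃ σ, c σ ≠ 0 ∧ ∀ k : Cell m H, τ (cellEquiv m H (k, 0)) + τ (cellEquiv m H (k, 1)) ≤
      if σ k.1.1 = k.1.2 then 1 else 0 := by
  by_contra! hcon
  refine hτ ?_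
  have hint : ∀ σ : Fin n → Fin (m ^ 2), Integrable (fun x =>
      ((hermiteFn τ x * cellMono H a b σ x : ℝ) : ℂ) *
        (c σ * ninner (tensorBasis B ν) (tensorBasis A fun i : {i // i ∈ H} => σ i)))
      (gaussN _) := fun σ => (integrable_hermiteFn_mul_cellMono H a b σ τ).ofReal.mul_const _
  have e : ∀ x, (hermiteFn τ x : ℂ) * fourierCoeff B (gaussOp A H c a b x) ν =
      ∑ σ, ((hermiteFn τ x * cellMono H a b σ x : ℝ) : ℂ) *
        (c σ * ninner (tensorBasis B ν) (tensorBasis A fun i : {i // i ∈ H} => σ i)) := fun x => by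
    rw [fourierCoeff_gaussOp, Finset.mul_sum]
    refine Finset.sum_congr rfl fun σ _ => ?_
    push_cast
    ring
  rw [hermiteCoeff]
  simp only [e]
  rw [integral_finsetSum _ fun σ _ => hint σ]
  refine Finset.sum_eq_zero fun σ _ => ?_
  rw [integral_mul_const]
  by_cases hc : c σ = 0
  · rw [hc, zero_mul, mul_zero]
  · obtain ⟨k, hk⟩ := hcon σ hc
    rw [integral_complex_ofReal, integral_hermiteFn_mul_cellMono_eq_zero H a b σ τ hk]
    simp

theorem isMultilinear_gaussOp (A B : Fin (m ^ 2) → Matrix (Fin m) (Fin m) ℂ)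
    (H : Finset (Fin n)) (c : (Fin n → Fin (m ^ 2)) → ℂ) (a b : Fin (m ^ 2) → ℝ)
    (ν : {i // i ∈ H} → Fin (m ^ 2)) :
    IsMultilinear fun x => fourierCoeff B (gaussOp A H c a b x) ν := by
  rintro τ ⟨l, hl⟩
  by_contra hne
  obtain ⟨σ, -, hσ⟩ := exists_of_hermiteCoeff_ne_zero A B H c a b ν τ hne
  obtain ⟨⟨k, s⟩, rfl⟩ := (cellEquiv m H).surjective l
  have h := hσ k
  have h1 : (if σ k.1.1 = k.1.2 then 1 else 0) ≤ 1 := by split_ifs <;> simp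
  have h2 : τ (cellEquiv m H (k, s)) ≤
      τ (cellEquiv m H (k, 0)) + τ (cellEquiv m H (k, 1)) := by
    fin_cases s <;> simp
  omega

theorem hermiteDegree_gaussOp_le (A B : Fin (m ^ 2) → Matrix (Fin m) (Fin m) ℂ)
    (H : Finset (Fin n)) {c : (Fin n → Fin (m ^ 2)) → ℂ} {d : ℕ}
    (hd : ∀ σ, c σ ≠ 0 → wtNZ σ ≤ d) (a b : Fin (m ^ 2) → ℝ)
    (ν : {i // i ∈ H} → Fin (m ^ 2)) :
    hermiteDegree (fun x => fourierCoeff B (gaussOp A H c a b x) ν) ≤ d := by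
  refine iSup₂_le fun τ hne => ?_
  obtain ⟨σ, hc, hσ⟩ := exists_of_hermiteCoeff_ne_zero A B H c a b ν τ hne
  rw [Nat.cast_le]
  refine le_trans ?_ (hd σ hc)
  have e : ∑ l, τ l = ∑ k : Cell m H, (τ (cellEquiv m H (k, 0)) + τ (cellEquiv m H (k, 1))) := by
    rw [← Equiv.sum_comp (cellEquiv m H), Fintype.sum_prod_type]
    exact Finset.sum_congr rfl fun k _ => Fin.sum_univ_two _
  rw [e]
  refine (Finset.sum_le_sum fun k _ => hσ k).trans ?_
  rw [← Finset.card_filter]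
  -- A selected cell is determined by its register, its second component being the value of σ there.
  -- Hence the selected cells inject into the nonzero entries of σ.
  refine Finset.card_le_card_of_injOn (fun k : Cell m H => k.1.1) ?_ ?_
  · intro k hk
    have hk' : σ k.1.1 = k.1.2 := (Finset.mem_filter.1 hk).2
    refine Finset.mem_filter.2 ⟨Finset.mem_univ _, fun h => k.2.2 ?_⟩
    rw [← hk']
    exact Fin.ext (by simpa using h)
  · intro k hk k' hk' h
    have e1 : σ k.1.1 = k.1.2 := (Finset.mem_filter.1 hk).2
    have e2 : σ k'.1.1 = k'.1.2 := (Finset.mem_filter.1 hk').2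
    have h' : k.1.1 = k'.1.1 := h
    exact Subtype.ext (Prod.ext h' (by rw [← e1, ← e2, h']))

end Expansion

/-! ### Correlated Gaussian variables -/

section CorrGauss

theorem measurePreserving_corrGauss (ρ : ℝ) :
    MeasurePreserving (fun z : ℝ × ℝ => (z.1, ρ * z.1 + √(1 - ρ ^ 2) * z.2))
      ((gaussianReal 0 1).prod (gaussianReal 0 1)) (corrGauss ρ) :=
  ⟨by fun_prop, rfl⟩

instance (ρ : ℝ) : IsProbabilityMeasure (corrGauss ρ) :=
  Measure.isProbabilityMeasure_map (by fun_prop)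

theorem integrable_id_gaussianReal : Integrable (fun x : ℝ => x) (gaussianReal 0 1) := by
  simpa using integrable_pow_gaussianReal 1

theorem integral_fst_gaussian :
    ∫ z : ℝ × ℝ, z.1 ∂(gaussianReal 0 1).prod (gaussianReal 0 1) = 0 := by
  rw [integral_fun_fst (fun x : ℝ => x), integral_id_gaussianReal, smul_zero]

theorem integral_snd_gaussian :
    ∫ z : ℝ × ℝ, z.2 ∂(gaussianReal 0 1).prod (gaussianReal 0 1) = 0 := by
  rw [integral_fun_snd (fun x : ℝ => x), integral_id_gaussianReal, smul_zero]

theorem corrGauss_fst (ρ : ℝ) : Integrable (fun z : ℝ × ℝ => z.1) (corrGauss ρ) ∧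
    ∫ z, z.1 ∂corrGauss ρ = 0 := by
  have hmp := measurePreserving_corrGauss ρ
  constructor
  · exact (hmp.integrable_comp (by fun_prop)).1 (integrable_id_gaussianReal.comp_fst _)
  · rw [← hmp.map_eq, integral_map hmp.measurable.aemeasurable (by fun_prop)]
    exact integral_fst_gaussian

theorem corrGauss_snd (ρ : ℝ) : Integrable (fun z : ℝ × ℝ => z.2) (corrGauss ρ) ∧
    ∫ z, z.2 ∂corrGauss ρ = 0 := by
  have hmp := measurePreserving_corrGauss ρ
  have h1 : Integrable (fun z : ℝ × ℝ => ρ * z.1) ((gaussianReal 0 1).prod (gaussianReal 0 1)) :=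
    (integrable_id_gaussianReal.comp_fst _).const_mul _
  have h2 : Integrable (fun z : ℝ × ℝ => √(1 - ρ ^ 2) * z.2)
      ((gaussianReal 0 1).prod (gaussianReal 0 1)) :=
    (integrable_id_gaussianReal.comp_snd _).const_mul _
  constructor
  · exact (hmp.integrable_comp (by fun_prop)).1 (h1.add h2)
  · rw [← hmp.map_eq, integral_map hmp.measurable.aemeasurable (by fun_prop),
      integral_add h1 h2, integral_const_mul, integral_const_mul, integral_fst_gaussian,
      integral_snd_gaussian]
    ring

theorem corrGauss_mul (ρ : ℝ) : Integrable (fun z : ℝ × ℝ => z.1 * z.2) (corrGauss ρ) ∧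
    ∫ z, z.1 * z.2 ∂corrGauss ρ = ρ := by
  have hmp := measurePreserving_corrGauss ρ
  have h1 : Integrable (fun z : ℝ × ℝ => ρ * z.1 ^ 2)
      ((gaussianReal 0 1).prod (gaussianReal 0 1)) :=
    ((integrable_pow_gaussianReal 2).comp_fst _).const_mul _
  have h2 : Integrable (fun z : ℝ × ℝ => √(1 - ρ ^ 2) * (z.1 * z.2))
      ((gaussianReal 0 1).prod (gaussianReal 0 1)) :=
    (integrable_id_gaussianReal.mul_prod integrable_id_gaussianReal).const_mul _
  have e : ∀ z : ℝ × ℝ, z.1 * (ρ * z.1 + √(1 - ρ ^ 2) * z.2) =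
      ρ * z.1 ^ 2 + √(1 - ρ ^ 2) * (z.1 * z.2) := fun z => by ring
  constructor
  · refine (hmp.integrable_comp (by fun_prop)).1 ?_
    exact (h1.add h2).congr (Filter.Eventually.of_forall fun z => (e z).symm)
  · rw [← hmp.map_eq, integral_map hmp.measurable.aemeasurable (by fun_prop)]
    simp only [e]
    rw [integral_add h1 h2, integral_const_mul, integral_const_mul,
      integral_prod_mul (fun x : ℝ => x) (fun x : ℝ => x),
      integral_fun_fst (fun x : ℝ => x ^ 2), integral_id_gaussianReal]
    have : ∫ x : ℝ, x ^ 2 ∂gaussianReal 0 1 = 1 := gaussMoment_two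
    rw [this]
    simp

/-- The factor of one cell in a correlation. -/
def corrFactor (a b a' b' : ℝ) (q q' : Prop) [Decidable q] [Decidable q']
    (z : (ℝ × ℝ) × (ℝ × ℝ)) : ℝ :=
  (if q then a * z.1.1 + b * z.2.1 else 1) * (if q' then a' * z.1.2 + b' * z.2.2 else 1)

/-- The two coordinate pairs of a cell are independent and centered, so the mixed products vanish
and each matching product contributes ρ. -/
theorem integral_corrFactor (ρ a b a' b' : ℝ) (q q' : Prop) [Decidable q] [Decidable q'] :
    Integrable (corrFactor a b a' b' q q') ((corrGauss ρ).prod (corrGauss ρ)) ∧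
    ∫ z, corrFactor a b a' b' q q' z ∂(corrGauss ρ).prod (corrGauss ρ) =
      if q then (if q' then (a * a' + b * b') * ρ else 0) else (if q' then 0 else 1) := by
  obtain ⟨i1, e1⟩ := corrGauss_fst ρ
  obtain ⟨i2, e2⟩ := corrGauss_snd ρ
  obtain ⟨i3, e3⟩ := corrGauss_mul ρ
  have lin : ∀ (u v : ℝ) (F : ℝ × ℝ → ℝ), Integrable F (corrGauss ρ) → ∫ z, F z ∂corrGauss ρ = 0 →
      Integrable (fun z : (ℝ × ℝ) × (ℝ × ℝ) => u * F z.1 + v * F z.2)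
        ((corrGauss ρ).prod (corrGauss ρ)) ∧
      ∫ z : (ℝ × ℝ) × (ℝ × ℝ), u * F z.1 + v * F z.2 ∂(corrGauss ρ).prod (corrGauss ρ) = 0 := by
    intro u v F hF h0
    have j1 : Integrable (fun z : (ℝ × ℝ) × (ℝ × ℝ) => u * F z.1)
        ((corrGauss ρ).prod (corrGauss ρ)) := (hF.comp_fst _).const_mul _
    have j2 : Integrable (fun z : (ℝ × ℝ) × (ℝ × ℝ) => v * F z.2)
        ((corrGauss ρ).prod (corrGauss ρ)) := (hF.comp_snd _).const_mul _
    refine ⟨j1.add j2, ?_⟩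
    rw [integral_add j1 j2, integral_const_mul, integral_const_mul, integral_fun_fst,
      integral_fun_snd, h0]
    simp
  by_cases hq : q <;> by_cases hq' : q' <;> unfold corrFactor <;>
    simp only [hq, hq', if_true, if_false]
  · have e : ∀ z : (ℝ × ℝ) × (ℝ × ℝ), (a * z.1.1 + b * z.2.1) * (a' * z.1.2 + b' * z.2.2) =
        (a * a') * (z.1.1 * z.1.2) + (b * b') * (z.2.1 * z.2.2) +
          ((a * b') * (z.1.1 * z.2.2) + (b * a') * (z.1.2 * z.2.1)) := fun z => by ring
    have j1 : Integrable (fun z : (ℝ × ℝ) × (ℝ × ℝ) => (a * a') * (z.1.1 * z.1.2))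
        ((corrGauss ρ).prod (corrGauss ρ)) := (i3.comp_fst _).const_mul _
    have j2 : Integrable (fun z : (ℝ × ℝ) × (ℝ × ℝ) => (b * b') * (z.2.1 * z.2.2))
        ((corrGauss ρ).prod (corrGauss ρ)) := (i3.comp_snd _).const_mul _
    have j3 : Integrable (fun z : (ℝ × ℝ) × (ℝ × ℝ) => (a * b') * (z.1.1 * z.2.2))
        ((corrGauss ρ).prod (corrGauss ρ)) := (i1.mul_prod i2).const_mul _
    have j4 : Integrable (fun z : (ℝ × ℝ) × (ℝ × ℝ) => (b * a') * (z.1.2 * z.2.1))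
        ((corrGauss ρ).prod (corrGauss ρ)) := (i2.mul_prod i1).const_mul _
    have j12 : Integrable (fun z : (ℝ × ℝ) × (ℝ × ℝ) => (a * a') * (z.1.1 * z.1.2) +
        (b * b') * (z.2.1 * z.2.2)) ((corrGauss ρ).prod (corrGauss ρ)) := j1.add j2
    have j34 : Integrable (fun z : (ℝ × ℝ) × (ℝ × ℝ) => (a * b') * (z.1.1 * z.2.2) +
        (b * a') * (z.1.2 * z.2.1)) ((corrGauss ρ).prod (corrGauss ρ)) := j3.add j4
    simp only [e]
    refine ⟨j12.add j34, ?_⟩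
    rw [integral_add j12 j34, integral_add j1 j2, integral_add j3 j4, integral_const_mul,
      integral_const_mul, integral_const_mul, integral_const_mul,
      integral_fun_fst (fun z : ℝ × ℝ => z.1 * z.2), integral_fun_snd (fun z : ℝ × ℝ => z.1 * z.2),
      integral_prod_mul (fun z : ℝ × ℝ => z.1) (fun z : ℝ × ℝ => z.2),
      integral_prod_mul (fun z : ℝ × ℝ => z.2) (fun z : ℝ × ℝ => z.1), e1, e2, e3]
    simp
    ring
  · simpa using lin a b (fun z => z.1) i1 e1
  · simpa using lin a' b' (fun z => z.2) i2 e2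
  · simp

end CorrGauss

/-! ### Correlations of the Gaussian hybrid operators -/

section CorrOp

variable {m n : ℕ} [NeZero m]

theorem cellMono_mul_cellMono (H : Finset (Fin n)) (a b a' b' : Fin (m ^ 2) → ℝ)
    (σ σ' : Fin n → Fin (m ^ 2)) (w : Fin (2 * (m ^ 2 - 1) * (n - H.card)) → ℝ × ℝ) :
    cellMono H a b σ (fun l => (w l).1) * cellMono H a' b' σ' (fun l => (w l).2) =
      ∏ k : Cell m H, corrFactor (a k.1.2) (b k.1.2) (a' k.1.2) (b' k.1.2) (σ k.1.1 = k.1.2)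
        (σ' k.1.1 = k.1.2) (w (cellEquiv m H (k, 0)), w (cellEquiv m H (k, 1))) := by
  rw [cellMono, cellMono, prod_gvar_extCell, prod_gvar_extCell, ← Finset.prod_mul_distrib]
  rfl

theorem integral_cellMono_mul (H : Finset (Fin n)) (a b a' b' : Fin (m ^ 2) → ℝ)
    (σ σ' : Fin n → Fin (m ^ 2)) (ρ : ℝ) :
    Integrable (fun w => cellMono H a b σ (fun l => (w l).1) *
      cellMono H a' b' σ' (fun l => (w l).2)) (corrGaussN ρ _) ∧
    ∫ w, cellMono H a b σ (fun l => (w l).1) * cellMono H a' b' σ' (fun l => (w l).2)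
      ∂corrGaussN ρ _ = ∏ k : Cell m H, if σ k.1.1 = k.1.2 then
        (if σ' k.1.1 = k.1.2 then (a k.1.2 * a' k.1.2 + b k.1.2 * b' k.1.2) * ρ else 0) else
        (if σ' k.1.1 = k.1.2 then 0 else 1) := by
  simp only [cellMono_mul_cellMono]
  have hmp := measurePreserving_cells (corrGauss ρ) (cellEquiv m H)
  have h : Integrable (fun z : Cell m H → (ℝ × ℝ) × (ℝ × ℝ) => ∏ k : Cell m H,
      corrFactor (a k.1.2) (b k.1.2) (a' k.1.2) (b' k.1.2) (σ k.1.1 = k.1.2)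
        (σ' k.1.1 = k.1.2) (z k))
      (Measure.pi fun _ => (corrGauss ρ).prod (corrGauss ρ)) :=
    Integrable.fintype_prod fun k => (integral_corrFactor ρ _ _ _ _ _ _).1
  refine ⟨hmp.integrable_comp_of_integrable h, ?_⟩
  have h2 := integral_map hmp.measurable.aemeasurable
    (hmp.map_eq.symm ▸ h.aestronglyMeasurable)
  rw [hmp.map_eq, integral_fintype_prod_eq_prod (fun k : Cell m H =>
    corrFactor (a k.1.2) (b k.1.2) (a' k.1.2) (b' k.1.2) (σ k.1.1 = k.1.2)
        (σ' k.1.1 = k.1.2))] at h2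
  refine h2.symm.trans (Finset.prod_congr rfl fun k _ => (integral_corrFactor ρ _ _ _ _ _ _).2)

theorem corrValue_eq_sum {ψ : Matrix (Fin m × Fin m) (Fin m × Fin m) ℂ}
    {A B : Fin (m ^ 2) → Matrix (Fin m) (Fin m) ℂ} (hA : IsStdBasis m A) (hB : IsStdBasis m B)
    {c : Fin (m ^ 2) → ℝ}
    (hdiag : ∀ j k, pairVal ψ (A j) (B k) = if j = k then (c j : ℂ) else 0)
    (P Q : Op m (Fin n)) :
    corrValue ψ P Q = ∑ σ, fourierCoeff A P σ * fourierCoeff B Q σ * ((∏ i, c (σ i) : ℝ) : ℂ) := by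
  conv_lhs => rw [← sum_fourierCoeff hA P, ← sum_fourierCoeff hB Q]
  refine (corrValue_sum_tensorBasis ψ (fourierCoeff A P) (fun σ i => A (σ i)) (fourierCoeff B Q)
    (fun σ i => B (σ i))).trans (Finset.sum_congr rfl fun σ _ => ?_)
  rw [Finset.sum_eq_single σ]
  · simp [hdiag]
  · intro σ' _ hne
    obtain ⟨i, hi⟩ := Function.ne_iff.1 hne
    rw [Finset.prod_eq_zero (Finset.mem_univ i), mul_zero]
    rw [hdiag, if_neg (Ne.symm hi)]
  · simp

/-- Registers in `H` contribute `c` through the diagonal bases; each selected cell contributes `c`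
through the covariance condition `hab`. For σ ≠ σ' a differing register gives a zero factor: an
off-diagonal pairing inside `H`, a centered Gaussian left unpaired outside. Hence correlations are
reproduced exactly. -/
theorem integral_corrValue_gaussOp {ψ : Matrix (Fin m × Fin m) (Fin m × Fin m) ℂ}
    {A B : Fin (m ^ 2) → Matrix (Fin m) (Fin m) ℂ} {c : Fin (m ^ 2) → ℝ} (hc0 : c 0 = 1)
    (hdiag : ∀ j k, pairVal ψ (A j) (B k) = if j = k then (c j : ℂ) else 0)
    {a b a' b' : Fin (m ^ 2) → ℝ} {ρ : ℝ}
    (hab : ∀ j, j ≠ 0 → (a j * a' j + b j * b' j) * ρ = c j)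
    (H : Finset (Fin n)) (p q : (Fin n → Fin (m ^ 2)) → ℂ) :
    Integrable (fun w => corrValue ψ (gaussOp A H p a b fun l => (w l).1)
      (gaussOp B H q a' b' fun l => (w l).2)) (corrGaussN ρ _) ∧
    ∫ w, corrValue ψ (gaussOp A H p a b fun l => (w l).1)
      (gaussOp B H q a' b' fun l => (w l).2) ∂corrGaussN ρ _ =
      ∑ σ, p σ * q σ * ((∏ i, c (σ i) : ℝ) : ℂ) := by
  have e : ∀ w : Fin (2 * (m ^ 2 - 1) * (n - H.card)) → ℝ × ℝ, corrValue ψ (gaussOp A H p a b fun l => (w l).1)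
      (gaussOp B H q a' b' fun l => (w l).2) = ∑ σ, ∑ σ',
        ((cellMono H a b σ (fun l => (w l).1) * cellMono H a' b' σ' (fun l => (w l).2) : ℝ) : ℂ) *
        (p σ * q σ' * ∏ i : {i // i ∈ H}, pairVal ψ (A (σ i)) (B (σ' i))) := fun w => by
    rw [gaussOp_eq_sum, gaussOp_eq_sum]
    simp only [tensorBasis_eq_tens]
    rw [corrValue_sum_tensorBasis ψ (fun σ => p σ * (cellMono H a b σ (fun l => (w l).1) : ℂ))
      (fun (σ : Fin n → Fin (m ^ 2)) (i : {i // i ∈ H}) => A (σ i))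
      (fun σ => q σ * (cellMono H a' b' σ (fun l => (w l).2) : ℂ))
      (fun (σ : Fin n → Fin (m ^ 2)) (i : {i // i ∈ H}) => B (σ i))]
    refine Finset.sum_congr rfl fun σ _ => Finset.sum_congr rfl fun σ' _ => ?_
    push_cast
    ring
  have hint : ∀ σ σ' : Fin n → Fin (m ^ 2), Integrable
      (fun (w : Fin (2 * (m ^ 2 - 1) * (n - H.card)) → ℝ × ℝ) =>
      ((cellMono H a b σ (fun l => (w l).1) * cellMono H a' b' σ' (fun l => (w l).2) : ℝ) : ℂ) *
        (p σ * q σ' * ∏ i : {i // i ∈ H}, pairVal ψ (A (σ i)) (B (σ' i)))) (corrGaussN ρ _) :=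
    fun σ σ' => (integral_cellMono_mul H a b a' b' σ σ' ρ).1.ofReal.mul_const _
  simp only [e]
  refine ⟨integrable_finsetSum _ fun σ _ => integrable_finsetSum _ fun σ' _ => hint σ σ', ?_⟩
  rw [integral_finsetSum _ fun σ _ => integrable_finsetSum _ fun σ' _ => hint σ σ']
  refine Finset.sum_congr rfl fun σ _ => ?_
  rw [integral_finsetSum _ fun σ' _ => hint σ σ', Finset.sum_eq_single σ]
  · rw [integral_mul_const, integral_complex_ofReal, (integral_cellMono_mul H a b a' b' σ σ ρ).2]
    have h1 : (∏ k : Cell m H, if σ k.1.1 = k.1.2 then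
        (if σ k.1.1 = k.1.2 then (a k.1.2 * a' k.1.2 + b k.1.2 * b' k.1.2) * ρ else 0) else
        (if σ k.1.1 = k.1.2 then 0 else 1)) = ∏ i ∈ Hᶜ, c (σ i) := by
      -- The regrouping over cells is applied with the numbers `c j` in place of Gaussian values;
      -- the convention that index 0 carries the value 1 agrees with `c 0 = 1`.
      have h2 := prod_gvar_extCell H (fun k : Cell m H => c k.1.2) σ
      refine Eq.trans ?_ (h2.symm.trans ?_)
      · refine Finset.prod_congr rfl fun k _ => ?_
        split_ifs
        · exact hab _ k.2.2
        · rfl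
      · refine Finset.prod_congr rfl fun i hi => ?_
        by_cases h0 : σ i = 0
        · simp [gvar, h0, hc0]
        · have : (σ i : ℕ) ≠ 0 := fun h => h0 (Fin.ext (by simpa using h))
          simp [gvar, h0, extCell, Finset.mem_compl.1 hi]
    have h3 : ∏ i : {i // i ∈ H}, pairVal ψ (A (σ i)) (B (σ i)) =
        ((∏ i ∈ H, c (σ i) : ℝ) : ℂ) := by
      rw [Complex.ofReal_prod, ← Finset.prod_coe_sort H]
      exact Finset.prod_congr rfl fun i _ => by rw [hdiag, if_pos rfl]
    rw [h1, h3, ← Finset.prod_mul_prod_compl H]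
    push_cast
    ring
  · intro σ' _ hne
    rw [integral_mul_const, integral_complex_ofReal, (integral_cellMono_mul H a b a' b' σ σ' ρ).2]
    obtain ⟨i, hi⟩ := Function.ne_iff.1 hne
    by_cases hiH : i ∈ H
    · have : ∏ i : {i // i ∈ H}, pairVal ψ (A (σ i)) (B (σ' i)) = 0 :=
        Finset.prod_eq_zero (Finset.mem_univ ⟨i, hiH⟩) (by rw [hdiag, if_neg (Ne.symm hi)])
      rw [this]
      ring
    · by_cases h0 : σ i = 0
      · have h0' : σ' i ≠ 0 := fun h => hi (h.trans h0.symm)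
        rw [Finset.prod_eq_zero (Finset.mem_univ (⟨(i, σ' i), hiH, h0'⟩ : Cell m H))]
        · simp
        · simp [Ne.symm hi]
      · rw [Finset.prod_eq_zero (Finset.mem_univ (⟨(i, σ i), hiH, h0⟩ : Cell m H))]
        · simp
        · simp [hi]
  · simp

end CorrOp

/-! ### Basis independence of the high-degree part -/

section HighDegree

variable {m n : ℕ} [NeZero m] {A B : Fin (m ^ 2) → Matrix (Fin m) (Fin m) ℂ}

/-- In each register a change of standard basis fixes the identity and preserves the traceless part,
so labels with different sets of nonzero entries are orthogonal. This is needed because the tails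
are measured in an arbitrary basis while the maps are built in the diagonalizing ones. -/
theorem wtNZ_eq_of_ninner_ne_zero (hA : IsStdBasis m A) (hB : IsStdBasis m B)
    {σ τ : Fin n → Fin (m ^ 2)} (h : ninner (tensorBasis B σ) (tensorBasis A τ) ≠ 0) :
    wtNZ σ = wtNZ τ := by
  rw [ninner_eq_ntr, tensorBasis_eq_tens, tensorBasis_eq_tens, tens_conjTranspose, tens_mul,
    ntr_tens, Finset.prod_ne_zero_iff] at h
  have key : ∀ i, (σ i : ℕ) = 0 ↔ (τ i : ℕ) = 0 := fun i => by
    have hi := h i (Finset.mem_univ i)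
    have hz : ∀ j : Fin (m ^ 2), (j : ℕ) = 0 ↔ j = 0 := fun j => by
      rw [Fin.ext_iff, Fin.val_zero]
    rw [hz, hz, (hB.isHermitian _).eq] at *
    constructor
    · intro h0
      by_contra h1
      refine hi ?_
      rw [h0, hB.zero_eq_one, Matrix.one_mul, hA.ntr_eq, if_neg h1]
    · intro h0
      by_contra h1
      refine hi ?_
      rw [h0, hA.zero_eq_one, Matrix.mul_one, hB.ntr_eq, if_neg h1]
  unfold wtNZ
  congr 1
  ext i
  simp only [Finset.mem_filter, Finset.mem_univ, true_and, ne_eq, key i]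

theorem highDegree_eq_of_isStdBasis (hA : IsStdBasis m A) (hB : IsStdBasis m B)
    (P : Op m (Fin n)) (d : ℕ) : highDegree A P d = highDegree B P d := by
  have key : ∀ σ, fourierCoeff B (highDegree A P d) σ = fourierCoeff B (highDegree B P d) σ := by
    intro σ
    rw [fourierCoeff_highDegree hB, highDegree, filter_sum_eq, fourierCoeff, ninner_sum_right]
    have h : ∀ τ, (if d < wtNZ τ then fourierCoeff A P τ else 0) *
        ninner (tensorBasis B σ) (tensorBasis A τ) = if d < wtNZ σ then
          fourierCoeff A P τ * ninner (tensorBasis B σ) (tensorBasis A τ) else 0 := fun τ => by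
      by_cases h0 : ninner (tensorBasis B σ) (tensorBasis A τ) = 0
      · simp [h0]
      · rw [wtNZ_eq_of_ninner_ne_zero hA hB h0]
        split_ifs <;> simp
    simp only [h]
    split_ifs
    · rw [fourierCoeff, ← ninner_sum_right, sum_fourierCoeff hA]
    · simp
  calc highDegree A P d = ∑ σ, fourierCoeff B (highDegree A P d) σ • tensorBasis B σ :=
        (sum_fourierCoeff hB _).symm
    _ = ∑ σ, fourierCoeff B (highDegree B P d) σ • tensorBasis B σ :=
        Finset.sum_congr rfl fun σ _ => by rw [key σ]
    _ = highDegree B P d := sum_fourierCoeff hB _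

theorem nsq_highDegree (hA : IsStdBasis m A) (P : Op m (Fin n)) (d : ℕ) :
    nsq (highDegree A P d) = ∑ σ, if d < wtNZ σ then ‖fourierCoeff A P σ‖ ^ 2 else 0 := by
  rw [nsq_eq_sum_fourierCoeff hA]
  refine Finset.sum_congr rfl fun σ _ => ?_
  rw [fourierCoeff_highDegree hA]
  split_ifs <;> simp

theorem lowDegree_add_highDegree (hA : IsStdBasis m A) (P : Op m (Fin n)) (d : ℕ) :
    lowDegree A P d + highDegree A P d = P := by
  conv_rhs => rw [← sum_fourierCoeff hA P]
  rw [lowDegree, highDegree, ← Finset.sum_filter_add_sum_filter_not Finset.univ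
    (fun σ : Fin n → Fin (m ^ 2) => wtNZ σ ≤ d)]
  simp only [not_le]

end HighDegree

/-! ### Comparison with positive operators -/

section Positive

variable {κ : Type} [Fintype κ] [DecidableEq κ]

theorem nsq_star_mul_mul (U : Matrix.unitaryGroup κ ℂ) (R : Matrix κ κ ℂ) :
    nsq ((U : Matrix κ κ ℂ).conjTranspose * R * (U : Matrix κ κ ℂ)) = nsq R := by
  have h1 : (U : Matrix κ κ ℂ) * (U : Matrix κ κ ℂ).conjTranspose = 1 :=
    Unitary.coe_mul_star_self U
  have e : ((U : Matrix κ κ ℂ).conjTranspose * R * (U : Matrix κ κ ℂ)).conjTranspose *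
      ((U : Matrix κ κ ℂ).conjTranspose * R * (U : Matrix κ κ ℂ)) =
      (U : Matrix κ κ ℂ).conjTranspose * (R.conjTranspose * R * (U : Matrix κ κ ℂ)) := by
    simp only [Matrix.conjTranspose_mul, Matrix.conjTranspose_conjTranspose]
    calc _ = (U : Matrix κ κ ℂ).conjTranspose * R.conjTranspose *
          ((U : Matrix κ κ ℂ) * (U : Matrix κ κ ℂ).conjTranspose) * R * (U : Matrix κ κ ℂ) := by
            simp only [Matrix.mul_assoc]
      _ = _ := by rw [h1]; simp only [Matrix.mul_assoc, Matrix.one_mul]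
  rw [nsq, e, ntr_mul_comm, Matrix.mul_assoc, h1, Matrix.mul_one, nsq]

theorem conjTranspose_mul_eigenvectorUnitary {X : Matrix κ κ ℂ} (hX : X.IsHermitian) :
    (hX.eigenvectorUnitary : Matrix κ κ ℂ).conjTranspose * X *
      (hX.eigenvectorUnitary : Matrix κ κ ℂ) =
      Matrix.diagonal fun k => (hX.eigenvalues k : ℂ) := by
  have h := hX.conjStarAlgAut_star_eigenvectorUnitary
  rw [Unitary.conjStarAlgAut_star_apply] at h
  exact h

/-- In an eigenbasis of X the diagonal of P is nonnegative, so at a negative eigenvalue the diagonal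
entry of P − X is at least its absolute value. The squared diagonal is part of the squared Frobenius
norm. -/
theorem trZeta_le_nsq_sub {P X : Matrix κ κ ℂ} (hP : P.PosSemidef) (hX : X.IsHermitian) :
    (Fintype.card κ : ℝ)⁻¹ * trZeta X ≤ nsq (P - X) := by
  set U : Matrix κ κ ℂ := (hX.eigenvectorUnitary : Matrix κ κ ℂ) with hU
  have hP' : (U.conjTranspose * P * U).PosSemidef := hP.conjTranspose_mul_mul_same U
  rw [trZeta_eq hX, ← nsq_star_mul_mul hX.eigenvectorUnitary, nsq_eq_sum, specAvg]
  gcongr with k _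
  refine le_trans ?_ (Finset.single_le_sum (f := fun b =>
    ‖(U.conjTranspose * (P - X) * U) b k‖ ^ 2) (fun b _ => by positivity) (Finset.mem_univ k))
  rw [Matrix.mul_sub, Matrix.sub_mul, conjTranspose_mul_eigenvectorUnitary hX, Matrix.sub_apply,
    Matrix.diagonal_apply_eq]
  have hk : 0 ≤ (U.conjTranspose * P * U) k k := hP'.diag_nonneg
  obtain ⟨r, hr, hr'⟩ : ∃ r : ℝ, 0 ≤ r ∧ (U.conjTranspose * P * U) k k = r := by
    rw [Complex.nonneg_iff] at hk
    exact ⟨_, hk.1, Complex.ext rfl (by simpa using hk.2.symm)⟩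
  rw [hr', ← Complex.ofReal_sub, Complex.norm_real, Real.norm_eq_abs, sq_abs, zeta]
  split_ifs with h
  · nlinarith
  · positivity

theorem nsq_le_one [Nonempty κ] {P : Matrix κ κ ℂ} (hP : P.PosSemidef) (hP' : (1 - P).PosSemidef) :
    nsq P ≤ 1 := by
  have hX := hP.isHermitian
  rw [specAvg_sq hX, specAvg]
  have h1 : ∀ k, hX.eigenvalues k ^ 2 ≤ 1 := fun k => by
    have h := hP'.conjTranspose_mul_mul_same (hX.eigenvectorUnitary : Matrix κ κ ℂ)
    rw [Matrix.mul_sub, Matrix.sub_mul, conjTranspose_mul_eigenvectorUnitary hX, Matrix.mul_one] at h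
    have hU : (hX.eigenvectorUnitary : Matrix κ κ ℂ).conjTranspose *
      (hX.eigenvectorUnitary : Matrix κ κ ℂ) = 1 := Unitary.coe_star_mul_self _
    rw [hU] at h
    have hk : 0 ≤ ((1 : Matrix κ κ ℂ) - Matrix.diagonal fun k => (hX.eigenvalues k : ℂ)) k k :=
      h.diag_nonneg
    rw [Matrix.sub_apply, Matrix.one_apply_eq, Matrix.diagonal_apply_eq, ← Complex.ofReal_one,
      ← Complex.ofReal_sub, Complex.zero_le_real] at hk
    have h0 := hP.eigenvalues_nonneg k
    exact pow_le_one₀ h0 (by linarith)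
  have hc : (0 : ℝ) < Fintype.card κ := by exact_mod_cast Fintype.card_pos
  rw [inv_mul_le_iff₀ hc, mul_one]
  calc ∑ k, hX.eigenvalues k ^ 2 ≤ ∑ _k : κ, (1 : ℝ) := Finset.sum_le_sum fun k _ => h1 k
    _ = Fintype.card κ := by simp

end Positive

/-! ### The random operator attached to an operator -/

section GaussMap

variable {m n : ℕ} [NeZero m] {A : Fin (m ^ 2) → Matrix (Fin m) (Fin m) ℂ}

/-- The low-degree part of `P` with the registers outside `H` replaced by Gaussian variables. -/
def gaussMap (hA : IsStdBasis m A) (H : Finset (Fin n)) (d : ℕ) (a b : Fin (m ^ 2) → ℝ)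
    (P : HermOp m (Fin n)) (x : Fin (2 * (m ^ 2 - 1) * (n - H.card)) → ℝ) :
    HermOp m {i // i ∈ H} :=
  ⟨gaussOp A H (lowCoeff A (P : Op m (Fin n)) d) a b x,
    hybridSum_isHermitian hA H (star_lowCoeff_eq hA P d) _⟩

theorem fourierCoeff_add (P Q : Op m (Fin n)) (σ : Fin n → Fin (m ^ 2)) :
    fourierCoeff A (P + Q) σ = fourierCoeff A P σ + fourierCoeff A Q σ := by
  simp only [fourierCoeff, ninner_eq_ntr, Matrix.mul_add, ntr_add]

theorem fourierCoeff_real_smul (r : ℝ) (P : Op m (Fin n)) (σ : Fin n → Fin (m ^ 2)) :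
    fourierCoeff A (r • P) σ = (r : ℂ) * fourierCoeff A P σ := by
  rw [← Complex.coe_smul, fourierCoeff, ninner_eq_ntr, Matrix.mul_smul, ntr_smul]
  rfl

theorem gaussMap_isLinearMap (hA : IsStdBasis m A) (H : Finset (Fin n)) (d : ℕ)
    (a b : Fin (m ^ 2) → ℝ) (x : Fin (2 * (m ^ 2 - 1) * (n - H.card)) → ℝ) :
    IsLinearMap ℝ fun P : HermOp m (Fin n) => gaussMap hA H d a b P x := by
  constructor
  · intro P Q
    refine Subtype.ext ?_
    change gaussOp A H (lowCoeff A ((P : Op m (Fin n)) + (Q : Op m (Fin n))) d) a b x =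
      gaussOp A H (lowCoeff A (P : Op m (Fin n)) d) a b x +
        gaussOp A H (lowCoeff A (Q : Op m (Fin n)) d) a b x
    rw [gaussOp_eq_sum, gaussOp_eq_sum, gaussOp_eq_sum, ← Finset.sum_add_distrib]
    refine Finset.sum_congr rfl fun σ _ => ?_
    rw [← add_smul, ← add_mul]
    congr 2
    unfold lowCoeff
    split_ifs
    · exact fourierCoeff_add _ _ _
    · simp
  · intro r P
    refine Subtype.ext ?_
    change gaussOp A H (lowCoeff A (r • (P : Op m (Fin n))) d) a b x =
      r • gaussOp A H (lowCoeff A (P : Op m (Fin n)) d) a b x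
    rw [gaussOp_eq_sum, gaussOp_eq_sum, Finset.smul_sum]
    refine Finset.sum_congr rfl fun σ _ => ?_
    have e : ∀ X : Op m {i // i ∈ H}, r • X = (r : ℂ) • X := fun X => (Complex.coe_smul r X).symm
    rw [e, smul_smul, ← mul_assoc]
    congr 2
    unfold lowCoeff
    split_ifs
    · exact fourierCoeff_real_smul _ _ _
    · simp

theorem lowCoeff_one (hA : IsStdBasis m A) (d : ℕ) :
    lowCoeff A (1 : Op m (Fin n)) d = coeffOne m n := by
  have h1 : (1 : Op m (Fin n)) = tensorBasis A 0 := by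
    rw [tensorBasis_eq_tens, ← tens_one]
    congr 1
    funext i
    exact hA.zero_eq_one.symm
  funext σ
  rw [lowCoeff, h1, fourierCoeff, ninner_tensorBasis hA, coeffOne]
  by_cases h : σ = 0
  · subst h
    have : wtNZ (0 : Fin n → Fin (m ^ 2)) = 0 := by simp [wtNZ]
    simp [this]
  · simp [h]

theorem gaussMap_one (hA : IsStdBasis m A) (H : Finset (Fin n)) (d : ℕ)
    (a b : Fin (m ^ 2) → ℝ) (x : Fin (2 * (m ^ 2 - 1) * (n - H.card)) → ℝ) :
    gaussMap hA H d a b 1 x = 1 := by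
  refine Subtype.ext ?_
  change gaussOp A H (lowCoeff A (1 : Op m (Fin n)) d) a b x = 1
  rw [lowCoeff_one hA, gaussOp, hybridSum, Finset.sum_eq_single 0]
  · rw [coeffOne, Pi.single_eq_same, one_smul, hybridBasis, tensorBasis_eq_tens, ← tens_one]
    have : ∏ i ∈ Hᶜ, gvar (extCell H (cellVars H a b x)) i ((0 : Fin n → Fin (m ^ 2)) i) = 1 :=
      Finset.prod_eq_one fun i _ => by simp [gvar]
    rw [this, Complex.ofReal_one, one_smul]
    congr 1
    funext i
    exact hA.zero_eq_one
  · intro σ _ hσ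
    simp [coeffOne, hσ]
  · simp

theorem nsq_hyb_eq_hybridSum (H : Finset (Fin n)) (c : (Fin n → Fin (m ^ 2)) → ℂ)
    (ω : Fin n → Fin (m ^ 2) → ℝ) : nsq (hyb A H c ω) = nsq (hybridSum A H c ω) := by
  rw [hyb_eq_submatrix, nsq_submatrix, nsq_one_kronecker]

theorem integral_nsq_gaussOp (hA : IsStdBasis m A) (H : Finset (Fin n))
    {c : (Fin n → Fin (m ^ 2)) → ℂ} (hc : star c = c) {a b : Fin (m ^ 2) → ℝ}
    (hab : ∀ j, a j ^ 2 + b j ^ 2 = 1) :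
    Integrable (fun x => nsq (gaussOp A H c a b x)) (gaussN _) ∧
      ∫ x, nsq (gaussOp A H c a b x) ∂gaussN _ = sqn c := by
  have h1 := integrable_nsq_hyb hA H hc
  have h2 := integral_nsq_hyb hA H hc
  simp only [nsq_hyb_eq_hybridSum] at h1 h2
  have h := transfer_hybridSum A H c hab nsq h1
  rw [h2] at h
  exact h

theorem continuous_cellMono (H : Finset (Fin n)) (a b : Fin (m ^ 2) → ℝ)
    (σ : Fin n → Fin (m ^ 2)) : Continuous (cellMono H a b σ) := by
  unfold cellMono
  simp only [prod_gvar_extCell]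
  refine continuous_finsetProd _ fun k _ => ?_
  split_ifs
  · unfold cellVars
    fun_prop
  · exact continuous_const

theorem isL2_gaussMap (hA : IsStdBasis m A) (H : Finset (Fin n)) (d : ℕ) {a b : Fin (m ^ 2) → ℝ}
    (hab : ∀ j, a j ^ 2 + b j ^ 2 = 1) {B : Fin (m ^ 2) → Matrix (Fin m) (Fin m) ℂ}
    (hB : IsStdBasis m B) (P : HermOp m (Fin n)) : IsL2 B (gaussMap hA H d a b P) := by
  intro ν
  set c := lowCoeff A (P : Op m (Fin n)) d
  change MemLp (fun x => fourierCoeff B (gaussOp A H c a b x) ν) 2 (gaussN _)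
  have hcont : Continuous fun x => fourierCoeff B (gaussOp A H c a b x) ν := by
    simp only [fourierCoeff_gaussOp]
    exact continuous_finsetSum _ fun σ _ =>
      (Complex.continuous_ofReal.comp (continuous_cellMono H a b σ)).mul continuous_const
  rw [← integrable_norm_rpow_iff hcont.aestronglyMeasurable (by simp) (by simp)]
  have hmeas : AEStronglyMeasurable (fun x => ‖fourierCoeff B (gaussOp A H c a b x) ν‖ ^ 2)
    (gaussN _) := (hcont.norm.pow 2).aestronglyMeasurable
  refine (integral_nsq_gaussOp hA H (star_lowCoeff_eq hA P d) hab).1.mono' (by simpa using hmeas)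
    (Filter.Eventually.of_forall fun x => ?_)
  rw [nsq_eq_sum_fourierCoeff hB]
  have := Finset.single_le_sum (f := fun σ => ‖fourierCoeff B (gaussOp A H c a b x) σ‖ ^ 2)
    (fun σ _ => by positivity) (Finset.mem_univ ν)
  simpa using this

theorem sqn_lowCoeff_le (hA : IsStdBasis m A) (P : Op m (Fin n)) (d : ℕ) :
    sqn (lowCoeff A P d) ≤ nsq P := by
  rw [nsq_eq_sum_fourierCoeff hA]
  exact Finset.sum_le_sum fun σ _ => pow_le_pow_left₀ (norm_nonneg _) (norm_lowCoeff_le _ _ _) 2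

/-- Replacing registers by Gaussians is isometric on coefficients; only the truncation at degree d
can lose norm. -/
theorem randNorm2_gaussMap_le (hA : IsStdBasis m A) (H : Finset (Fin n)) (d : ℕ)
    {a b : Fin (m ^ 2) → ℝ} (hab : ∀ j, a j ^ 2 + b j ^ 2 = 1) (P : HermOp m (Fin n)) :
    randNorm2 (gaussMap hA H d a b P) ≤ nnorm2 (P : Op m (Fin n)) := by
  rw [randNorm2]
  simp only [nnorm2_sq]
  refine Real.sqrt_le_sqrt ?_
  exact (integral_nsq_gaussOp hA H (star_lowCoeff_eq hA P d) hab).2.le.trans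
    (sqn_lowCoeff_le hA _ d)

theorem randIsMultilinear_gaussMap (hA : IsStdBasis m A) (H : Finset (Fin n)) (d : ℕ)
    (a b : Fin (m ^ 2) → ℝ) (B : Fin (m ^ 2) → Matrix (Fin m) (Fin m) ℂ)
    (P : HermOp m (Fin n)) : RandIsMultilinear B (gaussMap hA H d a b P) :=
  fun ν => isMultilinear_gaussOp A B H _ a b ν

theorem randDegree_gaussMap_le (hA : IsStdBasis m A) (H : Finset (Fin n)) (d : ℕ)
    (a b : Fin (m ^ 2) → ℝ) (B : Fin (m ^ 2) → Matrix (Fin m) (Fin m) ℂ)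
    (P : HermOp m (Fin n)) : randDegree B (gaussMap hA H d a b P) ≤ d :=
  iSup_le fun ν => hermiteDegree_gaussOp_le A B H (fun σ => lowCoeff_ne_zero σ) a b ν

/-- The invariance principle compares with ζ of the low-degree part, which is at most the squared
norm of the tail by comparison with P ≥ 0. The bound P ≤ 1 serves to give norm at most 1, and δ is
relaxed to √δ using δ < 1. -/
theorem integral_trZeta_gaussMap_le (hm : 2 ≤ m) (hA : IsStdBasis m A) (H : Finset (Fin n)) {d : ℕ}
    (hd : 0 < d) {τ δ : ℝ} (hτ : 0 < τ) (hδ0 : 0 < δ) (hδ1 : δ < 1) {a b : Fin (m ^ 2) → ℝ}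
    (hab : ∀ j, a j ^ 2 + b j ^ 2 = 1) {B : Fin (m ^ 2) → Matrix (Fin m) (Fin m) ℂ}
    (hB : IsStdBasis m B) (P : HermOp m (Fin n)) (hP : (P : Op m (Fin n)).PosSemidef)
    (hP1 : (1 - (P : Op m (Fin n))).PosSemidef)
    (hinf : ∀ i, i ∉ H → influence i (P : Op m (Fin n)) ≤ τ)
    (hhigh : nnorm2 (highDegree B (P : Op m (Fin n)) d) ^ 2 ≤ δ) :
    Integrable (fun x => trZeta (gaussMap hA H d a b P x : Op m {i // i ∈ H})) (gaussN _) ∧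
    ∫ x, trZeta (gaussMap hA H d a b P x : Op m {i // i ∈ H}) ∂gaussN _ ≤
      2 * ((m : ℝ) ^ H.card *
        (((3 : ℝ) ^ d * (m : ℝ) ^ ((d : ℝ) / 2) * Real.sqrt τ * d) ^ (2 / 3 : ℝ) +
          Real.sqrt δ)) := by
  have hi := integrable_trZeta_hybridLow hA H d P
  simp only [hybridLow_eq_hybridSum] at hi
  obtain ⟨h1, h2⟩ := transfer_hybridSum A H (lowCoeff A (P : Op m (Fin n)) d) hab trZeta hi
  refine ⟨h1, ?_⟩
  have hn : nnorm2 (P : Op m (Fin n)) ≤ 1 := by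
    have := Real.sqrt_le_sqrt (nsq_le_one hP hP1)
    rwa [Real.sqrt_one] at this
  have hb := invariance_low hm hA hd hτ P H hn hinf
  simp only [hybridLow_eq_hybridSum] at hb
  have hz : ((m : ℝ) ^ n)⁻¹ * trZeta (lowDegree A (P : Op m (Fin n)) d) ≤ √δ := by
    have hherm : (lowDegree A (P : Op m (Fin n)) d).IsHermitian := by
      -- The low-degree part is the hybrid without Gaussian registers, so the point ω = 0 is an
      -- arbitrary choice.
      have := hyb_isHermitian hA Finset.univ (star_lowCoeff_eq hA P d) 0
      rwa [hyb_univ, ← lowDegree_eq_sum_lowCoeff] at this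
    have h := trZeta_le_nsq_sub hP hherm
    rw [card_registers_inv] at h
    refine h.trans ?_
    have e : (P : Op m (Fin n)) - lowDegree A (P : Op m (Fin n)) d =
        highDegree A (P : Op m (Fin n)) d := by
      rw [sub_eq_iff_eq_add', lowDegree_add_highDegree hA]
    rw [e, highDegree_eq_of_isStdBasis hA hB, ← nnorm2_sq]
    refine hhigh.trans ?_
    exact Real.le_sqrt_of_sq_le (by nlinarith)
  have hmpos : (0 : ℝ) < (m : ℝ) ^ H.card := by
    have : 0 < m := by omega
    positivity
  have h3 := (abs_le.1 hb).2
  have e4 : ∫ x, trZeta (gaussMap hA H d a b P x : Op m {i // i ∈ H}) ∂gaussN _ =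
      ∫ ω, trZeta (hybridSum A H (lowCoeff A (P : Op m (Fin n)) d) ω) ∂gaussFamily m n := h2
  rw [e4]
  generalize ∫ ω, trZeta (hybridSum A H (lowCoeff A (P : Op m (Fin n)) d) ω) ∂gaussFamily m n = I
    at h3 ⊢
  generalize ((3 : ℝ) ^ d * (m : ℝ) ^ ((d : ℝ) / 2) * Real.sqrt τ * d) ^ (2 / 3 : ℝ) = X at h3 ⊢
  have h5 : ((m : ℝ) ^ H.card)⁻¹ * I ≤ 2 * (X + √δ) := by
    have := Real.sqrt_nonneg δ
    linarith
  rw [inv_mul_le_iff₀ hmpos] at h5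
  linarith

/-- The correlations of the low-degree parts. -/
theorem norm_corrValue_sub_le {ψ : Matrix (Fin m × Fin m) (Fin m × Fin m) ℂ}
    {B : Fin (m ^ 2) → Matrix (Fin m) (Fin m) ℂ} (hA : IsStdBasis m A) (hB : IsStdBasis m B)
    {c : Fin (m ^ 2) → ℝ} (hc1 : ∀ j, |c j| ≤ 1)
    (hdiag : ∀ j k, pairVal ψ (A j) (B k) = if j = k then (c j : ℂ) else 0)
    (P Q : Op m (Fin n)) (d : ℕ) {δ : ℝ} (hP : nsq (highDegree A P d) ≤ δ)
    (hQ : nsq (highDegree B Q d) ≤ δ) :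
    ‖corrValue ψ P Q - ∑ σ, lowCoeff A P d σ * lowCoeff B Q d σ * ((∏ i, c (σ i) : ℝ) : ℂ)‖ ≤
      δ := by
  rw [corrValue_eq_sum hA hB hdiag, ← Finset.sum_sub_distrib]
  refine (norm_sum_le _ _).trans ?_
  rw [nsq_highDegree hA] at hP
  rw [nsq_highDegree hB] at hQ
  -- Terms of degree at most d cancel. For the others the product of the `c (σ i)` is at most 1 in
  -- absolute value, and the arithmetic–geometric mean bounds the term by the average of the two
  -- tail contributions.
  have key : ∀ σ : Fin n → Fin (m ^ 2), ‖fourierCoeff A P σ * fourierCoeff B Q σ *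
      ((∏ i, c (σ i) : ℝ) : ℂ) - lowCoeff A P d σ * lowCoeff B Q d σ *
        ((∏ i, c (σ i) : ℝ) : ℂ)‖ ≤
      ((if d < wtNZ σ then ‖fourierCoeff A P σ‖ ^ 2 else 0) +
        (if d < wtNZ σ then ‖fourierCoeff B Q σ‖ ^ 2 else 0)) / 2 := by
    intro σ
    by_cases h : wtNZ σ ≤ d
    · simp [lowCoeff, h, not_lt.2 h]
    · have h' : d < wtNZ σ := not_le.1 h
      simp only [lowCoeff, h, h', if_true, if_false, zero_mul, sub_zero, norm_mul,
        Complex.norm_real]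
      have hprod : ‖∏ i, c (σ i)‖ ≤ 1 := by
        rw [Real.norm_eq_abs, Finset.abs_prod]
        exact Finset.prod_le_one (fun i _ => abs_nonneg _) fun i _ => hc1 _
      have h1 : 0 ≤ ‖fourierCoeff A P σ‖ := norm_nonneg _
      have h2 : 0 ≤ ‖fourierCoeff B Q σ‖ := norm_nonneg _
      generalize ‖fourierCoeff A P σ‖ = u at h1
      generalize ‖fourierCoeff B Q σ‖ = v at h2
      calc u * v * ‖∏ i, c (σ i)‖ ≤ u * v * 1 := by gcongr
        _ ≤ (u ^ 2 + v ^ 2) / 2 := by nlinarith [sq_nonneg (u - v)]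
  refine (Finset.sum_le_sum fun σ _ => key σ).trans ?_
  rw [← Finset.sum_div, Finset.sum_add_distrib]
  linarith

end GaussMap

/-! ### The joint statement for a pair of operators -/

theorem joint_invariance_exists :
    ∃ C : ℝ, 0 < C ∧
      ∀ (m n d : ℕ), 1 < m → 0 < d →
      ∀ (τ δ : ℝ), 0 < τ → τ < 1 → 0 < δ → δ < 1 →
      ∀ (H : Finset (Fin n)), H.card < n →
      ∀ (ψ : Matrix (Fin m × Fin m) (Fin m × Fin m) ℂ), IsNoisyMES ψ → 0 < maxCorr ψ →
      ∃ f f' : HermOp m (Fin n) → (Fin (2 * (m ^ 2 - 1) * (n - H.card)) → ℝ) →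
          HermOp m {i // i ∈ H},
        (∀ x, IsLinearMap ℝ (fun P => f P x) ∧ f 1 x = 1 ∧
          IsLinearMap ℝ (fun Q => f' Q x) ∧ f' 1 x = 1) ∧
        ∀ (B : Fin (m ^ 2) → Matrix (Fin m) (Fin m) ℂ), IsStdBasis m B →
          (∀ P, IsL2 B (f P) ∧ IsL2 B (f' P)) ∧
          ∀ P Q : HermOp m (Fin n),
            (P : Op m (Fin n)).PosSemidef → (1 - (P : Op m (Fin n))).PosSemidef →
            (Q : Op m (Fin n)).PosSemidef → (1 - (Q : Op m (Fin n))).PosSemidef →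
            (∀ i, i ∉ H → influence i (P : Op m (Fin n)) ≤ τ) →
            (∀ i, i ∉ H → influence i (Q : Op m (Fin n)) ≤ τ) →
            nnorm2 (highDegree B (P : Op m (Fin n)) d) ^ 2 ≤ δ →
            nnorm2 (highDegree B (Q : Op m (Fin n)) d) ^ 2 ≤ δ →
            RandIsMultilinear B (f P) ∧ randDegree B (f P) ≤ d ∧
            RandIsMultilinear B (f' Q) ∧ randDegree B (f' Q) ≤ d ∧
            randNorm2 (f P) ≤ nnorm2 (P : Op m (Fin n)) ∧
            randNorm2 (f' Q) ≤ nnorm2 (Q : Op m (Fin n)) ∧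
            Integrable (fun w => corrValue ψ (f P fun k => (w k).1 : Op m {i // i ∈ H})
                (f' Q fun k => (w k).2)) (corrGaussN (maxCorr ψ) _) ∧
            ‖corrValue ψ (P : Op m (Fin n)) (Q : Op m (Fin n)) -
                ∫ w, corrValue ψ (f P fun k => (w k).1 : Op m {i // i ∈ H})
                  (f' Q fun k => (w k).2) ∂corrGaussN (maxCorr ψ) _‖ ≤ δ ∧
            Integrable (fun x => trZeta (f P x : Op m {i // i ∈ H})) (gaussN _) ∧
            ∫ x, trZeta (f P x : Op m {i // i ∈ H}) ∂gaussN _ ≤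
              C * ((m : ℝ) ^ H.card *
                (((3 : ℝ) ^ d * (m : ℝ) ^ ((d : ℝ) / 2) * Real.sqrt τ * d) ^ (2 / 3 : ℝ) +
                  Real.sqrt δ)) ∧
            Integrable (fun x => trZeta (f' Q x : Op m {i // i ∈ H})) (gaussN _) ∧
            ∫ x, trZeta (f' Q x : Op m {i // i ∈ H}) ∂gaussN _ ≤
              C * ((m : ℝ) ^ H.card *
                (((3 : ℝ) ^ d * (m : ℝ) ^ ((d : ℝ) / 2) * Real.sqrt τ * d) ^ (2 / 3 : ℝ) +
                  Real.sqrt δ)) := by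
  refine ⟨2, two_pos, fun m n d hm hd τ δ hτ _ hδ hδ1 H _ ψ hψ hpos => ?_⟩
  have : NeZero m := ⟨by omega⟩
  obtain ⟨A, A', c, hA, hA', hc0, hcρ, hdiag⟩ := exists_diagonal_bases hψ hpos
  set ρ := maxCorr ψ with hρ
  set a' : Fin (m ^ 2) → ℝ := fun j => if j = 0 then 1 else c j / ρ with ha'
  set b' : Fin (m ^ 2) → ℝ := fun j => √(1 - a' j ^ 2) with hb'
  have hc1 : ∀ j, |c j| ≤ 1 := fun j => by
    by_cases hj : j = 0
    · simp [hj, hc0]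
    · exact (hcρ j hj).trans hψ.maxCorr_lt_one.le
  have habf : ∀ j : Fin (m ^ 2), (fun _ : Fin (m ^ 2) => (1 : ℝ)) j ^ 2 +
      (fun _ : Fin (m ^ 2) => (0 : ℝ)) j ^ 2 = 1 := fun j => by simp
  have hab' : ∀ j, a' j ^ 2 + b' j ^ 2 = 1 := fun j => by
    have h1 : a' j ^ 2 ≤ 1 := by
      rw [sq_le_one_iff_abs_le_one]
      by_cases hj : j = 0
      · simp [ha', hj]
      · simp only [ha', hj, if_false]
        rw [abs_div, abs_of_pos hpos, div_le_one hpos]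
        exact hcρ j hj
    simp only [hb']
    rw [Real.sq_sqrt (by linarith)]
    ring
  have hcov : ∀ j, j ≠ 0 → ((fun _ : Fin (m ^ 2) => (1 : ℝ)) j * a' j +
      (fun _ : Fin (m ^ 2) => (0 : ℝ)) j * b' j) * ρ = c j := fun j hj => by
    simp only [ha', hj, if_false]
    field_simp
    ring
  refine ⟨gaussMap hA H d (fun _ => 1) (fun _ => 0), gaussMap hA' H d a' b', fun x =>
    ⟨gaussMap_isLinearMap hA H d _ _ x, gaussMap_one hA H d _ _ x,
      gaussMap_isLinearMap hA' H d _ _ x, gaussMap_one hA' H d _ _ x⟩, fun B hB =>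
    ⟨fun P => ⟨isL2_gaussMap hA H d habf hB P, isL2_gaussMap hA' H d hab' hB P⟩, ?_⟩⟩
  intro P Q hP hP1 hQ hQ1 hPi hQi hPd hQd
  obtain ⟨z1, z2⟩ := integral_trZeta_gaussMap_le hm hA H hd hτ hδ hδ1 habf hB P hP hP1 hPi hPd
  obtain ⟨z3, z4⟩ := integral_trZeta_gaussMap_le hm hA' H hd hτ hδ hδ1 hab' hB Q hQ hQ1 hQi hQd
  obtain ⟨w1, w2⟩ := integral_corrValue_gaussOp hc0 hdiag hcov H
    (lowCoeff A (P : Op m (Fin n)) d) (lowCoeff A' (Q : Op m (Fin n)) d)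
  refine ⟨randIsMultilinear_gaussMap hA H d _ _ B P, randDegree_gaussMap_le hA H d _ _ B P,
    randIsMultilinear_gaussMap hA' H d _ _ B Q, randDegree_gaussMap_le hA' H d _ _ B Q,
    randNorm2_gaussMap_le hA H d habf P, randNorm2_gaussMap_le hA' H d hab' Q, w1, ?_,
    z1, z2, z3, z4⟩
  rw [nnorm2_sq, highDegree_eq_of_isStdBasis hB hA] at hPd
  rw [nnorm2_sq, highDegree_eq_of_isStdBasis hB hA'] at hQd
  have h := norm_corrValue_sub_le hA hA' hc1 hdiag (P : Op m (Fin n)) (Q : Op m (Fin n)) d hPd hQd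
  rw [← w2] at h
  exact h

end QuantumInvariance
end

theorem lemma10p6 :
    -- the invariance principle with a free parameter `lam`
    (∃ C : ℝ, 0 < C ∧
      ∀ (m n : ℕ), 1 < m →
      ∀ (B : Fin (m ^ 2) → Matrix (Fin m) (Fin m) ℂ), IsStdBasis m B →
      ∀ (M : HermOp m (Fin n)) (H : Finset (Fin n)) (lam : ℝ), 0 < lam →
        Integrable (fun ω => trZeta (hybrid B H (M : Op m (Fin n)) ω)) (gaussFamily m n) ∧
        |(∫ ω, ((m : ℝ) ^ H.card)⁻¹ * trZeta (hybrid B H (M : Op m (Fin n)) ω) ∂gaussFamily m n) -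
            ((m : ℝ) ^ n)⁻¹ * trZeta (M : Op m (Fin n))| ≤
          C * (lam ^ 2 +
            (3 : ℝ) ^ opDegree B (M : Op m (Fin n)) *
              (m : ℝ) ^ ((opDegree B (M : Op m (Fin n)) : ℝ) / 2) / lam *
              ∑ i ∈ Hᶜ, influence i (M : Op m (Fin n)) ^ (3 / 2 : ℝ))) ∧
    -- the version for operators with small influences outside `H`
    (∃ C : ℝ, 0 < C ∧
      ∀ (m n d : ℕ), 1 < m → 0 < d →
      ∀ (τ : ℝ), 0 < τ → τ < 1 →
      ∀ (B : Fin (m ^ 2) → Matrix (Fin m) (Fin m) ℂ), IsStdBasis m B →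
      ∀ (M : HermOp m (Fin n)) (H : Finset (Fin n)),
        nnorm2 (M : Op m (Fin n)) ≤ 1 →
        (∀ i, i ∉ H → influence i (M : Op m (Fin n)) ≤ τ) →
        Integrable (fun ω => trZeta (hybridLow B H d (M : Op m (Fin n)) ω)) (gaussFamily m n) ∧
        |((m : ℝ) ^ H.card)⁻¹ *
              (∫ ω, trZeta (hybridLow B H d (M : Op m (Fin n)) ω) ∂gaussFamily m n) -
            ((m : ℝ) ^ n)⁻¹ * trZeta (lowDegree B (M : Op m (Fin n)) d)| ≤
          C * ((3 : ℝ) ^ d * (m : ℝ) ^ ((d : ℝ) / 2) * Real.sqrt τ * d) ^ (2 / 3 : ℝ)) ∧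
    -- the joint version for a pair of operators between `0` and `1`
    (∃ C : ℝ, 0 < C ∧
      ∀ (m n d : ℕ), 1 < m → 0 < d →
      ∀ (τ δ : ℝ), 0 < τ → τ < 1 → 0 < δ → δ < 1 →
      ∀ (H : Finset (Fin n)), H.card < n →
      ∀ (ψ : Matrix (Fin m × Fin m) (Fin m × Fin m) ℂ), IsNoisyMES ψ → 0 < maxCorr ψ →
      ∃ f f' : HermOp m (Fin n) → (Fin (2 * (m ^ 2 - 1) * (n - H.card)) → ℝ) →
          HermOp m {i // i ∈ H},
        -- both maps are linear and unital
        (∀ x, IsLinearMap ℝ (fun P => f P x) ∧ f 1 x = 1 ∧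
          IsLinearMap ℝ (fun Q => f' Q x) ∧ f' 1 x = 1) ∧
        ∀ (B : Fin (m ^ 2) → Matrix (Fin m) (Fin m) ℂ), IsStdBasis m B →
          -- both maps take values in the square-integrable random operators
          (∀ P, IsL2 B (f P) ∧ IsL2 B (f' P)) ∧
          ∀ P Q : HermOp m (Fin n),
            (P : Op m (Fin n)).PosSemidef → (1 - (P : Op m (Fin n))).PosSemidef →
            (Q : Op m (Fin n)).PosSemidef → (1 - (Q : Op m (Fin n))).PosSemidef →
            (∀ i, i ∉ H → influence i (P : Op m (Fin n)) ≤ τ) →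
            (∀ i, i ∉ H → influence i (Q : Op m (Fin n)) ≤ τ) →
            nnorm2 (highDegree B (P : Op m (Fin n)) d) ^ 2 ≤ δ →
            nnorm2 (highDegree B (Q : Op m (Fin n)) d) ^ 2 ≤ δ →
            RandIsMultilinear B (f P) ∧ randDegree B (f P) ≤ d ∧
            RandIsMultilinear B (f' Q) ∧ randDegree B (f' Q) ≤ d ∧
            randNorm2 (f P) ≤ nnorm2 (P : Op m (Fin n)) ∧
            randNorm2 (f' Q) ≤ nnorm2 (Q : Op m (Fin n)) ∧
            Integrable (fun w => corrValue ψ (f P fun k => (w k).1 : Op m {i // i ∈ H})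
                (f' Q fun k => (w k).2)) (corrGaussN (maxCorr ψ) _) ∧
            ‖corrValue ψ (P : Op m (Fin n)) (Q : Op m (Fin n)) -
                ∫ w, corrValue ψ (f P fun k => (w k).1 : Op m {i // i ∈ H})
                  (f' Q fun k => (w k).2) ∂corrGaussN (maxCorr ψ) _‖ ≤ δ ∧
            Integrable (fun x => trZeta (f P x : Op m {i // i ∈ H})) (gaussN _) ∧
            ∫ x, trZeta (f P x : Op m {i // i ∈ H}) ∂gaussN _ ≤
              C * ((m : ℝ) ^ H.card *
                (((3 : ℝ) ^ d * (m : ℝ) ^ ((d : ℝ) / 2) * Real.sqrt τ * d) ^ (2 / 3 : ℝ) +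
                  Real.sqrt δ)) ∧
            Integrable (fun x => trZeta (f' Q x : Op m {i // i ∈ H})) (gaussN _) ∧
            ∫ x, trZeta (f' Q x : Op m {i // i ∈ H}) ∂gaussN _ ≤
              C * ((m : ℝ) ^ H.card *
                (((3 : ℝ) ^ d * (m : ℝ) ^ ((d : ℝ) / 2) * Real.sqrt τ * d) ^ (2 / 3 : ℝ) +
                  Real.sqrt δ))) := by
  exact ⟨invariance_exists, invariance_low_exists, joint_invariance_exists⟩
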